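/- Let $(\Omega,\mathcal F,\mathbb P)$ be a probability space and $\theta$ an invertible, bi-measurable, measure-preserving transformation of $\Omega$. Let $\mathcal F_0\subset\mathcal F$ be a $\sigma$-algebra with $\mathcal F_0\subset\theta^{-1}(\mathcal F_0)$, and for $n\in\mathbb Z$ put $\mathcal F_n:=\theta^{-n}(\mathcal F_0)$, $\mathbb E_n:=\mathbb E(\cdot\,|\,\mathcal F_n)$, $P_n:=\mathbb E_n-\mathbb E_{n-1}$; let $\mathcal F_{-\infty}=\bigcap_n\mathcal F_n$ and $\mathcal F_\infty=\bigvee_n\mathcal F_n$. Let $\mathcal X$ be a separable real Banach space with norm $|\cdot|$ which is $2$-smooth: for some $L_0\ge1$, $|x+y|^2+|x-y|^2\le 2(|x|^2+L_0^2|y|^2)$ for all $x,y\in\mathcal X$. Write $\|Z\|_2=(\mathbb E|Z|^2)^{1/2}$, $\|Z\|_{p,\infty}=\sup_{t>0}t\,\mathbb P(|Z|>t)^{1/p}$, $L(x)=\max(\log x,1)$, $S_n(Z)=\sum_{k=0}^{n-1}Z\circ\theta^k$ and $\mathcal M_2(Z)=\sup_{n\ge1}|S_n(Z)|/\sqrt{nL(L(n))}$.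 Let $\xi\in L^2(\Omega,\mathcal F_0,\mathbb P,\mathcal X)$ with $\mathbb E(\xi\,|\,\mathcal F_{-1})=0$, and $\xi_i=\xi\circ\theta^i$. Let $(A_i)_{i\in\mathbb Z}$ be random bounded linear operators on $\mathcal X$ such that $\omega\mapsto A_i(\omega)x$ is $\mathcal F_{-i-1}$-measurable (up to null sets) for every $x\in\mathcal X$ and $i\in\mathbb Z$, and $$\sum_{i\in\mathbb Z}\|A_i\|_\infty<\infty ,\qquad \|A_i\|_\infty:=\operatorname{ess\,sup}_\omega\|A_i(\omega)\|_{\mathcal X\to\mathcal X}.$$ Consider the stationary linear process $X_n=X_0\circ\theta^n=\sum_{i\in\mathbb Z}(A_i\circ\theta^n)\,\xi_{n-i}$, $n\in\mathbb Z$, where $X_0=\sum_{i\in\mathbb Z}A_i\,\xi_{-i}$ (so $X_n=\sum_iA_i\xi_{n-i}$ if the $A_i$ are deterministic). Then: 1. For every $n$ the series defining $X_n$ converges unconditionally, almost surely and in $L^2(\Omega,\mathcal X)$. 2. $X_0$ is regular, i.e. $\mathbb E(X_0|\mathcal F_{-\infty})=0$ and $\mathbb E(X_0|\mathcal F_\infty)=X_0$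 almost surely, and satisfies the Hannan condition $\|X_0\|_{H_2}:=\sum_{n\in\mathbb Z}\|P_nX_0\|_2<\infty$. 3. For every $1\le p<2$ there is a constant $C_p>0$ depending only on $p$ such that, whenever $D\ge1$ satisfies $\mathbb E|d_1+\dots+d_N|^2\le D^2\sum_{n=1}^N\mathbb E|d_n|^2$ for all finite sequences of square-integrable $\mathcal X$-valued martingale differences (on any probability space), $$\|\mathcal M_2(X_0)\|_{p,\infty}\le C_p\,D\,\|X_0\|_{H_2}.$$ 4. The series $\sum_{n\in\mathbb Z}P_1(X_n)$ converges unconditionally in $L^2$ to some $d\in L^2(\Omega,\mathcal F_1,\mathcal X)$ with $\mathbb E_0(d)=0$, and $$\Big|\sum_{k=0}^{n-1}X_k-\sum_{k=0}^{n-1}d\circ\theta^k\Big|=o\big(\sqrt{nL(L(n))}\big)\qquad\mathbb P\text{-a.s.}$$ -/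

import Mathlib

open MeasureTheory Filter Topology
open scoped ENNReal NNReal

universe u v

noncomputable section

/-- A real normed space is `2`-smooth if for some `L ≥ 1`, for all `x, y`,
`|x + y|² + |x - y|² ≤ 2 (|x|² + L² |y|²)`. -/
def IsTwoSmooth (E : Type*) [NormedAddCommGroup E] [NormedSpace ℝ E] : Prop :=
  ∃ L : ℝ, 1 ≤ L ∧ ∀ x y : E, ‖x + y‖ ^ 2 + ‖x - y‖ ^ 2 ≤ 2 * (‖x‖ ^ 2 + L ^ 2 * ‖y‖ ^ 2)

/-- The martingale inequality with constant `D`: for all square integrable `E`-valued martingale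
differences `d 0, …, d (N - 1)` (with `d n` measurable with respect to `𝒢 (n + 1)` and centered
given `𝒢 n`) on any probability space, `𝔼 |d 0 + ⋯ + d (N - 1)|² ≤ D² ∑ n < N, 𝔼 |d n|²`.
A `2`-smooth space for which this holds is called `(2, D)`-smooth. -/
def MartingaleInequality (E : Type v) [NormedAddCommGroup E] [NormedSpace ℝ E] [CompleteSpace E]
    (D : ℝ) : Prop :=
  ∀ (Ω : Type u) [m : MeasurableSpace Ω] (P : Measure Ω) [IsProbabilityMeasure P]
    (𝒢 : Filtration ℕ m) (N : ℕ) (d : ℕ → Ω → E),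
    (∀ n < N, StronglyMeasurable[𝒢 (n + 1)] (d n)) →
    (∀ n < N, MemLp (d n) 2 P) →
    (∀ n < N, P[d n | 𝒢 n] =ᵐ[P] 0) →
    ∫ ω, ‖∑ n ∈ Finset.range N, d n ω‖ ^ 2 ∂P
      ≤ D ^ 2 * ∑ n ∈ Finset.range N, ∫ ω, ‖d n ω‖ ^ 2 ∂P

/-- `L = max (log, 1)`. -/
def logOne (x : ℝ) : ℝ := max (Real.log x) 1

/-- The normalization `√(n L(L(n)))` of the law of the iterated logarithm. -/
def lilNorm (n : ℕ) : ℝ := Real.sqrt (n * logOne (logOne n))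

section Dynamics

variable {Ω : Type u} (ℱ₀ : MeasurableSpace Ω) [m : MeasurableSpace Ω] {E : Type v} [NormedAddCommGroup E]
  [NormedSpace ℝ E]

/-- The iterate `θⁿ`, `n ∈ ℤ`, of an invertible bi-measurable transformation. -/
def iter (θ : Ω ≃ᵐ Ω) (n : ℤ) : Ω → Ω := ⇑((θ.toEquiv : Equiv.Perm Ω) ^ n)

/-- The `σ`-algebra `ℱ n = θ⁻ⁿ(ℱ₀)`. -/
@[reducible] def filt (θ : Ω ≃ᵐ Ω) (n : ℤ) : MeasurableSpace Ω :=
  MeasurableSpace.comap (iter θ n) ℱ₀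

/-- The partial sums `S_n(X) = ∑ k < n, X ∘ θᵏ`. -/
def partialSum (θ : Ω ≃ᵐ Ω) (X : Ω → E) (n : ℕ) (ω : Ω) : E :=
  ∑ k ∈ Finset.range n, X (iter θ k ω)

/-- The maximal function `ℳ₂(X) = sup_{n ≥ 1} |S_n(X)| / √(n L(L(n)))`, with values in `[0, ∞]`. -/
def maxFun (θ : Ω ≃ᵐ Ω) (X : Ω → E) (ω : Ω) : ℝ≥0∞ :=
  ⨆ (n : ℕ) (_ : 1 ≤ n), ENNReal.ofReal (‖partialSum θ X n ω‖ / lilNorm n)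

/-- The weak norm `‖Z‖_{p,∞} = sup_{t > 0} t (P(Z > t))^{1/p}` of a `[0, ∞]`-valued `Z`. -/
def weakNorm (p : ℝ) (P : Measure Ω) (Z : Ω → ℝ≥0∞) : ℝ≥0∞ :=
  ⨆ (t : ℝ≥0) (_ : 0 < t), (t : ℝ≥0∞) * P {ω | (t : ℝ≥0∞) < Z ω} ^ (1 / p)

/-- The stationary linear process `X_n = ∑ i ∈ ℤ, (A_i ∘ θⁿ) ξ_{n-i}`, where `ξ_j = ξ ∘ θʲ`
(a pointwise sum). -/
def linearProcess (θ : Ω ≃ᵐ Ω) (A : ℤ → Ω → E →L[ℝ] E) (ξ : Ω → E) (n : ℤ) (ω : Ω) : E :=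
  ∑' i : ℤ, A i (iter θ n ω) (ξ (iter θ (n - i) ω))

variable [CompleteSpace E]

/-- The projection `P_n X = 𝔼(X | ℱ n) - 𝔼(X | ℱ (n-1))`. -/
def proj (P : Measure Ω) (θ : Ω ≃ᵐ Ω) (n : ℤ) (X : Ω → E) : Ω → E :=
  P[X | filt ℱ₀ θ n] - P[X | filt ℱ₀ θ (n - 1)]

/-- `‖X‖_{H₂} = ∑ n ∈ ℤ, ‖P_n X‖₂`. -/
def hannanNorm (P : Measure Ω) (θ : Ω ≃ᵐ Ω) (X : Ω → E) : ℝ≥0∞ :=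
  ∑' n : ℤ, eLpNorm (proj ℱ₀ P θ n X) 2 P

/-- `X` is regular: `𝔼(X | ℱ_{-∞}) = 0` and `X = 𝔼(X | ℱ_∞)`. -/
def IsRegularVar (P : Measure Ω) (θ : Ω ≃ᵐ Ω) (X : Ω → E) : Prop :=
  P[X | ⨅ n : ℤ, filt ℱ₀ θ n] =ᵐ[P] 0 ∧ X =ᵐ[P] P[X | ⨆ n : ℤ, filt ℱ₀ θ n]

end Dynamics

end

/-! Grouping by innovations, `X₀ = ∑ⱼ Yⱼ` with `Yⱼ = A₋ⱼ ξⱼ`. As `A₋ⱼ` is `ℱ_{j-1}`-measurable and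
bounded, `Yⱼ` is a martingale difference for `ℱⱼ`, with `‖Yⱼ‖₂ ≤ ‖A₋ⱼ‖_∞ ‖ξ‖₂`. So the series
converges absolutely in `L²`, `Pⱼ X₀ = Yⱼ`, and the Hannan norm is `∑ⱼ ‖Yⱼ‖₂` (`IsHannanFamily`).
The maximal function is subadditive, so by Minkowski it suffices to prove `‖ℳ₂(Y)‖_p ≤ C_p D ‖Y‖₂`
for one stationary sequence of martingale differences `Y ∘ θᵏ`.

Normalise `D ‖Y‖₂ ≤ 1` and cut the `k`-th difference, for `k + 1` in the dyadic block of `2 ^ m`, at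
a level of order `√(2 ^ m / L(L(2 ^ m)))`. The large parts form an absolutely convergent weighted
series. The recentred small parts obey a Freedman inequality, outside an event where Birkhoff
averages of the conditional variance are large; the maximal ergodic theorem controls that event. The
tail at `z = 2 ^ j` is of order `j² / 4 ^ j`, summable against `2 ^ (p j)` for `p < 2`
(`SmoothMajorant.measure_exists_lilNorm_lt_le`).

Freedman's argument needs a function with a second-order upper expansion, here `exp √(1 + a² f)`
with `f` a smooth majorant of `‖·‖²` (`SmoothMajorant.exists_exp_le`). To have a constant linear in
`D`, `f` must itself be smooth with constant `D`. Such an `f` is extracted from the martingale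
inequality in the manner of Burkholder and Pisier, as a supremum over Paley-Walsh martingales
(`MartingaleInequality.smoothMajorant`). Where the constant does not matter, `f = ‖·‖²` is enough.

For the approximation, `d = ∑ₙ Y_{1-n} ∘ θⁿ`. Then `X₀ - d` is a series of coboundaries. The sums of
each are `o(√n)` by Borel-Cantelli, and the maximal functions form an almost surely summable bound,
so dominated convergence in the index concludes (`IsHannanFamily.ae_isLittleO_sum_sub`). -/

/-- `f` is a `2`-homogeneous convex function, comparable with `‖·‖²`, which satisfies the two-point
smoothness inequality with constant `D`. -/
structure SmoothMajorant {E : Type*} [NormedAddCommGroup E] [NormedSpace ℝ E] (f : E → ℝ) (D : ℝ) :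
    Prop where
  one_le : 1 ≤ D
  convex : ConvexOn ℝ Set.univ f
  smul : ∀ (t : ℝ) (x : E), f (t • x) = t ^ 2 * f x
  ge : ∀ x, ‖x‖ ^ 2 ≤ f x
  le : ∀ x, f x ≤ D ^ 2 * ‖x‖ ^ 2
  two_point : ∀ x y, f (x + y) + f (x - y) ≤ 2 * f x + 2 * D ^ 2 * ‖y‖ ^ 2

/-! ### Convexity, duality and second-order bounds for smooth majorants. -/

namespace SmoothMajorant

variable {E : Type*} [NormedAddCommGroup E] [NormedSpace ℝ E] {f : E → ℝ} {D : ℝ}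

theorem nonneg (h : SmoothMajorant f D) (x : E) : 0 ≤ f x := (sq_nonneg _).trans (h.ge x)

theorem norm_le_sqrt (h : SmoothMajorant f D) (x : E) : ‖x‖ ≤ √(f x) :=
  Real.le_sqrt_of_sq_le (h.ge x)

theorem sqrt_le (h : SmoothMajorant f D) (x : E) : √(f x) ≤ D * ‖x‖ := by
  have := h.one_le
  rw [Real.sqrt_le_left (by positivity), mul_pow]
  exact h.le x

theorem sqrt_smul (h : SmoothMajorant f D) (t : ℝ) (x : E) : √(f (t • x)) = |t| * √(f x) := by
  rw [h.smul, Real.sqrt_mul (sq_nonneg _), Real.sqrt_sq_eq_abs]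

/-- Convexity and homogeneity make `√f` a gauge: `x + y` is an average, with weights `a / (a + b)`
and `b / (a + b)`, of multiples of `x` and `y` at which `√f` equals `a + b`. -/
theorem sqrt_add_le (h : SmoothMajorant f D) (x y : E) : √(f (x + y)) ≤ √(f x) + √(f y) := by
  rcases eq_or_ne x 0 with rfl | hx
  · simp
  rcases eq_or_ne y 0 with rfl | hy
  · simp
  have hx' : 0 < √(f x) := (norm_pos_iff.2 hx).trans_le (h.norm_le_sqrt x)
  have hy' : 0 < √(f y) := (norm_pos_iff.2 hy).trans_le (h.norm_le_sqrt y)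
  set a := √(f x)
  set b := √(f y)
  have ha : f x = a ^ 2 := (Real.sq_sqrt (h.nonneg x)).symm
  have hb : f y = b ^ 2 := (Real.sq_sqrt (h.nonneg y)).symm
  rw [Real.sqrt_le_left (by positivity)]
  have key := h.convex.2 (Set.mem_univ (((a + b) / a) • x)) (Set.mem_univ (((a + b) / b) • y))
    (show 0 ≤ a / (a + b) by positivity) (show 0 ≤ b / (a + b) by positivity) (by field_simp)
  rw [smul_smul, smul_smul, h.smul, h.smul, ha, hb] at key
  have e1 : a / (a + b) * ((a + b) / a) = 1 := by field_simp
  have e2 : b / (a + b) * ((a + b) / b) = 1 := by field_simp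
  rw [e1, e2, one_smul, one_smul] at key
  refine key.trans (le_of_eq ?_)
  simp only [smul_eq_mul]
  field_simp

theorem abs_sqrt_sub_le (h : SmoothMajorant f D) (x y : E) :
    |√(f (x + y)) - √(f x)| ≤ D * ‖y‖ := by
  rw [abs_sub_le_iff]
  constructor
  · linarith [h.sqrt_add_le x y, h.sqrt_le y]
  · have := h.sqrt_add_le (x + y) (-y)
    have h2 := h.sqrt_le (-y)
    rw [norm_neg] at h2
    rw [add_neg_cancel_right] at this
    linarith

theorem continuous_sqrt (h : SmoothMajorant f D) : Continuous fun x => √(f x) := by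
  have : LipschitzWith D.toNNReal fun x => √(f x) := by
    refine LipschitzWith.of_dist_le_mul fun x y => ?_
    have := h.abs_sqrt_sub_le y (x - y)
    rw [add_sub_cancel] at this
    rw [Real.dist_eq, dist_eq_norm, Real.coe_toNNReal _ (zero_le_one.trans h.one_le)]
    exact this
  exact this.continuous

theorem continuous (h : SmoothMajorant f D) : Continuous f := by
  have : f = fun x => √(f x) ^ 2 := funext fun x => (Real.sq_sqrt (h.nonneg x)).symm
  rw [this]
  exact h.continuous_sqrt.pow 2

/-- Hahn-Banach for the sublinear function `√f` gives a norming functional at `x`; it is continuous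
because `√f ≤ D ‖·‖`. -/
theorem exists_dual (h : SmoothMajorant f D) (x : E) :
    ∃ φ : E →L[ℝ] ℝ, φ x = √(f x) ∧ ∀ y, φ y ≤ √(f y) := by
  have h0 : √(f 0) = 0 := by simpa using h.sqrt_smul 0 0
  rcases eq_or_ne x 0 with rfl | hx
  · exact ⟨0, by simp [h0], fun y => by simp⟩
  obtain ⟨g, hg1, hg2⟩ := exists_extension_of_le_sublinear
    (LinearPMap.mkSpanSingleton x (√(f x)) hx) (fun y => √(f y))
    (fun c hc y => by rw [h.sqrt_smul, abs_of_pos hc]) h.sqrt_add_le (by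
      rintro ⟨y, hy⟩
      obtain ⟨c, rfl⟩ := Submodule.mem_span_singleton.1 hy
      rw [LinearPMap.mkSpanSingleton'_apply, h.sqrt_smul, smul_eq_mul]
      exact mul_le_mul_of_nonneg_right (le_abs_self c) (Real.sqrt_nonneg _))
  have hbd : ∀ y, ‖g y‖ ≤ D * ‖y‖ := fun y => by
    rw [Real.norm_eq_abs, abs_le']
    refine ⟨(hg2 y).trans (h.sqrt_le y), ?_⟩
    have := (hg2 (-y)).trans (h.sqrt_le (-y))
    rwa [map_neg, norm_neg] at this
  refine ⟨g.mkContinuous D hbd, ?_, fun y => hg2 y⟩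
  have := hg1 ⟨x, Submodule.mem_span_singleton_self x⟩
  simp only [LinearMap.mkContinuous_apply]
  rw [this]
  exact LinearPMap.mkSpanSingleton_apply ℝ ℝ hx _

/-- By `two_point`, an upper bound at `x + y` follows from a lower bound at `x - y`, namely `f (x -
y) ≥ φ (x - y) ^ 2` with `φ` norming at `x`. No differentiability of `f` is needed. -/
theorem exists_tangent (h : SmoothMajorant f D) (x : E) :
    ∃ l : E →L[ℝ] ℝ, ∀ y, f (x + y) ≤ f x + l y + 2 * D ^ 2 * ‖y‖ ^ 2 := by
  obtain ⟨φ, hφ, hle⟩ := h.exists_dual x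
  refine ⟨(2 * √(f x)) • φ, fun y => ?_⟩
  have hsq : ∀ z, φ z ^ 2 ≤ f z := fun z => by
    have h1 := hle z
    have h2 := hle (-z)
    have h3 : f (-z) = f z := by simpa using h.smul (-1) z
    rw [map_neg, h3] at h2
    rw [← Real.sq_sqrt (h.nonneg z)]
    exact sq_le_sq' (by linarith) h1
  have h1 := hsq (x - y)
  rw [map_sub, hφ] at h1
  have h2 := h.two_point x y
  have h3 := Real.sq_sqrt (h.nonneg x)
  simp only [smul_apply, smul_eq_mul]
  nlinarith [sq_nonneg (φ y)]

theorem abs_sqrt_one_add_sub_le {a b : ℝ} (ha : 0 ≤ a) (hb : 0 ≤ b) :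
    |√(1 + a ^ 2) - √(1 + b ^ 2)| ≤ |a - b| := by
  have h1 : 0 < √(1 + a ^ 2) := by positivity
  have h2 : 0 < √(1 + b ^ 2) := by positivity
  have e1 := Real.sq_sqrt (show (0:ℝ) ≤ 1 + a ^ 2 by positivity)
  have e2 := Real.sq_sqrt (show (0:ℝ) ≤ 1 + b ^ 2 by positivity)
  have l1 : a ≤ √(1 + a ^ 2) := Real.le_sqrt_of_sq_le (by linarith)
  have l2 : b ≤ √(1 + b ^ 2) := Real.le_sqrt_of_sq_le (by linarith)
  have e : (√(1 + a ^ 2) - √(1 + b ^ 2)) * (√(1 + a ^ 2) + √(1 + b ^ 2)) = (a - b) * (a + b) := by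
    nlinarith
  have h3 : |√(1 + a ^ 2) - √(1 + b ^ 2)| * (√(1 + a ^ 2) + √(1 + b ^ 2)) = |a - b| * (a + b) := by
    have := congrArg abs e
    rwa [abs_mul, abs_mul, abs_of_nonneg (add_nonneg ha hb), abs_of_pos (add_pos h1 h2)] at this
  by_contra hlt
  push Not at hlt
  nlinarith [abs_nonneg (a - b)]

/-- With `s`, `w` the roots at `x` and `x + y`, combine `e ^ u ≤ 1 + u + u ^ 2` for `|u| ≤ 1` with
`w - s ≤ (w ^ 2 - s ^ 2) / (2 s)`, and bound `w ^ 2 - s ^ 2` by the tangent inequality. -/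
theorem exists_exp_le (h : SmoothMajorant f D) {a : ℝ} (ha : 0 ≤ a) (x : E) :
    ∃ l : E →L[ℝ] ℝ, ∀ y, a * D * ‖y‖ ≤ 1 →
      Real.exp (√(1 + a ^ 2 * f (x + y))) ≤
        Real.exp (√(1 + a ^ 2 * f x)) * (1 + l y + 2 * a ^ 2 * D ^ 2 * ‖y‖ ^ 2) := by
  obtain ⟨l, hl⟩ := h.exists_tangent x
  set s := √(1 + a ^ 2 * f x) with hs
  have hfx := h.nonneg x
  have hs1 : 1 ≤ s := Real.le_sqrt_of_sq_le (by nlinarith [mul_nonneg (sq_nonneg a) hfx])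
  refine ⟨(a ^ 2 / (2 * s)) • l, fun y hy => ?_⟩
  have hD := h.one_le
  have hfy := h.nonneg (x + y)
  set w := √(1 + a ^ 2 * f (x + y)) with hw
  have hw0 : 0 ≤ w := Real.sqrt_nonneg _
  have es : s ^ 2 = 1 + a ^ 2 * f x := Real.sq_sqrt (by positivity)
  have ew : w ^ 2 = 1 + a ^ 2 * f (x + y) := Real.sq_sqrt (by positivity)
  have hu : |w - s| ≤ a * D * ‖y‖ := by
    have h1 := abs_sqrt_one_add_sub_le (mul_nonneg ha (Real.sqrt_nonneg (f (x + y))))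
      (mul_nonneg ha (Real.sqrt_nonneg (f x)))
    rw [mul_pow, mul_pow, Real.sq_sqrt hfx, Real.sq_sqrt hfy, ← mul_sub, abs_mul,
      abs_of_nonneg ha] at h1
    calc |w - s| ≤ a * |√(f (x + y)) - √(f x)| := h1
      _ ≤ a * (D * ‖y‖) := by gcongr; exact h.abs_sqrt_sub_le x y
      _ = _ := by ring
  have hexp : Real.exp (w - s) ≤ 1 + (w - s) + (w - s) ^ 2 := by
    have := Real.abs_exp_sub_one_sub_id_le (hu.trans hy)
    linarith [(abs_le.1 this).2]
  have hsq : (w - s) ^ 2 ≤ a ^ 2 * D ^ 2 * ‖y‖ ^ 2 := by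
    rw [← sq_abs]
    calc |w - s| ^ 2 ≤ (a * D * ‖y‖) ^ 2 := by gcongr
      _ = _ := by ring
  have hws : w - s ≤ (a ^ 2 / (2 * s)) * l y + a ^ 2 * D ^ 2 * ‖y‖ ^ 2 := by
    have h1 : (w - s) * (2 * s) ≤ a ^ 2 * (l y + 2 * D ^ 2 * ‖y‖ ^ 2) := by
      have : (w - s) * (2 * s) ≤ w ^ 2 - s ^ 2 := by nlinarith [sq_nonneg (w - s)]
      rw [ew, es] at this
      nlinarith [hl y, sq_nonneg a]
    have h2 : w - s ≤ a ^ 2 * (l y + 2 * D ^ 2 * ‖y‖ ^ 2) / (2 * s) := by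
      rwa [le_div_iff₀ (by positivity)]
    refine h2.trans ?_
    -- Dividing by `s` is harmless since `1 ≤ s`, the purpose of the `1` under the root. This term
    -- and `hsq` each give `a ^ 2 * D ^ 2 * ‖y‖ ^ 2`, whence the factor 2 in the conclusion.
    have h3 : a ^ 2 * (2 * D ^ 2 * ‖y‖ ^ 2) / (2 * s) ≤ a ^ 2 * D ^ 2 * ‖y‖ ^ 2 := by
      rw [div_le_iff₀ (by positivity)]
      nlinarith [show 0 ≤ a ^ 2 * D ^ 2 * ‖y‖ ^ 2 by positivity]
    calc _ = (a ^ 2 / (2 * s)) * l y + a ^ 2 * (2 * D ^ 2 * ‖y‖ ^ 2) / (2 * s) := by ring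
      _ ≤ _ := by linarith
  have : Real.exp w = Real.exp s * Real.exp (w - s) := by rw [← Real.exp_add]; ring_nf
  rw [this]
  gcongr
  simp only [smul_apply, smul_eq_mul]
  linarith

end SmoothMajorant

theorem smoothMajorant_norm_sq {E : Type*} [NormedAddCommGroup E] [NormedSpace ℝ E] {L : ℝ}
    (hL : 1 ≤ L)
    (h : ∀ x y : E, ‖x + y‖ ^ 2 + ‖x - y‖ ^ 2 ≤ 2 * (‖x‖ ^ 2 + L ^ 2 * ‖y‖ ^ 2)) :
    SmoothMajorant (fun x : E => ‖x‖ ^ 2) L where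
  one_le := hL
  convex := convexOn_univ_norm.pow (fun _ _ => norm_nonneg _) 2
  smul t x := by rw [norm_smul, mul_pow, Real.norm_eq_abs, sq_abs]
  ge x := le_rfl
  le x := le_mul_of_one_le_left (sq_nonneg _) (one_le_pow₀ hL)
  two_point x y := (h x y).trans (by linarith)

/-! ### Paley-Walsh martingales and their value recursion. -/

section PaleyWalsh

variable {E : Type v} [NormedAddCommGroup E] [NormedSpace ℝ E]

/-- The sign attached to a bit. -/
def boolSign (b : Bool) : ℝ := if b then 1 else -1

/-- `𝔼(|x + ∑ dₖ|² - D² ∑ |dₖ|²)` for the Paley-Walsh martingale of length `n` with increments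
`dₖ = εₖ Y(ε₀, …, εₖ₋₁)`. -/
noncomputable def walshValue (D : ℝ) : ℕ → (List Bool → E) → E → ℝ
  | 0, _, x => ‖x‖ ^ 2
  | n + 1, Y, x =>
    (walshValue D n (fun l => Y (true :: l)) (x + Y []) +
      walshValue D n (fun l => Y (false :: l)) (x - Y [])) / 2 - D ^ 2 * ‖Y []‖ ^ 2

/-- The increments of a Paley-Walsh martingale. -/
noncomputable def walshIncr (Y : List Bool → E) {n : ℕ} (k : ℕ) (w : Fin n → Bool) : E :=
  if h : k < n then boolSign (w ⟨k, h⟩) • Y ((List.ofFn w).take k) else 0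

theorem walshIncr_cons_zero (Y : List Bool → E) {n : ℕ} (b : Bool) (w : Fin n → Bool) :
    walshIncr Y 0 (Fin.cons b w : Fin (n + 1) → Bool) = boolSign b • Y [] := by
  simp [walshIncr]

theorem walshIncr_cons_succ (Y : List Bool → E) {n : ℕ} (b : Bool) (w : Fin n → Bool) (k : ℕ) :
    walshIncr Y (k + 1) (Fin.cons b w : Fin (n + 1) → Bool)
      = walshIncr (fun l => Y (b :: l)) k w := by
  unfold walshIncr
  by_cases h : k < n
  · have h' : k + 1 < n + 1 := by omega
    have e : (⟨k + 1, h'⟩ : Fin (n + 1)) = Fin.succ ⟨k, h⟩ := rfl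
    rw [dif_pos h, dif_pos h', e, Fin.cons_succ, List.ofFn_succ]
    simp
  · rw [dif_neg h, dif_neg (by omega)]

/-- Splitting off the first bit turns the recursion into an average over the cube, an expectation to
which the martingale inequality can be applied. -/
theorem walshValue_eq_sum (D : ℝ) (n : ℕ) (Y : List Bool → E) (x : E) :
    2 ^ n * walshValue D n Y x = ∑ w : Fin n → Bool,
      (‖x + ∑ k ∈ Finset.range n, walshIncr Y k w‖ ^ 2
        - D ^ 2 * ∑ k ∈ Finset.range n, ‖walshIncr Y k w‖ ^ 2) := by
  induction n generalizing Y x with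
  | zero => simp [walshValue]
  | succ n ih =>
    have e := (Fin.consEquiv fun _ : Fin (n + 1) => Bool).sum_comp fun w : Fin (n + 1) → Bool =>
      (‖x + ∑ k ∈ Finset.range (n + 1), walshIncr Y k w‖ ^ 2
        - D ^ 2 * ∑ k ∈ Finset.range (n + 1), ‖walshIncr Y k w‖ ^ 2)
    rw [← e, Fintype.sum_prod_type, Fintype.sum_bool]
    have hc : ∀ (b : Bool) (w : Fin n → Bool),
      (Fin.consEquiv fun _ : Fin (n + 1) => Bool) (b, w) = (Fin.cons b w : Fin (n + 1) → Bool) :=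
      fun _ _ => rfl
    simp only [hc, Finset.sum_range_succ', walshIncr_cons_zero, walshIncr_cons_succ]
    have h1 := ih (fun l => Y (true :: l)) (x + Y [])
    have h2 := ih (fun l => Y (false :: l)) (x - Y [])
    have e1 : ∀ s : E, x + (s + boolSign true • Y []) = x + Y [] + s := fun s => by
      simp only [boolSign, if_true, one_smul]; abel
    have e2 : ∀ s : E, x + (s + boolSign false • Y []) = x - Y [] + s := fun s => by
      simp only [boolSign, Bool.false_eq_true, if_false, neg_smul, one_smul]; abel
    have e3 : ∀ b, ‖boolSign b • Y []‖ ^ 2 = ‖Y []‖ ^ 2 := fun b => by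
      cases b <;> simp [boolSign]
    have hs : ∀ (g : (Fin n → Bool) → ℝ) (c : ℝ), ∑ w, (g w - c) = ∑ w, g w - 2 ^ n * c := by
      intro g c
      rw [Finset.sum_sub_distrib]
      simp
    simp only [e1, e2, e3, mul_add (D ^ 2), ← sub_sub]
    rw [hs, hs, ← h1, ← h2, walshValue]
    ring

theorem walshValue_neg (D : ℝ) (n : ℕ) (Y : List Bool → E) (x : E) :
    walshValue D n (fun l => -Y l) (-x) = walshValue D n Y x := by
  induction n generalizing Y x with
  | zero => simp [walshValue]
  | succ n ih =>
    simp only [walshValue, norm_neg]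
    rw [← neg_add, ih (fun l => Y (true :: l)), show -x - -Y [] = -(x - Y []) by abel,
      ih (fun l => Y (false :: l))]

theorem walshValue_smul (D : ℝ) (n : ℕ) (Y : List Bool → E) (x : E) (t : ℝ) :
    walshValue D n (fun l => t • Y l) (t • x) = t ^ 2 * walshValue D n Y x := by
  induction n generalizing Y x with
  | zero => simp [walshValue, norm_smul, mul_pow]
  | succ n ih =>
    simp only [walshValue]
    rw [← smul_add, ← smul_sub, ih (fun l => Y (true :: l)), ih (fun l => Y (false :: l)),
      norm_smul, mul_pow, Real.norm_eq_abs, sq_abs]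
    ring

theorem walshValue_convexOn (D : ℝ) (n : ℕ) (Y : List Bool → E) :
    ConvexOn ℝ Set.univ (walshValue D n Y) := by
  induction n generalizing Y with
  | zero => exact convexOn_univ_norm.pow (fun _ _ => norm_nonneg _) 2
  | succ n ih =>
    refine ⟨convex_univ, fun x _ y _ a b ha hb hab => ?_⟩
    have h1 := (ih fun l => Y (true :: l)).2 (Set.mem_univ (x + Y [])) (Set.mem_univ (y + Y []))
      ha hb hab
    have h2 := (ih fun l => Y (false :: l)).2 (Set.mem_univ (x - Y [])) (Set.mem_univ (y - Y []))
      ha hb hab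
    have e1 : a • (x + Y []) + b • (y + Y []) = a • x + b • y + Y [] := by
      rw [smul_add, smul_add, add_add_add_comm, ← add_smul, hab, one_smul]
    have e2 : a • (x - Y []) + b • (y - Y []) = a • x + b • y - Y [] := by
      rw [smul_sub, smul_sub, sub_add_sub_comm, ← add_smul, hab, one_smul]
    rw [e1] at h1
    rw [e2] at h2
    simp only [walshValue, smul_eq_mul] at *
    have : D ^ 2 * ‖Y []‖ ^ 2 = a * (D ^ 2 * ‖Y []‖ ^ 2) + b * (D ^ 2 * ‖Y []‖ ^ 2) := by
      rw [← add_mul, hab, one_mul]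
    linarith

/-- A vanishing first increment changes nothing, so two martingales about to be glued can be given a
common length. -/
theorem walshValue_succ_pad (D : ℝ) (n : ℕ) (Y : List Bool → E) (x : E) :
    walshValue D (n + 1) (fun l => if l = [] then 0 else Y l.tail) x = walshValue D n Y x := by
  simp [walshValue]

theorem exists_walshValue_of_le (D : ℝ) {n m : ℕ} (hnm : n ≤ m) (Y : List Bool → E) (x : E) :
    ∃ Y' : List Bool → E, walshValue D m Y' x = walshValue D n Y x := by
  induction m, hnm using Nat.le_induction with
  | base => exact ⟨Y, rfl⟩
  | succ m _ ih =>
    obtain ⟨Y', h⟩ := ih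
    exact ⟨_, (walshValue_succ_pad D m Y' x).trans h⟩

end PaleyWalsh

/-! ### From the martingale inequality to a smooth majorant. -/

section Realization

variable {E : Type v} [NormedAddCommGroup E] [NormedSpace ℝ E] [CompleteSpace E]

/-- The filtration generated by the coordinates on the discrete cube. -/
def cubeFiltration (n : ℕ) :
    @Filtration (ULift.{u} (Fin n → Bool)) ℕ _ (⊤ : MeasurableSpace (ULift.{u} (Fin n → Bool))) where
  seq k := MeasurableSpace.comap (fun w => (List.ofFn w.down).take k) ⊤
  mono' i j hij := by
    have : (fun w : ULift.{u} (Fin n → Bool) => (List.ofFn w.down).take i)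
        = (fun l => l.take i) ∘ fun w => (List.ofFn w.down).take j := by
      funext w
      simp [List.take_take, hij]
    simp only [this]
    rw [← MeasurableSpace.comap_comp]
    exact MeasurableSpace.comap_mono le_top
  le' _ := le_top

theorem walshIncr_eq_comp (Y : List Bool → E) {n k : ℕ} (hk : k < n) (w : Fin n → Bool) :
    walshIncr Y k w = (fun l : List Bool => boolSign (l.getD k false) • Y (l.take k))
      ((List.ofFn w).take (k + 1)) := by
  simp [walshIncr, hk, List.take_take]

/-- Flip the `k`-th bit. -/
def flipBit {n : ℕ} (k : Fin n) : Equiv.Perm (ULift.{u} (Fin n → Bool)) where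
  toFun w := ⟨Function.update w.down k (!w.down k)⟩
  invFun w := ⟨Function.update w.down k (!w.down k)⟩
  left_inv w := by simp
  right_inv w := by simp

theorem take_flip {n : ℕ} (k : Fin n) (w : ULift.{u} (Fin n → Bool)) :
    (List.ofFn (flipBit k w).down).take k = (List.ofFn w.down).take k := by
  apply List.ext_getElem
  · simp
  · intro i h1 h2
    simp only [List.length_take, List.length_ofFn, lt_min_iff] at h1
    simp only [List.getElem_take, List.getElem_ofFn, flipBit, Equiv.coe_fn_mk]
    rw [Function.update_of_ne]
    intro h
    have := congrArg Fin.val h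
    simp at this
    omega

theorem walsh_flip (Y : List Bool → E) {n : ℕ} (k : Fin n) (w : ULift.{u} (Fin n → Bool)) :
    walshIncr Y k (flipBit k w).down = -walshIncr Y k w.down := by
  unfold walshIncr
  rw [dif_pos k.2, dif_pos k.2, take_flip]
  have : (flipBit k w).down ⟨k, k.2⟩ = !(w.down k) := by simp [flipBit]
  rw [this]
  have : boolSign (!w.down k) = -boolSign (w.down k) := by cases w.down k <;> simp [boolSign]
  rw [this, neg_smul]

/-- The Paley-Walsh martingale lives on the uniform cube, lifted to universe `u`, with the
filtration of initial bits; the martingale inequality there is the claim. -/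
theorem MartingaleInequality.walshValue_zero_le {D : ℝ} (h : MartingaleInequality.{u, v} E D)
    (n : ℕ) (Y : List Bool → E) : walshValue D n Y 0 ≤ 0 := by
  let Ω := ULift.{u} (Fin n → Bool)
  let _ : MeasurableSpace Ω := ⊤
  have : MeasurableSingletonClass Ω := ⟨fun _ => trivial⟩
  let P : Measure Ω := ProbabilityTheory.uniformOn Set.univ
  have : IsProbabilityMeasure P := ProbabilityTheory.isProbabilityMeasure_uniformOn
    Set.finite_univ Set.univ_nonempty
  have hP : ∀ w : Ω, P {w} = (2 ^ n : ℝ≥0∞)⁻¹ := fun w => by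
    rw [ProbabilityTheory.uniformOn_univ, Measure.count_singleton]
    simp [Ω]
  have hPs : ∀ w : Ω, P.real {w} = (2 ^ n : ℝ)⁻¹ := fun w => by
    rw [Measure.real, hP]
    simp
  have hI : ∀ g : Ω → ℝ, ∫ ω, g ω ∂P = (2 ^ n : ℝ)⁻¹ * ∑ w : Fin n → Bool, g ⟨w⟩ := fun g => by
    rw [integral_fintype Integrable.of_finite, Finset.mul_sum,
      ← Equiv.sum_comp (Equiv.ulift.symm : (Fin n → Bool) ≃ Ω)]
    simp only [hPs]
    rfl
  have hflip : ∀ k : Fin n, MeasurePreserving (flipBit k : Ω → Ω) P P := fun k => by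
    refine ⟨fun _ _ => trivial, ?_⟩
    refine Measure.ext_of_singleton fun w => ?_
    rw [Measure.map_apply (α := Ω) (β := Ω) (fun _ _ => trivial) (measurableSet_singleton w), hP]
    have : (flipBit k : Ω → Ω) ⁻¹' {w} = {(flipBit k).symm w} := by
      ext v
      exact (Equiv.eq_symm_apply _).symm
    rw [this, hP]
  have key := h Ω P (cubeFiltration n) n (fun k w => walshIncr Y k w.down) ?_ ?_ ?_
  · have e := walshValue_eq_sum D n Y 0
    simp only [zero_add, Finset.sum_sub_distrib] at e
    rw [hI] at key
    simp only [hI] at key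
    rw [← Finset.mul_sum, Finset.sum_comm, mul_left_comm] at key
    have hp : (0 : ℝ) < 2 ^ n := by positivity
    have key' := le_of_mul_le_mul_left key (inv_pos.2 hp)
    rw [Finset.mul_sum] at key'
    by_contra hc
    push Not at hc
    have := mul_pos hp hc
    linarith
  · intro k hk
    have : (fun w : Ω => walshIncr Y k w.down) =
      (fun l : List Bool => boolSign (l.getD k false) • Y (l.take k)) ∘
        fun w : Ω => (List.ofFn w.down).take (k + 1) :=
      funext fun w => walshIncr_eq_comp Y hk w.down
    rw [this]
    let _ : MeasurableSpace (List Bool) := ⊤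
    have : MeasurableSingletonClass (List Bool) := ⟨fun _ => trivial⟩
    refine StronglyMeasurable.comp_measurable (StronglyMeasurable.of_discrete) ?_
    exact comap_measurable _
  · intro k _
    exact MemLp.of_discrete
  · intro k hk
    refine (ae_eq_condExp_of_forall_setIntegral_eq ((cubeFiltration n).le k)
      Integrable.of_finite (fun _ _ _ => integrableOn_zero) (fun s hs _ => ?_)
      aestronglyMeasurable_zero).symm
    obtain ⟨S, -, rfl⟩ := hs
    simp only [Pi.zero_apply, integral_zero]
    set s : Set Ω := (fun w : Ω => (List.ofFn w.down).take k) ⁻¹' S with hs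
    -- Flipping bit `k` fixes every event of the first `k` bits, preserves `P` and negates the
    -- `k`-th increment, so the integral over `s` equals its own negative.
    have hpre : (flipBit ⟨k, hk⟩ : Ω → Ω) ⁻¹' s = s := by
      ext w
      simp only [hs, Set.mem_preimage]
      rw [take_flip ⟨k, hk⟩ w]
    have h1 := (hflip ⟨k, hk⟩).setIntegral_preimage_emb
      (MeasurableEquiv.measurableEmbedding ⟨flipBit ⟨k, hk⟩, fun _ _ => trivial, fun _ _ => trivial⟩)
      (fun w : Ω => walshIncr Y k w.down) s
    rw [hpre] at h1
    simp only [walsh_flip Y ⟨k, hk⟩, integral_neg] at h1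
    have h2 : (2 : ℝ) • ∫ w in s, walshIncr Y k w.down ∂P = 0 := by
      rw [two_smul]
      nth_rw 1 [← h1]
      exact neg_add_cancel _
    exact ((smul_eq_zero.1 h2).resolve_left two_ne_zero).symm

/-- Start at `0` with a first step `±x`, then follow `Y` or its mirror image `-Y`. By symmetry both
branches have the value sought, and the first step costs exactly `D ^ 2 * ‖x‖ ^ 2`. -/
theorem MartingaleInequality.walshValue_le {D : ℝ} (h : MartingaleInequality.{u, v} E D)
    (n : ℕ) (Y : List Bool → E) (x : E) : walshValue D n Y x ≤ D ^ 2 * ‖x‖ ^ 2 := by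
  have key := h.walshValue_zero_le (n + 1) fun l => match l with
    | [] => x
    | true :: l => Y l
    | false :: l => -Y l
  simp only [walshValue, zero_add, zero_sub] at key
  rw [walshValue_neg] at key
  linarith

/-- The Burkholder-type function: the supremum of `𝔼(|x + ∑ dₖ|² - D² ∑ |dₖ|²)` over all
Paley-Walsh martingales. -/
noncomputable def walshSup (E : Type v) [NormedAddCommGroup E] [NormedSpace ℝ E] (D : ℝ) (x : E) :
    ℝ :=
  ⨆ q : ℕ × (List Bool → E), walshValue D q.1 q.2 x

/-- The supremum inherits convexity and homogeneity from its members, the martingale of length `0`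
gives the lower bound, and `two_point` says that gluing martingales never leaves the class. -/
theorem MartingaleInequality.smoothMajorant {D : ℝ} (hD : 1 ≤ D)
    (h : MartingaleInequality.{u, v} E D) : SmoothMajorant (walshSup E D) D := by
  have hbdd : ∀ x : E, BddAbove (Set.range fun q : ℕ × (List Bool → E) =>
      walshValue D q.1 q.2 x) := fun x => ⟨D ^ 2 * ‖x‖ ^ 2, by
    rintro _ ⟨q, rfl⟩
    exact h.walshValue_le q.1 q.2 x⟩
  have hle : ∀ n Y (x : E), walshValue D n Y x ≤ walshSup E D x := fun n Y x =>
    le_ciSup (hbdd x) (n, Y)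
  refine ⟨hD, ⟨convex_univ, fun x _ y _ a b ha hb hab => ?_⟩, ?_, fun x => ?_, fun x => ?_,
    fun x y => ?_⟩
  · refine ciSup_le fun q => ?_
    refine ((walshValue_convexOn D q.1 q.2).2 (Set.mem_univ x) (Set.mem_univ y) ha hb hab).trans ?_
    simp only [smul_eq_mul]
    gcongr <;> exact hle _ _ _
  · have key : ∀ (t : ℝ) (x : E), t ≠ 0 → t ^ 2 * walshSup E D x ≤ walshSup E D (t • x) :=
      fun t x ht => by
        rw [← le_div_iff₀' (by positivity)]
        refine ciSup_le fun q => ?_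
        rw [le_div_iff₀' (by positivity), ← walshValue_smul]
        exact hle _ _ _
    intro t x
    rcases eq_or_ne t 0 with rfl | ht
    · have h1 : walshSup E D 0 ≤ 0 := ciSup_le fun q => h.walshValue_zero_le q.1 q.2
      have h2 : 0 ≤ walshSup E D 0 := by simpa [walshValue] using hle 0 (fun _ => 0) 0
      simpa using le_antisymm h1 h2
    · refine le_antisymm ?_ (key t x ht)
      have := key t⁻¹ (t • x) (inv_ne_zero ht)
      rw [smul_smul, inv_mul_cancel₀ ht, one_smul, inv_pow, inv_mul_le_iff₀ (by positivity)] at this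
      exact this
  · simpa [walshValue] using hle 0 (fun _ => 0) x
  · exact ciSup_le fun q => h.walshValue_le q.1 q.2 x
  -- From `x` take a step `±y`, then follow arbitrary martingales from `x + y` and `x - y`, padded
  -- to equal length; the result competes in the supremum at `x`.
  · rw [← le_sub_iff_add_le]
    refine ciSup_le fun q₁ => ?_
    rw [le_sub_iff_add_le, ← le_sub_iff_add_le']
    refine ciSup_le fun q₂ => ?_
    obtain ⟨Y₁, h₁⟩ := exists_walshValue_of_le D (le_max_left q₁.1 q₂.1) q₁.2 (x + y)
    obtain ⟨Y₂, h₂⟩ := exists_walshValue_of_le D (le_max_right q₁.1 q₂.1) q₂.2 (x - y)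
    have := hle (max q₁.1 q₂.1 + 1) (fun l => match l with
      | [] => y
      | true :: l => Y₁ l
      | false :: l => Y₂ l) x
    simp only [walshValue] at this
    rw [h₁, h₂] at this
    linarith

end Realization

/-! ### The one-step exponential estimate. -/

section Exponential

variable {Ω : Type*} {m m0 : MeasurableSpace Ω} {P : Measure Ω}
  {E : Type*} [NormedAddCommGroup E] [NormedSpace ℝ E] [CompleteSpace E]
  {f : E → ℝ} {D : ℝ}

/-- The exponential functional `exp √(1 + a² f)`. -/
noncomputable def expSqrt (f : E → ℝ) (a : ℝ) (x : E) : ℝ := Real.exp (√(1 + a ^ 2 * f x))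

theorem expSqrt_pos (f : E → ℝ) (a : ℝ) (x : E) : 0 < expSqrt f a x := Real.exp_pos _

theorem SmoothMajorant.continuous_expSqrt (hf : SmoothMajorant f D) (a : ℝ) :
    Continuous (expSqrt f a) :=
  Real.continuous_exp.comp
    (Real.continuous_sqrt.comp (continuous_const.add (continuous_const.mul hf.continuous)))

theorem SmoothMajorant.exp_norm_le (hf : SmoothMajorant f D) {a : ℝ} (x : E) :
    Real.exp (a * ‖x‖) ≤ expSqrt f a x := by
  refine Real.exp_le_exp.2 (Real.le_sqrt_of_sq_le ?_)
  have := mul_le_mul_of_nonneg_left (hf.ge x) (sq_nonneg a)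
  rw [mul_pow]
  linarith

theorem SmoothMajorant.expSqrt_le (hf : SmoothMajorant f D) {a R : ℝ} {x : E} (hx : ‖x‖ ≤ R) :
    expSqrt f a x ≤ Real.exp (√(1 + a ^ 2 * (D ^ 2 * R ^ 2))) := by
  refine Real.exp_le_exp.2 (Real.sqrt_le_sqrt ?_)
  have : f x ≤ D ^ 2 * R ^ 2 := (hf.le x).trans (by gcongr)
  gcongr

theorem SmoothMajorant.expSqrt_zero (hf : SmoothMajorant f D) (a : ℝ) :
    expSqrt f a 0 = Real.exp 1 := by
  have : f 0 = 0 := by simpa using hf.smul 0 0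
  simp [expSqrt, this]

/-- For simple `M` the tangent functional at `M ω` is a simple `m`-measurable function of `ω`, so no
measurable selection is needed. Its linear term integrates to zero because `d` is centred given `m`.
-/
theorem SmoothMajorant.integral_expSqrt_simpleFunc_le [IsFiniteMeasure P]
    (hf : SmoothMajorant f D) (hm : m ≤ m0) {a ρ : ℝ} (ha : 0 ≤ a) (haρ : a * D * ρ ≤ 1)
    (M : @SimpleFunc Ω m E) {d : Ω → E} (hd : AEStronglyMeasurable d P)
    (hdρ : ∀ᵐ ω ∂P, ‖d ω‖ ≤ ρ) (hd0 : P[d | m] =ᵐ[P] 0)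
    {w : Ω → ℝ} (hw : StronglyMeasurable[m] w) (hw0 : ∀ ω, 0 ≤ w ω)
    {W : ℝ} (hw1 : ∀ᵐ ω ∂P, w ω ≤ W) :
    ∫ ω, w ω * expSqrt f a (M ω + d ω) ∂P
      ≤ ∫ ω, w ω * expSqrt f a (M ω) * (1 + 2 * a ^ 2 * D ^ 2 * ‖d ω‖ ^ 2) ∂P := by
  choose l hl using hf.exists_exp_le ha
  obtain ⟨R, hR⟩ := @SimpleFunc.exists_forall_norm_le _ _ m _ M
  let Λ : @SimpleFunc Ω m (E →L[ℝ] ℝ) := @SimpleFunc.map _ _ _ m (fun x => expSqrt f a x • l x) M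
  obtain ⟨S, hS⟩ := @SimpleFunc.exists_forall_norm_le _ _ m _ Λ
  have hMm : StronglyMeasurable M := (@SimpleFunc.stronglyMeasurable _ _ m _ M).mono hm
  have hΛm : StronglyMeasurable Λ := (@SimpleFunc.stronglyMeasurable _ _ m _ Λ).mono hm
  have hdi : Integrable d P := Integrable.of_bound hd ρ hdρ
  have hwm : StronglyMeasurable w := hw.mono hm
  have hcont := hf.continuous_expSqrt a
  have hwW : ∀ᵐ ω ∂P, ‖w ω‖ ≤ W := by
    filter_upwards [hw1] with ω h1
    rwa [Real.norm_of_nonneg (hw0 ω)]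
  have hEb : ∀ {R : ℝ} {x : E}, ‖x‖ ≤ R → ‖expSqrt f a x‖ ≤
      Real.exp (√(1 + a ^ 2 * (D ^ 2 * R ^ 2))) := fun h => by
    rw [Real.norm_of_nonneg (expSqrt_pos f a _).le]
    exact hf.expSqrt_le h
  have hΛd : Integrable (fun ω => Λ ω (d ω)) P := by
    refine Integrable.of_bound ?_ (S * ρ) ?_
    · exact (isBoundedBilinearMap_apply (𝕜 := ℝ)).continuous.comp_aestronglyMeasurable
        (hΛm.aestronglyMeasurable.prodMk hd)
    · filter_upwards [hdρ] with ω h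
      exact ((Λ ω).le_opNorm _).trans (mul_le_mul (hS ω) h (norm_nonneg _)
        ((norm_nonneg _).trans (hS ω)))
  have hwΛd : Integrable (fun ω => w ω * Λ ω (d ω)) P :=
    hΛd.bdd_mul hwm.aestronglyMeasurable hwW
  have hzero : ∫ ω, w ω * Λ ω (d ω) ∂P = 0 := by
    have h1 : P[fun ω => Λ ω (d ω) | m] =ᵐ[P] 0 := by
      have := condExp_stronglyMeasurable_simpleFunc_bilin (ContinuousLinearMap.id ℝ (E →L[ℝ] ℝ))
        hm Λ hdi
      refine this.trans ?_
      filter_upwards [hd0] with ω h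
      simp [h]
    have h2 : P[fun ω => w ω * Λ ω (d ω) | m] =ᵐ[P] 0 := by
      refine (condExp_mul_of_stronglyMeasurable_left hw hwΛd hΛd).trans ?_
      filter_upwards [h1] with ω h
      simp [h]
    rw [← integral_condExp hm, integral_congr_ae h2]
    simp
  have hI2 : Integrable (fun ω => w ω * expSqrt f a (M ω) *
      (1 + 2 * a ^ 2 * D ^ 2 * ‖d ω‖ ^ 2)) P := by
    refine Integrable.of_bound (C := W * Real.exp (√(1 + a ^ 2 * (D ^ 2 * R ^ 2))) *
      (1 + 2 * a ^ 2 * D ^ 2 * ρ ^ 2)) ?_ ?_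
    · exact (hwm.aestronglyMeasurable.mul (hcont.comp_aestronglyMeasurable
        hMm.aestronglyMeasurable)).mul (by fun_prop)
    · filter_upwards [hdρ, hwW] with ω h h1
      rw [norm_mul, norm_mul]
      have h3 := hEb (hR ω)
      have h4 : ‖1 + 2 * a ^ 2 * D ^ 2 * ‖d ω‖ ^ 2‖ ≤ 1 + 2 * a ^ 2 * D ^ 2 * ρ ^ 2 := by
        rw [Real.norm_of_nonneg (by positivity)]
        gcongr
      have := (norm_nonneg _).trans h1
      gcongr
  have hI1 : Integrable (fun ω => w ω * expSqrt f a (M ω + d ω)) P := by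
    refine Integrable.of_bound (C := W * Real.exp (√(1 + a ^ 2 * (D ^ 2 * (R + ρ) ^ 2)))) ?_ ?_
    · exact hwm.aestronglyMeasurable.mul (hcont.comp_aestronglyMeasurable
        (hMm.aestronglyMeasurable.add hd))
    · filter_upwards [hdρ, hwW] with ω h h1
      rw [norm_mul]
      have h3 := hEb ((norm_add_le _ _).trans (add_le_add (hR ω) h))
      have := (norm_nonneg _).trans h1
      gcongr
  calc ∫ ω, w ω * expSqrt f a (M ω + d ω) ∂P
      ≤ ∫ ω, (w ω * Λ ω (d ω) + w ω * expSqrt f a (M ω) *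
          (1 + 2 * a ^ 2 * D ^ 2 * ‖d ω‖ ^ 2)) ∂P := by
        refine integral_mono_ae hI1 (hwΛd.add hI2) ?_
        filter_upwards [hdρ] with ω h
        have hD := hf.one_le
        have h1 := hl (M ω) (d ω) ((by gcongr : a * D * ‖d ω‖ ≤ a * D * ρ).trans haρ)
        have h2 : Λ ω (d ω) = expSqrt f a (M ω) * l (M ω) (d ω) := rfl
        have h3 := mul_le_mul_of_nonneg_left h1 (hw0 ω)
        simp only [h2]
        refine h3.trans (le_of_eq ?_)
        simp only [expSqrt]
        ring
    _ = _ := by rw [integral_add hwΛd hI2, hzero, zero_add]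

/-- Bounded simple approximations of `M` and dominated convergence remove the restriction on `M`;
pulling out the `m`-measurable weight then turns `‖d‖ ^ 2` into its conditional expectation. -/
theorem SmoothMajorant.integral_expSqrt_le [IsFiniteMeasure P]
    (hf : SmoothMajorant f D) (hm : m ≤ m0) {a ρ R : ℝ} (ha : 0 ≤ a) (haρ : a * D * ρ ≤ 1)
    {M : Ω → E} (hM : StronglyMeasurable[m] M) (hR : 0 ≤ R) (hMR : ∀ᵐ ω ∂P, ‖M ω‖ ≤ R)
    {d : Ω → E} (hd : AEStronglyMeasurable d P)
    (hdρ : ∀ᵐ ω ∂P, ‖d ω‖ ≤ ρ) (hd0 : P[d | m] =ᵐ[P] 0)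
    {w : Ω → ℝ} (hw : StronglyMeasurable[m] w) (hw0 : ∀ ω, 0 ≤ w ω)
    {W : ℝ} (hw1 : ∀ᵐ ω ∂P, w ω ≤ W) :
    ∫ ω, w ω * expSqrt f a (M ω + d ω) ∂P
      ≤ ∫ ω, w ω * expSqrt f a (M ω) *
          (1 + 2 * a ^ 2 * D ^ 2 * P[fun ω => ‖d ω‖ ^ 2 | m] ω) ∂P := by
  have hwm : StronglyMeasurable w := hw.mono hm
  have hcont := hf.continuous_expSqrt a
  have hwW : ∀ᵐ ω ∂P, ‖w ω‖ ≤ W := by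
    filter_upwards [hw1] with ω h1
    rwa [Real.norm_of_nonneg (hw0 ω)]
  have hEb : ∀ {R : ℝ} {x : E}, ‖x‖ ≤ R → ‖expSqrt f a x‖ ≤
      Real.exp (√(1 + a ^ 2 * (D ^ 2 * R ^ 2))) := fun h => by
    rw [Real.norm_of_nonneg (expSqrt_pos f a _).le]
    exact hf.expSqrt_le h
  have hMs := hM.tendsto_approxBounded_ae hMR
  have hMb := hM.norm_approxBounded_le hR
  have hMsm : ∀ j, AEStronglyMeasurable (hM.approxBounded R j) P := fun j =>
    ((@SimpleFunc.stronglyMeasurable _ _ m _ _).mono hm).aestronglyMeasurable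
  have hlim1 : Tendsto (fun j => ∫ ω, w ω * expSqrt f a (hM.approxBounded R j ω + d ω) ∂P) atTop
      (𝓝 (∫ ω, w ω * expSqrt f a (M ω + d ω) ∂P)) := by
    refine tendsto_integral_of_dominated_convergence
      (fun _ => W * Real.exp (√(1 + a ^ 2 * (D ^ 2 * (R + ρ) ^ 2)))) (fun j => ?_)
      (integrable_const _) (fun j => ?_) ?_
    · exact hwm.aestronglyMeasurable.mul (hcont.comp_aestronglyMeasurable ((hMsm j).add hd))
    · filter_upwards [hdρ, hwW] with ω h h1
      rw [norm_mul]
      have h3 := hEb ((norm_add_le _ _).trans (add_le_add (hMb j ω) h))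
      have := (norm_nonneg _).trans h1
      gcongr
    · filter_upwards [hMs] with ω h
      exact ((hcont.tendsto _).comp (h.add_const _)).const_mul _
  have hlim2 : Tendsto (fun j => ∫ ω, w ω * expSqrt f a (hM.approxBounded R j ω) *
      (1 + 2 * a ^ 2 * D ^ 2 * ‖d ω‖ ^ 2) ∂P) atTop
      (𝓝 (∫ ω, w ω * expSqrt f a (M ω) * (1 + 2 * a ^ 2 * D ^ 2 * ‖d ω‖ ^ 2) ∂P)) := by
    refine tendsto_integral_of_dominated_convergence
      (fun _ => W * Real.exp (√(1 + a ^ 2 * (D ^ 2 * R ^ 2))) *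
        (1 + 2 * a ^ 2 * D ^ 2 * ρ ^ 2)) (fun j => ?_)
      (integrable_const _) (fun j => ?_) ?_
    · exact (hwm.aestronglyMeasurable.mul (hcont.comp_aestronglyMeasurable (hMsm j))).mul
        (by fun_prop)
    · filter_upwards [hdρ, hwW] with ω h h1
      rw [norm_mul, norm_mul]
      have h3 := hEb (hMb j ω)
      have h4 : ‖1 + 2 * a ^ 2 * D ^ 2 * ‖d ω‖ ^ 2‖ ≤ 1 + 2 * a ^ 2 * D ^ 2 * ρ ^ 2 := by
        rw [Real.norm_of_nonneg (by positivity)]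
        gcongr
      have := (norm_nonneg _).trans h1
      gcongr
    · filter_upwards [hMs] with ω h
      exact (((hcont.tendsto _).comp h).const_mul _).mul_const _
  have key := le_of_tendsto_of_tendsto' hlim1 hlim2 fun j =>
    hf.integral_expSqrt_simpleFunc_le hm ha haρ (hM.approxBounded R j) hd hdρ hd0 hw hw0 hw1
  refine key.trans (le_of_eq ?_)
  have hg : StronglyMeasurable[m] fun ω => w ω * expSqrt f a (M ω) :=
    hw.mul (hcont.comp_stronglyMeasurable hM)
  have hgb : ∀ᵐ ω ∂P, ‖w ω * expSqrt f a (M ω)‖ ≤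
      W * Real.exp (√(1 + a ^ 2 * (D ^ 2 * R ^ 2))) := by
    filter_upwards [hMR, hwW] with ω h h1
    rw [norm_mul]
    have h3 := hEb h
    have := (norm_nonneg _).trans h1
    gcongr
  have hd2 : Integrable (fun ω => ‖d ω‖ ^ 2) P := by
    refine Integrable.of_bound (C := ρ ^ 2) (by fun_prop) ?_
    filter_upwards [hdρ] with ω h
    rw [Real.norm_of_nonneg (by positivity)]
    gcongr
  have hgm := (hg.mono hm).aestronglyMeasurable (μ := P)
  have hgi : Integrable (fun ω => w ω * expSqrt f a (M ω)) P := Integrable.of_bound hgm _ hgb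
  have hgd : Integrable (fun ω => w ω * expSqrt f a (M ω) * ‖d ω‖ ^ 2) P :=
    hd2.bdd_mul hgm hgb
  have hgc : Integrable (fun ω => w ω * expSqrt f a (M ω) * P[fun ω => ‖d ω‖ ^ 2 | m] ω) P :=
    integrable_condExp.bdd_mul hgm hgb
  have e : ∫ ω, w ω * expSqrt f a (M ω) * ‖d ω‖ ^ 2 ∂P
      = ∫ ω, w ω * expSqrt f a (M ω) * P[fun ω => ‖d ω‖ ^ 2 | m] ω ∂P := by
    rw [← integral_condExp hm]
    exact integral_congr_ae (condExp_mul_of_stronglyMeasurable_left hg hgd hd2)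
  have e1 : ∀ (g h : Ω → ℝ) (c : ℝ), (fun ω => g ω * (1 + c * h ω))
      = fun ω => g ω + c * (g ω * h ω) := fun g h c => by funext ω; ring
  rw [e1 (fun ω => w ω * expSqrt f a (M ω)) (fun ω => ‖d ω‖ ^ 2),
    e1 (fun ω => w ω * expSqrt f a (M ω)) (P[fun ω => ‖d ω‖ ^ 2 | m]),
    integral_add hgi (hgd.const_mul _), integral_add hgi (hgc.const_mul _),
    integral_const_mul, integral_const_mul, e]

end Exponential

/-! ### Stopping and a Freedman inequality. -/

section Freedman

variable {Ω : Type*} {m0 : MeasurableSpace Ω} {P : Measure Ω}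
  {E : Type*} [NormedAddCommGroup E] [NormedSpace ℝ E] [CompleteSpace E]
  {f : E → ℝ} {D : ℝ}

/-- The predictable set on which neither the quadratic variation has exceeded `Q` nor the norm of
the partial sums has reached `x`. -/
def activeSet (Z : ℕ → Ω → E) (v : ℕ → Ω → ℝ) (Q x : ℝ) (k : ℕ) : Set Ω :=
  {ω | ∑ j ∈ Finset.range (k + 1), v j ω ≤ Q} ∩
    ⋂ j ∈ Finset.range (k + 1), {ω | ‖∑ i ∈ Finset.range j, Z i ω‖ < x}

theorem mem_activeSet {Z : ℕ → Ω → E} {v : ℕ → Ω → ℝ} {Q x : ℝ} {k : ℕ} {ω : Ω} :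
    ω ∈ activeSet Z v Q x k ↔ ∑ j ∈ Finset.range (k + 1), v j ω ≤ Q ∧
      ∀ j ≤ k, ‖∑ i ∈ Finset.range j, Z i ω‖ < x := by
  simp [activeSet]

theorem measurableSet_activeSet {𝒢 : Filtration ℕ m0} {Z : ℕ → Ω → E} {v : ℕ → Ω → ℝ} {N : ℕ}
    (hZ : ∀ k < N, StronglyMeasurable[𝒢 (k + 1)] (Z k))
    (hv : ∀ k < N, StronglyMeasurable[𝒢 k] (v k)) (Q x : ℝ) {k : ℕ} (hk : k < N) :
    MeasurableSet[𝒢 k] (activeSet Z v Q x k) := by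
  refine MeasurableSet.inter (m := 𝒢 k) ?_ ?_
  · refine StronglyMeasurable.measurableSet_le (m := 𝒢 k) ?_ stronglyMeasurable_const
    refine Finset.stronglyMeasurable_fun_sum (m := 𝒢 k) _ fun j hj => ?_
    have hj' : j ≤ k := Nat.lt_succ_iff.1 (Finset.mem_range.1 hj)
    exact (hv j (by omega)).mono (𝒢.mono hj')
  · refine Finset.measurableSet_biInter (m := 𝒢 k) _ fun j hj => ?_
    have hj' : j ≤ k := Nat.lt_succ_iff.1 (Finset.mem_range.1 hj)
    refine StronglyMeasurable.measurableSet_lt (m := 𝒢 k) ?_ stronglyMeasurable_const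
    have : StronglyMeasurable[𝒢 k] fun ω => ∑ i ∈ Finset.range j, Z i ω :=
      Finset.stronglyMeasurable_fun_sum (m := 𝒢 k) _ fun i hi => by
        have hi' := Finset.mem_range.1 hi
        exact (hZ i (by omega)).mono (𝒢.mono (by omega))
    exact this.norm

/-- Activity at `k` tests the sum up to and including `v k`, so at the last active index the total
is still at most `Q`. -/
theorem sum_indicator_activeSet_le {Z : ℕ → Ω → E} {v : ℕ → Ω → ℝ} {Q x : ℝ} (hQ : 0 ≤ Q) (n : ℕ)
    {ω : Ω} (hv : ∀ k < n, 0 ≤ v k ω) :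
    ∑ k ∈ Finset.range n, (activeSet Z v Q x k).indicator (v k) ω ≤ Q := by
  induction n with
  | zero => simpa using hQ
  | succ n ih =>
    by_cases h : ω ∈ activeSet Z v Q x n
    · refine le_trans (Finset.sum_le_sum fun k hk => ?_) (mem_activeSet.1 h).1
      exact Set.indicator_le_self' (fun _ _ => hv k (Finset.mem_range.1 hk)) ω
    · rw [Finset.sum_range_succ, Set.indicator_of_notMem h, add_zero]
      exact ih fun k hk => hv k (by omega)

/-- Every index before the first passage is active and none from it on, so the restricted sum
freezes at first passage. A maximal event becomes an event about the terminal value. -/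
theorem exists_le_norm_sum_indicator {Z : ℕ → Ω → E} {v : ℕ → Ω → ℝ} {Q x : ℝ} {N : ℕ} {ω : Ω}
    (hv : ∀ k < N, 0 ≤ v k ω) (hQ : ∑ k ∈ Finset.range N, v k ω ≤ Q)
    (hx : ∃ n ≤ N, x ≤ ‖∑ k ∈ Finset.range n, Z k ω‖) :
    x ≤ ‖∑ k ∈ Finset.range N, (activeSet Z v Q x k).indicator (Z k) ω‖ := by
  classical
  have hex : ∃ n, x ≤ ‖∑ k ∈ Finset.range n, Z k ω‖ := by
    obtain ⟨n, -, h⟩ := hx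
    exact ⟨n, h⟩
  obtain ⟨n', hn', hn'x⟩ := hx
  set n := Nat.find hex
  have hn : x ≤ ‖∑ k ∈ Finset.range n, Z k ω‖ := Nat.find_spec hex
  have hnN : n ≤ N := (Nat.find_min' hex hn'x).trans hn'
  have h1 : ∀ k < n, ω ∈ activeSet Z v Q x k := fun k hk => by
    refine mem_activeSet.2 ⟨?_, fun j hj => not_le.1 (Nat.find_min hex (by omega))⟩
    refine le_trans (Finset.sum_le_sum_of_subset_of_nonneg ?_ ?_) hQ
    · exact Finset.range_subset_range.2 (by omega)
    · exact fun i hi _ => hv i (Finset.mem_range.1 hi)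
  have h2 : ∀ k, n ≤ k → ω ∉ activeSet Z v Q x k := fun k hk h =>
    absurd ((mem_activeSet.1 h).2 n hk) (not_lt.2 hn)
  have : ∑ k ∈ Finset.range N, (activeSet Z v Q x k).indicator (Z k) ω
      = ∑ k ∈ Finset.range n, Z k ω := by
    rw [← Finset.sum_subset (Finset.range_subset_range.2 hnN)]
    · exact Finset.sum_congr rfl fun k hk => Set.indicator_of_mem (h1 k (Finset.mem_range.1 hk)) _
    · intro k _ hk
      exact Set.indicator_of_notMem (h2 k (by simpa using hk)) _
  rwa [this]

/-- A Freedman-type maximal inequality in `2`-smooth spaces. -/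
theorem SmoothMajorant.measure_exists_le_norm_sum_le [IsProbabilityMeasure P]
    (hf : SmoothMajorant f D) (𝒢 : Filtration ℕ m0) {N : ℕ} {Z : ℕ → Ω → E} {v : ℕ → Ω → ℝ}
    {a ρ Q x : ℝ} (ha : 0 ≤ a) (hρ : 0 ≤ ρ) (haρ : a * D * ρ ≤ 1) (hQ : 0 ≤ Q)
    (hZ : ∀ k < N, StronglyMeasurable[𝒢 (k + 1)] (Z k))
    (hZρ : ∀ k < N, ∀ᵐ ω ∂P, ‖Z k ω‖ ≤ ρ)
    (hZ0 : ∀ k < N, P[Z k | 𝒢 k] =ᵐ[P] 0)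
    (hv : ∀ k < N, StronglyMeasurable[𝒢 k] (v k))
    (hv0 : ∀ k < N, 0 ≤ᵐ[P] v k)
    (hZv : ∀ k < N, P[fun ω => ‖Z k ω‖ ^ 2 | 𝒢 k] ≤ᵐ[P] v k) :
    P {ω | ∑ k ∈ Finset.range N, v k ω ≤ Q ∧ ∃ n ≤ N, x ≤ ‖∑ k ∈ Finset.range n, Z k ω‖}
      ≤ ENNReal.ofReal (Real.exp (1 + 2 * a ^ 2 * D ^ 2 * Q - a * x)) := by
  set c := 2 * a ^ 2 * D ^ 2 with hc
  have hc0 : 0 ≤ c := by positivity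
  set B := activeSet Z v Q x with hB
  set M : ℕ → Ω → E := fun n ω => ∑ k ∈ Finset.range n, (B k).indicator (Z k) ω with hM
  set V : ℕ → Ω → ℝ := fun n ω => ∑ k ∈ Finset.range n, (B k).indicator (v k) ω with hV
  have hBm : ∀ k < N, MeasurableSet[𝒢 k] (B k) := fun k hk => measurableSet_activeSet hZ hv Q x hk
  have hZ'm : ∀ k < N, StronglyMeasurable[𝒢 (k + 1)] ((B k).indicator (Z k)) := fun k hk =>
    (hZ k hk).indicator (𝒢.mono (Nat.le_succ k) _ (hBm k hk))
  have hMm : ∀ n ≤ N, StronglyMeasurable[𝒢 n] (M n) := fun n hn =>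
    Finset.stronglyMeasurable_fun_sum (m := 𝒢 n) _ fun k hk => by
      have := Finset.mem_range.1 hk
      exact (hZ'm k (by omega)).mono (𝒢.mono (by omega))
  have hVm : ∀ n < N, StronglyMeasurable[𝒢 n] (V (n + 1)) := fun n hn =>
    Finset.stronglyMeasurable_fun_sum (m := 𝒢 n) _ fun k hk => by
      have := Finset.mem_range.1 hk
      exact ((hv k (by omega)).indicator (hBm k (by omega))).mono (𝒢.mono (by omega))
  have hVm' : ∀ n ≤ N, StronglyMeasurable (V n) := fun n hn => by
    cases n with
    | zero => simp only [hV, Finset.range_zero, Finset.sum_empty]; exact stronglyMeasurable_const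
    | succ n => exact (hVm n hn).mono (𝒢.le n)
  have hall : ∀ᵐ ω ∂P, ∀ k < N, ‖Z k ω‖ ≤ ρ ∧ 0 ≤ v k ω := by
    rw [ae_all_iff]
    intro k
    by_cases hk : k < N
    · filter_upwards [hZρ k hk, hv0 k hk] with ω h1 h2 _ using ⟨h1, h2⟩
    · exact ae_of_all _ fun ω h => absurd h hk
  have hZ'ρ : ∀ᵐ ω ∂P, ∀ k < N, ‖(B k).indicator (Z k) ω‖ ≤ ρ := by
    filter_upwards [hall] with ω h k hk
    exact (norm_indicator_le_norm_self _ _).trans (h k hk).1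
  have hMb : ∀ n ≤ N, ∀ᵐ ω ∂P, ‖M n ω‖ ≤ N * ρ := fun n hn => by
    filter_upwards [hZ'ρ] with ω h
    calc ‖M n ω‖ ≤ ∑ k ∈ Finset.range n, ρ := norm_sum_le_of_le _ fun k hk =>
          h k ((Finset.mem_range.1 hk).trans_le hn)
      _ = n * ρ := by simp
      _ ≤ N * ρ := by gcongr
  have hV0 : ∀ᵐ ω ∂P, ∀ n ≤ N, 0 ≤ V n ω := by
    filter_upwards [hall] with ω h n hn
    exact Finset.sum_nonneg fun k hk => Set.indicator_apply_nonneg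
      (fun _ => (h k ((Finset.mem_range.1 hk).trans_le hn)).2)
  have hVQ : ∀ᵐ ω ∂P, ∀ n ≤ N, V n ω ≤ Q := by
    filter_upwards [hall] with ω h n hn
    exact sum_indicator_activeSet_le hQ n fun k hk => (h k (hk.trans_le hn)).2
  have hHm := hf.continuous_expSqrt a
  have hHb : ∀ n ≤ N, ∀ᵐ ω ∂P, expSqrt f a (M n ω) ≤
      Real.exp (√(1 + a ^ 2 * (D ^ 2 * (N * ρ) ^ 2))) := fun n hn => by
    filter_upwards [hMb n hn] with ω h using hf.expSqrt_le h
  have hTint : ∀ n ≤ N, Integrable (fun ω => Real.exp (-c * V n ω) * expSqrt f a (M n ω)) P :=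
    fun n hn => by
      refine Integrable.of_bound (C := 1 * Real.exp (√(1 + a ^ 2 * (D ^ 2 * (N * ρ) ^ 2)))) ?_ ?_
      · exact (Real.continuous_exp.comp_aestronglyMeasurable
          ((hVm' n hn).aestronglyMeasurable.const_mul _)).mul
          (hHm.comp_aestronglyMeasurable ((hMm n hn).mono (𝒢.le n)).aestronglyMeasurable)
      · filter_upwards [hHb n hn, hV0] with ω h1 h2
        rw [Real.norm_of_nonneg (mul_nonneg (Real.exp_pos _).le (expSqrt_pos f a _).le)]
        refine mul_le_mul (Real.exp_le_one_iff.2 ?_) h1 (expSqrt_pos f a _).le zero_le_one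
        have := mul_nonneg hc0 (h2 n hn)
        linarith
  -- Supermartingale property: `V (n + 1)` is already `𝒢 n`-measurable and so serves as a weight,
  -- and `1 + c t ≤ e ^ (c t)` absorbs the conditional variance into its increment.
  have hstep : ∀ n < N, ∫ ω, Real.exp (-c * V (n + 1) ω) * expSqrt f a (M (n + 1) ω) ∂P
      ≤ ∫ ω, Real.exp (-c * V n ω) * expSqrt f a (M n ω) ∂P := fun n hn => by
    have hd0 : P[(B n).indicator (Z n) | 𝒢 n] =ᵐ[P] 0 := by
      have hZi : Integrable (Z n) P :=
        Integrable.of_bound ((hZ n hn).mono (𝒢.le _)).aestronglyMeasurable ρ (hZρ n hn)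
      refine (condExp_indicator hZi (hBm n hn)).trans ?_
      filter_upwards [hZ0 n hn] with ω h
      simp [Set.indicator, h]
    have hd2 : P[fun ω => ‖(B n).indicator (Z n) ω‖ ^ 2 | 𝒢 n] ≤ᵐ[P] (B n).indicator (v n) := by
      have e : (fun ω => ‖(B n).indicator (Z n) ω‖ ^ 2)
          = (B n).indicator fun ω => ‖Z n ω‖ ^ 2 := by
        funext ω
        by_cases h : ω ∈ B n <;> simp [h]
      have hZi : Integrable (fun ω => ‖Z n ω‖ ^ 2) P := by
        refine Integrable.of_bound (C := ρ ^ 2) ?_ ?_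
        · exact ((hZ n hn).mono (𝒢.le _)).aestronglyMeasurable.norm.pow 2
        · filter_upwards [hZρ n hn] with ω h
          rw [Real.norm_of_nonneg (by positivity)]
          gcongr
      rw [e]
      refine (condExp_indicator hZi (hBm n hn)).le.trans ?_
      filter_upwards [hZv n hn] with ω h
      exact Set.indicator_le_indicator h
    have hw1 : ∀ᵐ ω ∂P, Real.exp (-c * V (n + 1) ω) ≤ 1 := by
      filter_upwards [hV0] with ω h
      have := mul_nonneg hc0 (h (n + 1) hn)
      exact Real.exp_le_one_iff.2 (by linarith)
    have key := hf.integral_expSqrt_le (𝒢.le n) ha haρ (hMm n hn.le)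
      (by positivity : (0 : ℝ) ≤ N * ρ) (hMb n hn.le)
      ((hZ'm n hn).mono (𝒢.le _)).aestronglyMeasurable (by
        filter_upwards [hZ'ρ] with ω h using h n hn) hd0
      (w := fun ω => Real.exp (-c * V (n + 1) ω))
      (Real.continuous_exp.comp_stronglyMeasurable ((hVm n hn).const_mul (-c)))
      (fun ω => (Real.exp_pos _).le) hw1
    have eM : ∀ ω, M (n + 1) ω = M n ω + (B n).indicator (Z n) ω := fun ω =>
      Finset.sum_range_succ _ _
    simp only [eM]
    refine key.trans (integral_mono_of_nonneg ?_ (hTint n hn.le) ?_)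
    · have h0 : 0 ≤ᵐ[P] P[fun ω => ‖(B n).indicator (Z n) ω‖ ^ 2 | 𝒢 n] :=
        condExp_nonneg (ae_of_all _ fun ω => by positivity)
      filter_upwards [h0] with ω h
      have := expSqrt_pos f a (M n ω)
      have h' : 0 ≤ P[fun ω => ‖(B n).indicator (Z n) ω‖ ^ 2 | 𝒢 n] ω := h
      simp only [Pi.zero_apply]
      positivity
    · filter_upwards [hd2] with ω h
      have hVs : V (n + 1) ω = V n ω + (B n).indicator (v n) ω := Finset.sum_range_succ _ _
      have h1 : 1 + c * P[fun ω => ‖(B n).indicator (Z n) ω‖ ^ 2 | 𝒢 n] ω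
          ≤ Real.exp (c * (B n).indicator (v n) ω) := by
        have := Real.add_one_le_exp (c * (B n).indicator (v n) ω)
        have := mul_le_mul_of_nonneg_left h hc0
        linarith
      have h2 : Real.exp (-c * V n ω)
          = Real.exp (-c * V (n + 1) ω) * Real.exp (c * (B n).indicator (v n) ω) := by
        rw [← Real.exp_add, hVs]
        ring_nf
      rw [h2, mul_right_comm]
      refine mul_le_mul_of_nonneg_right ?_ (expSqrt_pos f a _).le
      exact mul_le_mul_of_nonneg_left h1 (Real.exp_pos _).le
  have hT : ∀ n ≤ N, ∫ ω, Real.exp (-c * V n ω) * expSqrt f a (M n ω) ∂P ≤ Real.exp 1 := by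
    intro n
    induction n with
    | zero => intro _; simp [hM, hV, hf.expSqrt_zero]
    | succ n ih => intro hn; exact (hstep n hn).trans (ih (by omega))
  have hfin := hT N le_rfl
  set T := fun ω => Real.exp (-c * V N ω) * expSqrt f a (M N ω) with hTdef
  have hT0 : ∀ ω, 0 ≤ T ω := fun ω => mul_nonneg (Real.exp_pos _).le (expSqrt_pos f a _).le
  -- Markov's inequality; the initial value `e` of the supermartingale is the `1` in the final
  -- exponent.
  have hmark := mul_meas_ge_le_integral_of_nonneg (ae_of_all P hT0) (hTint N le_rfl)
    (Real.exp (a * x - c * Q))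
  have hsub : P {ω | ∑ k ∈ Finset.range N, v k ω ≤ Q ∧ ∃ n ≤ N, x ≤ ‖∑ k ∈ Finset.range n, Z k ω‖}
      ≤ P {ω | Real.exp (a * x - c * Q) ≤ T ω} := by
    refine measure_mono_ae ?_
    filter_upwards [hall, hVQ] with ω h1 h2 h3
    obtain ⟨h3, h4⟩ := h3
    have h5 := exists_le_norm_sum_indicator (fun k hk => (h1 k hk).2) h3 h4
    have h6 := hf.exp_norm_le (a := a) (M N ω)
    show Real.exp (a * x - c * Q) ≤ T ω
    have h7 : Real.exp (a * x - c * Q) = Real.exp (-c * Q) * Real.exp (a * x) := by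
      rw [← Real.exp_add]
      ring_nf
    rw [h7]
    refine mul_le_mul (Real.exp_le_exp.2 ?_) ((Real.exp_le_exp.2 ?_).trans h6)
      (Real.exp_pos _).le (Real.exp_pos _).le
    · have := mul_le_mul_of_nonneg_left (h2 N le_rfl) hc0
      linarith
    · exact mul_le_mul_of_nonneg_left h5 ha
  refine hsub.trans ?_
  rw [← ENNReal.ofReal_toReal (measure_ne_top P {ω | Real.exp (a * x - c * Q) ≤ T ω})]
  refine ENNReal.ofReal_le_ofReal ?_
  have h8 := hmark.trans hfin
  rw [← le_div_iff₀' (Real.exp_pos _), ← Real.exp_sub] at h8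
  refine h8.trans (le_of_eq ?_)
  congr 1
  ring

end Freedman

/-! ### Dyadic estimates for the iterated logarithm. -/

section Numerics

theorem one_le_logOne (x : ℝ) : 1 ≤ logOne x := le_max_right _ _

theorem logOne_mono {x y : ℝ} (hx : 0 < x) (hxy : x ≤ y) : logOne x ≤ logOne y :=
  max_le_max (Real.log_le_log hx hxy) le_rfl

theorem logOne_two_mul_le {x : ℝ} (hx : 0 < x) : logOne (2 * x) ≤ logOne x + Real.log 2 := by
  have h2 : 0 ≤ Real.log 2 := Real.log_nonneg one_le_two
  refine max_le ?_ ?_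
  · rw [Real.log_mul two_ne_zero hx.ne']
    have := le_max_left (Real.log x) 1
    unfold logOne
    linarith
  · linarith [one_le_logOne x]

/-- The iterated logarithm at `2 ^ m`. -/
noncomputable def dyadicLog (m : ℕ) : ℝ := logOne (logOne (2 ^ m))

/-- The truncation level at `2 ^ m`. -/
noncomputable def dyadicLevel (m : ℕ) : ℝ := √(2 ^ m / dyadicLog m)

theorem one_le_dyadicLog (m : ℕ) : 1 ≤ dyadicLog m := one_le_logOne _

/-- Doubling `2 ^ m` at most doubles its `L`, hence adds at most `log 2 < 0.7` to the iterated `L`,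
which is at least `1`. -/
theorem dyadicLog_succ_le (m : ℕ) : dyadicLog (m + 1) ≤ 17 / 10 * dyadicLog m := by
  have hl := Real.log_two_lt_d9
  have h1 : logOne (2 ^ (m + 1)) ≤ 2 * logOne (2 ^ m) := by
    rw [pow_succ']
    have := logOne_two_mul_le (x := (2 : ℝ) ^ m) (by positivity)
    linarith [one_le_logOne (2 ^ m)]
  have hp : 0 < logOne (2 ^ m) := zero_lt_one.trans_le (one_le_logOne _)
  have h2 : dyadicLog (m + 1) ≤ logOne (2 * logOne (2 ^ m)) :=
    logOne_mono (zero_lt_one.trans_le (one_le_logOne _)) h1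
  have h3 := logOne_two_mul_le hp
  have h4 := one_le_dyadicLog m
  unfold dyadicLog at *
  linarith

theorem dyadicLevel_pos (m : ℕ) : 0 < dyadicLevel m :=
  Real.sqrt_pos.2 (div_pos (by positivity) (zero_lt_one.trans_le (one_le_dyadicLog m)))

/-- `2 / 1.7 ≥ 1.08 ^ 2`: the levels grow geometrically in spite of the logarithm. -/
theorem dyadicLevel_succ (m : ℕ) : 108 / 100 * dyadicLevel m ≤ dyadicLevel (m + 1) := by
  have h1 := one_le_dyadicLog m
  have h2 := one_le_dyadicLog (m + 1)
  have h3 := dyadicLog_succ_le m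
  refine Real.le_sqrt_of_sq_le ?_
  rw [mul_pow, dyadicLevel, Real.sq_sqrt (by positivity), pow_succ (2 : ℝ), mul_div_assoc',
    div_le_div_iff₀ (by positivity) (by positivity)]
  have : (0 : ℝ) < 2 ^ m := by positivity
  nlinarith [mul_le_mul_of_nonneg_left h3 this.le]

theorem dyadicLevel_mono : Monotone dyadicLevel :=
  monotone_nat_of_le_succ fun m => by linarith [dyadicLevel_succ m, dyadicLevel_pos m]

/-- A geometric sum of ratio `1.08`, with `25 / 2 = 1 / 0.08`. -/
theorem sum_dyadicLevel_le (M : ℕ) :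
    ∑ m ∈ Finset.range M, dyadicLevel m ≤ 25 / 2 * dyadicLevel M := by
  induction M with
  | zero => simpa using (dyadicLevel_pos 0).le
  | succ M ih =>
    rw [Finset.sum_range_succ]
    linarith [dyadicLevel_succ M]

theorem sum_dyadicLevel_lt_le {y : ℝ} (hy : 0 ≤ y) (M : ℕ) :
    ∑ m ∈ Finset.range M, (if dyadicLevel m < y then dyadicLevel m else 0) ≤ 14 * y := by
  induction M with
  | zero => simpa using hy
  | succ M ih =>
    by_cases h : dyadicLevel M < y
    · calc _ ≤ ∑ m ∈ Finset.range (M + 1), dyadicLevel m := by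
            refine Finset.sum_le_sum fun m _ => ?_
            split_ifs
            exacts [le_rfl, (dyadicLevel_pos m).le]
        _ ≤ 14 * y := by
            rw [Finset.sum_range_succ]
            linarith [sum_dyadicLevel_le M]
    · rw [Finset.sum_range_succ, if_neg h, add_zero]
      exact ih

theorem sqrt_le_lilNorm {m n : ℕ} (h : 2 ^ m ≤ n) : √(2 ^ m * dyadicLog m) ≤ lilNorm n := by
  have hn : (2 : ℝ) ^ m ≤ n := by exact_mod_cast h
  refine Real.sqrt_le_sqrt (mul_le_mul hn ?_ ?_ (by positivity))
  · exact logOne_mono (zero_lt_one.trans_le (one_le_logOne _)) (logOne_mono (by positivity) hn)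
  · exact zero_le_one.trans (one_le_dyadicLog m)

theorem lilNorm_pos {n : ℕ} (hn : 1 ≤ n) : 0 < lilNorm n := by
  have h1 : (1 : ℝ) ≤ n := by exact_mod_cast hn
  exact Real.sqrt_pos.2 (mul_pos (by positivity) (zero_lt_one.trans_le (one_le_logOne _)))

theorem lilNorm_mono {n k : ℕ} (hn : 1 ≤ n) (hk : n ≤ k) : lilNorm n ≤ lilNorm k := by
  have h1 : (1 : ℝ) ≤ n := by exact_mod_cast hn
  have h2 : (n : ℝ) ≤ k := by exact_mod_cast hk
  refine Real.sqrt_le_sqrt (mul_le_mul h2 ?_ ?_ (by positivity))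
  · exact logOne_mono (zero_lt_one.trans_le (one_le_logOne _)) (logOne_mono (by positivity) h2)
  · exact zero_le_one.trans (one_le_logOne _)

theorem sqrt_le_lilNorm_self (n : ℕ) : √n ≤ lilNorm n :=
  Real.sqrt_le_sqrt (le_mul_of_one_le_right (by positivity) (one_le_logOne _))

theorem two_pow_div_sqrt (m : ℕ) : 2 ^ m / √(2 ^ m * dyadicLog m) = dyadicLevel m := by
  have h := one_le_dyadicLog m
  rw [dyadicLevel, Real.sqrt_div (by positivity), Real.sqrt_mul (by positivity), div_mul_eq_div_div,
    Real.div_sqrt]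

/-- The block of `2 ^ m` has `2 ^ m` indices, each contributing at most `1 / √(2 ^ m * dyadicLog
m)`, in total `dyadicLevel m`. The levels below `y` then sum to a multiple of `y`. -/
theorem sum_inv_lilNorm_block_le {y : ℝ} (hy : 0 ≤ y) (N : ℕ) :
    ∑ k ∈ Finset.range N,
      (if dyadicLevel (Nat.log 2 (k + 1)) < y then (lilNorm (k + 1))⁻¹ else 0) ≤ 14 * y := by
  set F : ℕ → ℝ := fun k =>
    if dyadicLevel (Nat.log 2 (k + 1)) < y then (lilNorm (k + 1))⁻¹ else 0 with hF
  have hF0 : ∀ k, 0 ≤ F k := fun k => by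
    simp only [hF]
    split_ifs
    exacts [inv_nonneg.2 (Real.sqrt_nonneg _), le_rfl]
  have hblock : ∀ M, ∑ k ∈ Finset.range (2 ^ M - 1), F k
      ≤ ∑ m ∈ Finset.range M, (if dyadicLevel m < y then dyadicLevel m else 0) := by
    intro M
    induction M with
    | zero => simp
    | succ M ih =>
      have h1 : 1 ≤ 2 ^ M := Nat.one_le_two_pow
      have hle : 2 ^ M - 1 ≤ 2 ^ (M + 1) - 1 := by
        rw [pow_succ]; omega
      rw [Finset.sum_range_succ, ← Finset.sum_range_add_sum_Ico _ hle]
      refine add_le_add ih ?_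
      have hk : ∀ k ∈ Finset.Ico (2 ^ M - 1) (2 ^ (M + 1) - 1),
          F k ≤ if dyadicLevel M < y then (√(2 ^ M * dyadicLog M))⁻¹ else 0 := fun k hk => by
        rw [Finset.mem_Ico] at hk
        have hlog : Nat.log 2 (k + 1) = M := by
          rw [Nat.log_eq_iff (Or.inr ⟨one_lt_two, by omega⟩)]
          omega
        simp only [hF, hlog]
        split_ifs
        · have := one_le_dyadicLog M
          exact inv_anti₀ (by positivity) (sqrt_le_lilNorm (by omega))
        · exact le_rfl
      refine (Finset.sum_le_sum hk).trans ?_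
      rw [Finset.sum_const, Nat.card_Ico, nsmul_eq_mul]
      have hc : 2 ^ (M + 1) - 1 - (2 ^ M - 1) = 2 ^ M := by rw [pow_succ]; omega
      rw [hc]
      split_ifs
      · rw [← two_pow_div_sqrt M]
        push_cast
        rw [div_eq_mul_inv]
      · simp
  have hN : N ≤ 2 ^ (N + 1) - 1 := by
    have := Nat.lt_two_pow_self (n := N + 1)
    omega
  exact (Finset.sum_le_sum_of_subset_of_nonneg (Finset.range_subset_range.2 hN)
    fun k _ _ => hF0 k).trans ((hblock (N + 1)).trans (sum_dyadicLevel_lt_le hy _))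

/-- `exp (dyadicLog m) ≥ L(2 ^ m) ≥ (m + 1) / 3`, so the terms are at most `9 / (m + 1) ^ 2`. -/
theorem summable_exp_neg_dyadicLog : Summable fun m : ℕ => Real.exp (-2 * dyadicLog m) := by
  have hb : Summable fun m : ℕ => 9 * (1 / ((m + 1 : ℕ) : ℝ) ^ 2) :=
    ((summable_nat_add_iff 1).2 (Real.summable_one_div_nat_pow.2 one_lt_two)).mul_left 9
  refine hb.of_nonneg_of_le (fun _ => (Real.exp_pos _).le) fun m => ?_
  have hL : ((m + 1 : ℕ) : ℝ) / 3 ≤ logOne (2 ^ m) := by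
    have h1 := one_le_logOne (2 ^ m)
    have h2 : m * Real.log 2 ≤ logOne (2 ^ m) := by
      rw [← Real.log_pow]; exact le_max_left _ _
    have hl := Real.log_two_gt_d9
    push_cast
    have hm : (0 : ℝ) ≤ m := by positivity
    rcases le_or_gt 1 m with h | h
    · have : (1 : ℝ) ≤ m := by exact_mod_cast h
      nlinarith
    · have : m = 0 := by omega
      subst this
      rw [Nat.cast_zero, zero_add]
      exact (by norm_num : (1 : ℝ) / 3 ≤ 1).trans h1
  have hp : 0 < logOne (2 ^ m) := zero_lt_one.trans_le (one_le_logOne _)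
  have hexp : logOne (2 ^ m) ≤ Real.exp (dyadicLog m) := by
    rw [← Real.log_le_iff_le_exp hp]
    exact le_max_left _ _
  have h3 : ((m + 1 : ℕ) : ℝ) / 3 ≤ Real.exp (dyadicLog m) := hL.trans hexp
  have e : Real.exp (-2 * dyadicLog m) = (Real.exp (dyadicLog m) ^ 2)⁻¹ := by
    rw [← Real.exp_nat_mul, ← Real.exp_neg]
    congr 1
    push_cast
    ring
  rw [e]
  have hm1 : (0 : ℝ) < ((m + 1 : ℕ) : ℝ) := by positivity
  calc (Real.exp (dyadicLog m) ^ 2)⁻¹ ≤ ((((m + 1 : ℕ) : ℝ) / 3) ^ 2)⁻¹ := by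
        apply inv_anti₀ (by positivity)
        gcongr
    _ = _ := by
        rw [div_pow, inv_div]
        ring

end Numerics

/-! ### The maximal ergodic theorem and transport of conditional expectations. -/

section Ergodic

variable {Ω : Type*} {m0 : MeasurableSpace Ω} {P : Measure Ω} {T : Ω → Ω}

/-- `max (0, S₁ h, …, S_n h)`, where `S_k h` are the Birkhoff sums of `h`. -/
noncomputable def birkhoffMax (T : Ω → Ω) (h : Ω → ℝ) : ℕ → Ω → ℝ
  | 0 => fun _ => 0
  | n + 1 => fun ω => max 0 (h ω + birkhoffMax T h n (T ω))

theorem MeasureTheory.MeasurePreserving.integral_comp_of_aestronglyMeasurable {E : Type*}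
    [NormedAddCommGroup E] [NormedSpace ℝ E] {Ω' : Type*} {m' : MeasurableSpace Ω'}
    {P' : Measure Ω'} {T : Ω → Ω'} (hT : MeasurePreserving T P P') {g : Ω' → E}
    (hg : AEStronglyMeasurable g P') : ∫ ω, g (T ω) ∂P = ∫ ω, g ω ∂P' := by
  have h := integral_map (μ := P) hT.measurable.aemeasurable (f := g) (by rwa [hT.map_eq])
  rw [hT.map_eq] at h
  exact h.symm

theorem birkhoffMax_le_succ (T : Ω → Ω) (h : Ω → ℝ) (n : ℕ) (ω : Ω) :
    birkhoffMax T h n ω ≤ birkhoffMax T h (n + 1) ω := by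
  induction n generalizing ω with
  | zero => exact le_max_left _ _
  | succ n ih => exact max_le_max le_rfl (by simpa using ih (T ω))

theorem birkhoffMax_nonneg (T : Ω → Ω) (h : Ω → ℝ) (n : ℕ) (ω : Ω) : 0 ≤ birkhoffMax T h n ω := by
  cases n with
  | zero => exact le_rfl
  | succ n => exact le_max_left _ _

theorem sum_le_birkhoffMax (T : Ω → Ω) (h : Ω → ℝ) (n : ℕ) (ω : Ω) :
    ∑ k ∈ Finset.range n, h (T^[k] ω) ≤ birkhoffMax T h n ω := by
  induction n generalizing ω with
  | zero => simp [birkhoffMax]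
  | succ n ih =>
    rw [Finset.sum_range_succ']
    refine le_trans ?_ (le_max_right _ _)
    have := ih (T ω)
    simp only [Function.iterate_succ_apply, Function.iterate_zero, id_eq]
    linarith

theorem integrable_birkhoffMax [IsFiniteMeasure P] (hT : MeasurePreserving T P P) {h : Ω → ℝ}
    (hh : Integrable h P) (n : ℕ) : Integrable (birkhoffMax T h n) P := by
  induction n with
  | zero => exact integrable_zero _ _ _
  | succ n ih =>
    exact (integrable_zero _ _ _).sup (hh.add ((hT.integrable_comp ih.1).2 ih))

theorem measurable_birkhoffMax (hT : Measurable T) {h : Ω → ℝ} (hh : Measurable h) (n : ℕ) :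
    Measurable (birkhoffMax T h n) := by
  induction n with
  | zero => exact measurable_const
  | succ n ih => exact measurable_const.max (hh.add (ih.comp hT))

/-- The maximal ergodic theorem. -/
theorem MeasureTheory.MeasurePreserving.measure_exists_lt_sum_le [IsProbabilityMeasure P]
    (hT : MeasurePreserving T P P) {g : Ω → ℝ} (hgm : Measurable g) (hg : Integrable g P)
    (hg0 : 0 ≤ᵐ[P] g) {B : ℝ} (hB : 0 < B) :
    P {ω | ∃ n : ℕ, n * B < ∑ k ∈ Finset.range n, g (T^[k] ω)}
      ≤ ENNReal.ofReal ((∫ ω, g ω ∂P) / B) := by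
  set h : Ω → ℝ := fun ω => g ω - B
  have hh : Integrable h P := hg.sub (integrable_const _)
  have hhm : Measurable h := hgm.sub_const _
  set A : ℕ → Set Ω := fun n => {ω | 0 < birkhoffMax T h n ω} with hA
  have hAm : ∀ n, MeasurableSet (A n) := fun n =>
    measurableSet_lt measurable_const (measurable_birkhoffMax hT.measurable hhm n)
  have hmono : Monotone A := monotone_nat_of_le_succ fun n ω hω =>
    lt_of_lt_of_le hω (birkhoffMax_le_succ T h n ω)
  have hsub : {ω | ∃ n : ℕ, n * B < ∑ k ∈ Finset.range n, g (T^[k] ω)} ⊆ ⋃ n, A n := by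
    rintro ω ⟨n, hn⟩
    refine Set.mem_iUnion.2 ⟨n, lt_of_lt_of_le ?_ (sum_le_birkhoffMax T h n ω)⟩
    simp only [h, Finset.sum_sub_distrib, Finset.sum_const, Finset.card_range, nsmul_eq_mul]
    linarith
  refine (measure_mono hsub).trans ?_
  rw [hmono.measure_iUnion]
  refine iSup_le fun n => ?_
  have hM := integrable_birkhoffMax hT hh n
  have hMT : Integrable (fun ω => birkhoffMax T h n (T ω)) P := (hT.integrable_comp hM.1).2 hM
  have hpos : ∫ ω in A n, h ω ∂P ≥ 0 := by
    -- Garsia's argument: where `M_n > 0`, `M_n = h + M_{n-1} ∘ T ≤ h + M_n ∘ T`. Integrating over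
    -- this set, invariance of `P` gives a nonnegative integral of `h`.
    have h1 : ∫ ω in A n, (birkhoffMax T h n ω - birkhoffMax T h n (T ω)) ∂P
        ≤ ∫ ω in A n, h ω ∂P := by
      refine setIntegral_mono_on (hM.sub hMT).integrableOn hh.integrableOn (hAm n) fun ω hω => ?_
      cases n with
      | zero => exact absurd (show (0 : ℝ) < 0 from hω) (lt_irrefl _)
      | succ n =>
        have hω' : 0 < max 0 (h ω + birkhoffMax T h n (T ω)) := hω
        have h2 : birkhoffMax T h (n + 1) ω = h ω + birkhoffMax T h n (T ω) := by
          rcases lt_max_iff.1 hω' with h | h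
          · exact absurd h (lt_irrefl _)
          · exact max_eq_right h.le
        have := birkhoffMax_le_succ T h n (T ω)
        linarith
    have h2 : ∫ ω in A n, birkhoffMax T h n ω ∂P = ∫ ω, birkhoffMax T h n ω ∂P :=
      setIntegral_eq_integral_of_forall_compl_eq_zero fun ω hω =>
        le_antisymm (not_lt.1 hω) (birkhoffMax_nonneg T h n ω)
    have h3 : ∫ ω in A n, birkhoffMax T h n (T ω) ∂P ≤ ∫ ω, birkhoffMax T h n (T ω) ∂P :=
      setIntegral_le_integral hMT (ae_of_all _ fun ω => birkhoffMax_nonneg T h n (T ω))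
    have h4 : ∫ ω, birkhoffMax T h n (T ω) ∂P = ∫ ω, birkhoffMax T h n ω ∂P :=
      hT.integral_comp_of_aestronglyMeasurable hM.1
    rw [integral_sub hM.integrableOn hMT.integrableOn] at h1
    linarith
  have h5 : B * P.real (A n) ≤ ∫ ω, g ω ∂P := by
    have h6 : ∫ ω in A n, h ω ∂P = ∫ ω in A n, g ω ∂P - B * P.real (A n) := by
      simp only [h]
      rw [integral_sub hg.integrableOn (integrable_const _)]
      simp [mul_comm]
    have h7 : ∫ ω in A n, g ω ∂P ≤ ∫ ω, g ω ∂P := setIntegral_le_integral hg hg0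
    linarith
  rw [← ENNReal.ofReal_toReal (measure_ne_top P (A n))]
  refine ENNReal.ofReal_le_ofReal ?_
  rwa [le_div_iff₀' hB]

theorem MeasureTheory.MeasurePreserving.condExp_comp {Ω : Type*} {m m0 : MeasurableSpace Ω}
    {P : Measure Ω} {T : Ω → Ω} {E : Type*} [NormedAddCommGroup E]
    [NormedSpace ℝ E] [CompleteSpace E] [IsFiniteMeasure P] (hT : MeasurePreserving T P P)
    (hm : m ≤ m0) {X : Ω → E} (hX : Integrable X P) :
    P[X ∘ T | m.comap T] =ᵐ[P] P[X | m] ∘ T := by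
  have hmT : m.comap T ≤ m0 := (MeasurableSpace.comap_mono hm).trans hT.measurable.comap_le
  have hXT : Integrable (X ∘ T) P := (hT.integrable_comp hX.1).2 hX
  have hc : Integrable (P[X | m]) P := integrable_condExp
  have hcT : Integrable (P[X | m] ∘ T) P := (hT.integrable_comp hc.1).2 hc
  have hset : ∀ {g : Ω → E} {s : Set Ω}, Integrable g P → MeasurableSet[m0] s →
      ∫ ω in T ⁻¹' s, g (T ω) ∂P = ∫ ω in s, g ω ∂P := fun {g s} hg hs =>
    (hT.restrict_preimage hs).integral_comp_of_aestronglyMeasurable hg.1.restrict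
  refine (ae_eq_condExp_of_forall_setIntegral_eq hmT hXT (fun _ _ _ => hcT.integrableOn)
    (fun s hs _ => ?_) ?_).symm
  · obtain ⟨t, ht, rfl⟩ := hs
    have h1 := hset hc (hm t ht)
    have h2 := hset hX (hm t ht)
    simp only [Function.comp_apply]
    rw [h1, h2, setIntegral_condExp hm hX ht]
  · exact (stronglyMeasurable_condExp.comp_measurable (comap_measurable T)).aestronglyMeasurable

end Ergodic

/-! ### Tail of the maximal function by truncation. -/

section Tail

variable {Ω : Type*} {m1 m0 : MeasurableSpace Ω} {P : Measure Ω} {T : Ω → Ω}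
  {E : Type*} [NormedAddCommGroup E] [NormedSpace ℝ E] [CompleteSpace E]

/-- The increasing filtration `T⁻ᵏ(m1)`. -/
def iterFiltration (hT : Measurable[m0, m0] T) (hm1 : m1 ≤ m0) (hinv : m1 ≤ m1.comap T) :
    Filtration ℕ m0 where
  seq k := m1.comap T^[k]
  mono' := monotone_nat_of_le_succ fun k => by
    rw [Function.iterate_succ', ← MeasurableSpace.comap_comp]
    exact MeasurableSpace.comap_mono hinv
  le' k := (MeasurableSpace.comap_mono hm1).trans (hT.iterate k).comap_le

/-- By Tonelli the sum is taken pointwise first, and is at most `14 c ‖Y‖` by the block estimate;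
the remaining factor `‖Y‖` makes it a second moment. -/
theorem tsum_lintegral_indicator_enorm_le {Y : Ω → E} (hYm : StronglyMeasurable Y)
    (hYi : Integrable (fun ω => ‖Y ω‖ ^ 2) P) {c : ℝ} (hc : 0 ≤ c) :
    ∑' k : ℕ, (∫⁻ ω, {ω | dyadicLevel (Nat.log 2 (k + 1)) < c * ‖Y ω‖}.indicator
      (fun ω => ‖Y ω‖ₑ) ω ∂P) * ENNReal.ofReal (lilNorm (k + 1))⁻¹
      ≤ ENNReal.ofReal (14 * c * ∫ ω, ‖Y ω‖ ^ 2 ∂P) := by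
  have hms : ∀ b : ℝ, MeasurableSet {ω | b < c * ‖Y ω‖} := fun b =>
    measurableSet_lt measurable_const (hYm.norm.measurable.const_mul c)
  have hme : ∀ k : ℕ, Measurable fun ω => {ω | dyadicLevel (Nat.log 2 (k + 1)) < c * ‖Y ω‖}.indicator
      (fun ω => ‖Y ω‖ₑ) ω := fun k => hYm.enorm.indicator (hms _)
  simp_rw [← fun k => lintegral_mul_const (μ := P) (ENNReal.ofReal (lilNorm (k + 1))⁻¹) (hme k)]
  rw [← lintegral_tsum fun k => ((hme k).mul_const _).aemeasurable, ← integral_const_mul,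
    ofReal_integral_eq_lintegral_ofReal (hYi.const_mul _) (ae_of_all _ fun ω => by positivity)]
  refine lintegral_mono fun ω => ENNReal.tsum_le_of_sum_range_le fun N => ?_
  have hF : ∀ k : ℕ, {ω | dyadicLevel (Nat.log 2 (k + 1)) < c * ‖Y ω‖}.indicator
      (fun ω => ‖Y ω‖ₑ) ω * ENNReal.ofReal (lilNorm (k + 1))⁻¹
      = ENNReal.ofReal (‖Y ω‖ * if dyadicLevel (Nat.log 2 (k + 1)) < c * ‖Y ω‖
          then (lilNorm (k + 1))⁻¹ else 0) := fun k => by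
    by_cases h : dyadicLevel (Nat.log 2 (k + 1)) < c * ‖Y ω‖
    · rw [Set.indicator_of_mem (by exact h), if_pos h, ENNReal.ofReal_mul (norm_nonneg _),
        ofReal_norm]
    · rw [Set.indicator_of_notMem (by exact h), if_neg h]
      simp
  simp_rw [hF]
  rw [← ENNReal.ofReal_sum_of_nonneg, ← Finset.mul_sum]
  · refine ENNReal.ofReal_le_ofReal ?_
    have := sum_inv_lilNorm_block_le (mul_nonneg hc (norm_nonneg (Y ω))) N
    calc _ ≤ ‖Y ω‖ * (14 * (c * ‖Y ω‖)) := by gcongr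
      _ = _ := by ring
  · intro k _
    refine mul_nonneg (norm_nonneg _) ?_
    split_ifs
    exacts [inv_nonneg.2 (Real.sqrt_nonneg _), le_rfl]

/-- A tail estimate for the maximal function of a stationary sequence of martingale differences. -/
theorem SmoothMajorant.measure_exists_lilNorm_lt_le [IsProbabilityMeasure P] {f : E → ℝ} {D : ℝ}
    (hf : SmoothMajorant f D) (hT : MeasurePreserving T P P) (hm1 : m1 ≤ m0)
    (hinv : m1 ≤ m1.comap T) {Y : Ω → E} (hYm : StronglyMeasurable[m1.comap T] Y)
    (hYi : Integrable (fun ω => ‖Y ω‖ ^ 2) P) (hY0 : P[Y | m1] =ᵐ[P] 0)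
    (hnorm : D ^ 2 * ∫ ω, ‖Y ω‖ ^ 2 ∂P ≤ 1) {z κ : ℝ} (hz : 0 < z) (hκ : 24 ≤ κ) :
    P {ω | ∃ n : ℕ, 1 ≤ n ∧ z * lilNorm n < ‖∑ k ∈ Finset.range n, Y (T^[k] ω)‖}
      ≤ ENNReal.ofReal (κ ^ 2 / z ^ 2 + 56 * κ / z ^ 2
        + Real.exp (7 - κ / 4) * ∑' m : ℕ, Real.exp (-2 * dyadicLog m)) := by
  have hD := hf.one_le
  have hD0 : 0 < D := zero_lt_one.trans_le hD
  have hκ0 : 0 < κ := by linarith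
  set 𝒢 := iterFiltration hT.measurable hm1 hinv with h𝒢
  have hTk : ∀ k, MeasurePreserving T^[k] P P := fun k => hT.iterate k
  have hmT : m1.comap T ≤ m0 := (MeasurableSpace.comap_mono hm1).trans hT.measurable.comap_le
  have hYm0 : StronglyMeasurable Y := hYm.mono hmT
  have hYL : MemLp Y 2 P :=
    (memLp_two_iff_integrable_sq_norm hYm0.aestronglyMeasurable).2 hYi
  have hYint : Integrable Y P := hYL.integrable one_le_two
  -- the differences
  set Yk : ℕ → Ω → E := fun k ω => Y (T^[k] ω) with hYk
  have hYkm : ∀ k, StronglyMeasurable[𝒢 (k + 1)] (Yk k) := fun k => by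
    have h1 : 𝒢 (k + 1) = (m1.comap T).comap T^[k] := by
      show m1.comap T^[k + 1] = _
      rw [Function.iterate_succ', MeasurableSpace.comap_comp]
    rw [h1]
    exact hYm.comp_measurable (comap_measurable _)
  have hYkint : ∀ k, Integrable (Yk k) P := fun k => ((hTk k).integrable_comp hYint.1).2 hYint
  have hYki2 : ∀ k, Integrable (fun ω => ‖Yk k ω‖ ^ 2) P := fun k =>
    ((hTk k).integrable_comp hYi.1).2 hYi
  have hYk0 : ∀ k, P[Yk k | 𝒢 k] =ᵐ[P] 0 := fun k =>
    ((hTk k).condExp_comp hm1 hYint).trans ((hTk k).quasiMeasurePreserving.ae_eq_comp hY0)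
  set V0 : Ω → ℝ := P[fun ω => ‖Y ω‖ ^ 2 | m1] with hV0
  have hV0m : StronglyMeasurable[m1] V0 := stronglyMeasurable_condExp
  have hV00 : 0 ≤ᵐ[P] V0 := condExp_nonneg (ae_of_all _ fun ω => by positivity)
  have hV0k : ∀ k, P[fun ω => ‖Yk k ω‖ ^ 2 | 𝒢 k] =ᵐ[P] fun ω => V0 (T^[k] ω) := fun k =>
    (hTk k).condExp_comp hm1 hYi
  -- truncation
  set c : ℝ := κ * D / z with hc
  have hc0 : 0 < c := by positivity
  -- Index `k` belongs to block `m` when `2 ^ m ≤ k + 1 < 2 ^ (m + 1)`. The factor `c` makes the cut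
  -- as large as Freedman's inequality, used below with `a * D * ρ = 1`, allows.
  set A : ℕ → Set Ω := fun k => {ω | dyadicLevel (Nat.log 2 (k + 1)) < c * ‖Yk k ω‖} with hA
  have hAm : ∀ k, MeasurableSet[𝒢 (k + 1)] (A k) := fun k =>
    StronglyMeasurable.measurableSet_lt (m := 𝒢 (k + 1)) stronglyMeasurable_const
      ((hYkm k).norm.const_mul c)
  set U : ℕ → Ω → E := fun k => (A k).indicator (Yk k) with hU
  set R : ℕ → Ω → E := fun k => (A k)ᶜ.indicator (Yk k) with hR
  have hUm : ∀ k, StronglyMeasurable[𝒢 (k + 1)] (U k) := fun k => (hYkm k).indicator (hAm k)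
  have hRm : ∀ k, StronglyMeasurable[𝒢 (k + 1)] (R k) := fun k => (hYkm k).indicator (hAm k).compl
  have hUint : ∀ k, Integrable (U k) P := fun k => (hYkint k).indicator (𝒢.le _ _ (hAm k))
  have hRint : ∀ k, Integrable (R k) P := fun k => (hYkint k).indicator (𝒢.le _ _ (hAm k).compl)
  have hRb : ∀ k ω, ‖R k ω‖ ≤ dyadicLevel (Nat.log 2 (k + 1)) / c := fun k ω => by
    by_cases h : ω ∈ A k
    · have : R k ω = 0 := Set.indicator_of_notMem (by simpa using h) _
      rw [this, norm_zero]
      exact div_nonneg (dyadicLevel_pos _).le hc0.le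
    · have : R k ω = Yk k ω := Set.indicator_of_mem (by simpa using h) _
      rw [this, le_div_iff₀' hc0]
      exact not_lt.1 h
  have hRY : ∀ k ω, ‖R k ω‖ ≤ ‖Yk k ω‖ := fun k ω => norm_indicator_le_norm_self _ _
  set Z : ℕ → Ω → E := fun k => R k - P[R k | 𝒢 k] with hZ
  have hZm : ∀ k, StronglyMeasurable[𝒢 (k + 1)] (Z k) := fun k =>
    (hRm k).sub (stronglyMeasurable_condExp.mono (𝒢.mono (Nat.le_succ k)))
  have hZ0 : ∀ k, P[Z k | 𝒢 k] =ᵐ[P] 0 := fun k => by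
    refine (condExp_sub (hRint k) integrable_condExp _).trans ?_
    rw [condExp_of_stronglyMeasurable (𝒢.le k) stronglyMeasurable_condExp integrable_condExp,
      sub_self]
  have hRcb : ∀ k, ∀ᵐ ω ∂P, ‖P[R k | 𝒢 k] ω‖ ≤ dyadicLevel (Nat.log 2 (k + 1)) / c := fun k =>
    ae_bdd_norm_condExp_of_ae_bdd_norm (ae_of_all _ (hRb k))
  have hZb : ∀ k, ∀ᵐ ω ∂P, ‖Z k ω‖ ≤ 2 * dyadicLevel (Nat.log 2 (k + 1)) / c := fun k => by
    filter_upwards [hRcb k] with ω h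
    calc ‖Z k ω‖ ≤ ‖R k ω‖ + ‖P[R k | 𝒢 k] ω‖ := norm_sub_le _ _
      _ ≤ dyadicLevel (Nat.log 2 (k + 1)) / c + dyadicLevel (Nat.log 2 (k + 1)) / c :=
        add_le_add (hRb k ω) h
      _ = _ := by ring
  -- The compensators of `U` and `R` cancel because `Yk k` is centred given `𝒢 k`.
  have hsum : ∀ᵐ ω ∂P, ∀ k, Yk k ω = Z k ω + (U k ω - P[U k | 𝒢 k] ω) := by
    rw [ae_all_iff]
    intro k
    have e : U k + R k = Yk k := Set.indicator_self_add_compl _ _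
    have h1 := condExp_add (hUint k) (hRint k) (𝒢 k)
    rw [e] at h1
    filter_upwards [h1, hYk0 k] with ω h2 h3
    have h4 : P[R k | 𝒢 k] ω = -P[U k | 𝒢 k] ω := by
      rw [h3] at h2
      exact (neg_eq_of_add_eq_zero_right h2.symm).symm
    have h5 := congrFun e ω
    simp only [Pi.add_apply] at h5
    simp only [hZ, Pi.sub_apply, h4, ← h5]
    abel
  -- conditional variances
  set v : ℕ → Ω → ℝ := fun k ω => 4 * V0 (T^[k] ω) with hv
  have hvm : ∀ k, StronglyMeasurable[𝒢 k] (v k) := fun k =>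
    (hV0m.comp_measurable (comap_measurable _)).const_mul 4
  have hv0 : ∀ k, 0 ≤ᵐ[P] v k := fun k => by
    filter_upwards [(hTk k).quasiMeasurePreserving.ae hV00] with ω h
    exact mul_nonneg (by norm_num) h
  -- The factor 4 comes from `‖R - 𝔼R‖² ≤ 2 (‖R‖² + ‖𝔼R‖²)`, both terms being controlled by the
  -- conditional variance of `Yk` via `‖R‖ ≤ ‖Yk‖` and conditional Jensen.
  have hZv : ∀ k, P[fun ω => ‖Z k ω‖ ^ 2 | 𝒢 k] ≤ᵐ[P] v k := fun k => by
    have hZi2 : Integrable (fun ω => ‖Z k ω‖ ^ 2) P := by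
      refine Integrable.of_bound (C := (2 * dyadicLevel (Nat.log 2 (k + 1)) / c) ^ 2)
        (((hZm k).mono (𝒢.le _)).norm.pow 2).aestronglyMeasurable ?_
      filter_upwards [hZb k] with ω h
      rw [Real.norm_of_nonneg (by positivity)]
      gcongr
    set q : Ω → ℝ := P[fun ω => ‖Yk k ω‖ ^ 2 | 𝒢 k] with hq
    have hRi2 : Integrable (fun ω => ‖R k ω‖ ^ 2) P :=
      (hYki2 k).mono' (((hRm k).mono (𝒢.le _)).norm.pow 2).aestronglyMeasurable
        (ae_of_all _ fun ω => by
          rw [Real.norm_of_nonneg (by positivity)]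
          have := hRY k ω
          gcongr)
    have h1 : ∀ᵐ ω ∂P, ‖P[R k | 𝒢 k] ω‖ ^ 2 ≤ q ω := by
      have hJ := Integrable.norm_condExp_rpow_le (μ := P) (m := 𝒢 k) (f := R k) (p := 2)
        one_le_two (by simpa only [Real.rpow_two] using hRi2)
      have hM : P[fun ω => ‖R k ω‖ ^ 2 | 𝒢 k] ≤ᵐ[P] q :=
        condExp_mono hRi2 (hYki2 k) (ae_of_all _ fun ω => by
          have := hRY k ω
          simp only
          gcongr)
      filter_upwards [hJ, hM] with ω h1 h2
      simp only [Real.rpow_two] at h1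
      refine le_trans ?_ h2
      convert h1 using 2
    have h2 : P[fun ω => ‖Z k ω‖ ^ 2 | 𝒢 k]
        ≤ᵐ[P] P[(2 : ℝ) • ((fun ω => ‖Yk k ω‖ ^ 2) + q) | 𝒢 k] := by
      refine condExp_mono hZi2 (((hYki2 k).add integrable_condExp).smul 2) ?_
      filter_upwards [h1] with ω h
      have h3 : ‖Z k ω‖ ≤ ‖Yk k ω‖ + ‖P[R k | 𝒢 k] ω‖ :=
        (norm_sub_le _ _).trans (add_le_add (hRY k ω) le_rfl)
      simp only [Pi.smul_apply, Pi.add_apply, smul_eq_mul]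
      nlinarith [sq_nonneg (‖Yk k ω‖ - ‖P[R k | 𝒢 k] ω‖), norm_nonneg (Z k ω)]
    refine h2.trans ?_
    have hqi : Integrable q P := integrable_condExp
    have hqm : StronglyMeasurable[𝒢 k] q := stronglyMeasurable_condExp
    have h3 := condExp_add (hYki2 k) hqi (𝒢 k)
    rw [condExp_of_stronglyMeasurable (𝒢.le k) hqm hqi] at h3
    filter_upwards [condExp_smul (2 : ℝ) ((fun ω => ‖Yk k ω‖ ^ 2) + q) (𝒢 k), h3, hV0k k]
      with ω h4 h5 h6
    rw [h4, Pi.smul_apply, h5, Pi.add_apply, h6, smul_eq_mul]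
    simp only [hv]
    linarith
  -- the three exceptional sets
  set B : ℝ := z ^ 2 / (κ ^ 2 * D ^ 2) with hB
  have hB0 : 0 < B := by positivity
  set bad : Set Ω := {ω | ∃ n : ℕ, n * B < ∑ k ∈ Finset.range n, V0 (T^[k] ω)} with hbad
  -- The maximal ergodic theorem bounds this by `𝔼 V0 / B`, which is `κ² / z²` times `D² 𝔼‖Y‖² ≤ 1`.
  have hbadP : P bad ≤ ENNReal.ofReal (κ ^ 2 / z ^ 2) := by
    refine (hT.measure_exists_lt_sum_le (hV0m.mono hm1).measurable integrable_condExp hV00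
      hB0).trans (ENNReal.ofReal_le_ofReal ?_)
    rw [integral_condExp hm1, hB, div_div_eq_mul_div]
    gcongr
    calc _ = κ ^ 2 * (D ^ 2 * ∫ ω, ‖Y ω‖ ^ 2 ∂P) := by ring
      _ ≤ κ ^ 2 * 1 := by gcongr
      _ = _ := mul_one _
  set W : Ω → ℝ≥0∞ := fun ω => ∑' k : ℕ,
    (‖U k ω‖ₑ + ‖P[U k | 𝒢 k] ω‖ₑ) * ENNReal.ofReal (lilNorm (k + 1))⁻¹ with hW
  have hsm : ∀ k, AEMeasurable (fun ω => ‖U k ω‖ₑ + ‖P[U k | 𝒢 k] ω‖ₑ) P := fun k =>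
    (hUint k).1.enorm.add (integrable_condExp (f := U k)).1.enorm
  have hWm : AEMeasurable W P :=
    AEMeasurable.tsum fun k => (hsm k).mul_const _
  -- A truncated part and its compensator together give `𝔼 W ≤ 28 c 𝔼‖Y‖² ≤ 28 κ / z`, using `D ≤ D
  -- ^ 2`. Markov at `z / 2` doubles the 28.
  have hWP : P {ω | ENNReal.ofReal (z / 2) ≤ W ω} ≤ ENNReal.ofReal (56 * κ / z ^ 2) := by
    have hUe : ∀ k, ∫⁻ ω, ‖U k ω‖ₑ ∂P
        = ∫⁻ ω, {ω | dyadicLevel (Nat.log 2 (k + 1)) < c * ‖Y ω‖}.indicator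
          (fun ω => ‖Y ω‖ₑ) ω ∂P := fun k => by
      have hme : Measurable fun ω => {ω | dyadicLevel (Nat.log 2 (k + 1)) < c * ‖Y ω‖}.indicator
          (fun ω => ‖Y ω‖ₑ) ω := hYm0.enorm.indicator
        (measurableSet_lt measurable_const (hYm0.norm.measurable.const_mul c))
      rw [← (hTk k).lintegral_comp hme]
      refine lintegral_congr fun ω => ?_
      by_cases h : ω ∈ A k
      · have e : U k ω = Yk k ω := Set.indicator_of_mem h _
        rw [e, Set.indicator_of_mem (by exact h)]
      · have e : U k ω = 0 := Set.indicator_of_notMem h _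
        rw [e, Set.indicator_of_notMem (by exact h), enorm_zero]
    have hPU : ∀ k, ∫⁻ ω, ‖P[U k | 𝒢 k] ω‖ₑ ∂P ≤ ∫⁻ ω, ‖U k ω‖ₑ ∂P := fun k => by
      have := eLpNorm_condExp_le_eLpNorm (μ := P) (m := 𝒢 k) (U k) (le_refl (1 : ℝ≥0∞))
      rwa [eLpNorm_one_eq_lintegral_enorm, eLpNorm_one_eq_lintegral_enorm] at this
    have hint : ∫⁻ ω, W ω ∂P ≤ ENNReal.ofReal (28 * κ / z) := by
      rw [lintegral_tsum fun k => (hsm k).mul_const _]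
      calc _ ≤ ∑' k : ℕ, 2 * ((∫⁻ ω, {ω | dyadicLevel (Nat.log 2 (k + 1)) < c * ‖Y ω‖}.indicator
              (fun ω => ‖Y ω‖ₑ) ω ∂P) * ENNReal.ofReal (lilNorm (k + 1))⁻¹) := by
            refine ENNReal.tsum_le_tsum fun k => ?_
            rw [lintegral_mul_const'' _ (hsm k), lintegral_add_left' (hUint k).1.enorm, ← hUe, ← mul_assoc, two_mul]
            exact mul_le_mul' (add_le_add le_rfl (hPU k)) le_rfl
        _ ≤ 2 * ENNReal.ofReal (14 * c * ∫ ω, ‖Y ω‖ ^ 2 ∂P) := by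
            rw [ENNReal.tsum_mul_left]
            gcongr
            exact tsum_lintegral_indicator_enorm_le hYm0 hYi hc0.le
        _ = ENNReal.ofReal (2 * (14 * c * ∫ ω, ‖Y ω‖ ^ 2 ∂P)) := by
            rw [ENNReal.ofReal_mul zero_le_two, ENNReal.ofReal_ofNat]
        _ ≤ _ := by
            refine ENNReal.ofReal_le_ofReal ?_
            have h0 : 0 ≤ ∫ ω, ‖Y ω‖ ^ 2 ∂P := integral_nonneg fun _ => by positivity
            have h1 : D * ∫ ω, ‖Y ω‖ ^ 2 ∂P ≤ 1 := by
              refine le_trans ?_ hnorm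
              have : D ≤ D ^ 2 := by nlinarith
              gcongr
            calc 2 * (14 * c * ∫ ω, ‖Y ω‖ ^ 2 ∂P)
                = 28 * κ / z * (D * ∫ ω, ‖Y ω‖ ^ 2 ∂P) := by rw [hc]; ring
              _ ≤ 28 * κ / z * 1 := by gcongr
              _ = _ := mul_one _
    refine (meas_ge_le_lintegral_div hWm (by simpa using hz) ENNReal.ofReal_ne_top).trans ?_
    rw [ENNReal.div_le_iff (by simpa using hz) ENNReal.ofReal_ne_top,
      ← ENNReal.ofReal_mul (by positivity)]
    refine hint.trans (ENNReal.ofReal_le_ofReal (le_of_eq ?_))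
    field_simp
    norm_num
  -- Off `bad`, fewer than `2 * 2 ^ m` values of `V0` average at most `B`, and `v` carries a factor
  -- 4; hence `8 * 2 ^ m * B`. Half of `z` is spent on `Z`, the other half on `W`.
  set F : ℕ → Set Ω := fun m => {ω | ∑ k ∈ Finset.range (2 ^ (m + 1) - 1), v k ω ≤ 8 * 2 ^ m * B ∧
    ∃ n ≤ 2 ^ (m + 1) - 1, z / 2 * √(2 ^ m * dyadicLog m)
      ≤ ‖∑ k ∈ Finset.range n, Z k ω‖} with hF
  have hFP : ∀ m, P (F m) ≤ ENNReal.ofReal (Real.exp (7 - κ / 4) * Real.exp (-2 * dyadicLog m)) := by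
    intro m
    set l := dyadicLog m with hl
    have hl1 : 1 ≤ l := one_le_dyadicLog m
    set b := dyadicLevel m with hb
    have hb0 : 0 < b := dyadicLevel_pos m
    have hb2 : b ^ 2 = 2 ^ m / l := Real.sq_sqrt (by positivity)
    have hbx : √(2 ^ m * l) = l * b := by
      rw [Real.sqrt_eq_iff_mul_self_eq (by positivity) (by positivity)]
      calc 2 ^ m * l = l ^ 2 * b ^ 2 := by rw [hb2]; field_simp
        _ = l * b * (l * b) := by ring
    have hlog : ∀ k < 2 ^ (m + 1) - 1, dyadicLevel (Nat.log 2 (k + 1)) ≤ b := fun k hk => by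
      refine dyadicLevel_mono (Nat.lt_succ_iff.1 ?_)
      rw [Nat.log_lt_iff_lt_pow one_lt_two (Nat.succ_ne_zero _)]
      omega
    have key := hf.measure_exists_le_norm_sum_le 𝒢 (N := 2 ^ (m + 1) - 1) (Z := Z) (v := v)
      (P := P) (a := κ / (2 * z * b)) (ρ := 2 * b / c) (Q := 8 * 2 ^ m * B)
      (x := z / 2 * √(2 ^ m * l)) (by positivity) (by positivity)
      (le_of_eq (by rw [hc]; field_simp)) (by positivity) (fun k _ => hZm k)
      (fun k hk => by
        filter_upwards [hZb k] with ω h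
        have := hlog k hk
        refine h.trans ?_
        gcongr)
      (fun k _ => hZ0 k) (fun k _ => hvm k) (fun k _ => hv0 k) (fun k _ => hZv k)
    refine key.trans (ENNReal.ofReal_le_ofReal ?_)
    rw [← Real.exp_add]
    refine Real.exp_le_exp.2 ?_
    have e1 : 2 * (κ / (2 * z * b)) ^ 2 * D ^ 2 * (8 * 2 ^ m * B) = 4 * l := by
      have : (2 : ℝ) ^ m = l * b ^ 2 := by rw [hb2]; field_simp
      rw [this, hB]
      field_simp
      norm_num
    have e2 : κ / (2 * z * b) * (z / 2 * √(2 ^ m * l)) = κ / 4 * l := by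
      rw [hbx]
      field_simp
      norm_num
    rw [e1, e2]
    -- The inequality `1 + 4 l - κ l / 4 ≤ 7 - κ / 4 - 2 l` is `(6 - κ / 4) (l - 1) ≤ 0`; this is
    -- where `24 ≤ κ` enters.
    nlinarith
  have hcover : P {ω | ∃ n : ℕ, 1 ≤ n ∧ z * lilNorm n < ‖∑ k ∈ Finset.range n, Y (T^[k] ω)‖}
      ≤ P (bad ∪ {ω | ENNReal.ofReal (z / 2) ≤ W ω} ∪ ⋃ m, F m) := by
    refine measure_mono_ae ?_
    filter_upwards [hsum] with ω h1 h2
    obtain ⟨n, hn, hlt⟩ := h2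
    show ω ∈ bad ∪ {ω | ENNReal.ofReal (z / 2) ≤ W ω} ∪ ⋃ m, F m
    by_contra hcon
    simp only [Set.mem_union, not_or, Set.mem_iUnion, not_exists] at hcon
    obtain ⟨⟨hnb, hnW⟩, hnF⟩ := hcon
    have ha := lilNorm_pos hn
    -- Monotonicity of `lilNorm` gives `1 ≤ lilNorm n / lilNorm (k + 1)` for `k < n`, so a partial
    -- sum is at most `lilNorm n` times the weighted series `W`.
    have hrest : ‖∑ k ∈ Finset.range n, (U k ω - P[U k | 𝒢 k] ω)‖ ≤ z / 2 * lilNorm n := by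
      have hWlt : W ω ≤ ENNReal.ofReal (z / 2) := (not_le.1 hnW).le
      rw [← ENNReal.ofReal_le_ofReal_iff (by positivity), ofReal_norm,
        ENNReal.ofReal_mul (by positivity)]
      calc ‖∑ k ∈ Finset.range n, (U k ω - P[U k | 𝒢 k] ω)‖ₑ
          ≤ ∑ k ∈ Finset.range n, ‖U k ω - P[U k | 𝒢 k] ω‖ₑ := enorm_sum_le _ _
        _ ≤ ∑ k ∈ Finset.range n, (‖U k ω‖ₑ + ‖P[U k | 𝒢 k] ω‖ₑ) *
              ENNReal.ofReal (lilNorm (k + 1))⁻¹ * ENNReal.ofReal (lilNorm n) := by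
            refine Finset.sum_le_sum fun k hk => ?_
            have hkn := Finset.mem_range.1 hk
            have h3 : 1 ≤ (lilNorm (k + 1))⁻¹ * lilNorm n := by
              rw [← div_eq_inv_mul, one_le_div (lilNorm_pos (by omega))]
              exact lilNorm_mono (by omega) (by omega)
            rw [mul_assoc, ← ENNReal.ofReal_mul (inv_nonneg.2 (lilNorm_pos (by omega)).le)]
            refine enorm_sub_le.trans (le_mul_of_one_le_right' ?_)
            rw [← ENNReal.ofReal_one]
            exact ENNReal.ofReal_le_ofReal h3
        _ ≤ W ω * ENNReal.ofReal (lilNorm n) := by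
            rw [← Finset.sum_mul]
            gcongr
            exact ENNReal.sum_le_tsum _
        _ ≤ _ := by gcongr
    have hsplit : ∑ k ∈ Finset.range n, Y (T^[k] ω) = ∑ k ∈ Finset.range n, Z k ω
        + ∑ k ∈ Finset.range n, (U k ω - P[U k | 𝒢 k] ω) := by
      rw [← Finset.sum_add_distrib]
      exact Finset.sum_congr rfl fun k _ => h1 k
    have hZn : z / 2 * lilNorm n ≤ ‖∑ k ∈ Finset.range n, Z k ω‖ := by
      rw [hsplit] at hlt
      have := norm_add_le (∑ k ∈ Finset.range n, Z k ω)
        (∑ k ∈ Finset.range n, (U k ω - P[U k | 𝒢 k] ω))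
      linarith
    refine hnF (Nat.log 2 n) ⟨?_, n, ?_, ?_⟩
    · set N := 2 ^ (Nat.log 2 n + 1) - 1 with hN
      have h3 : ∑ k ∈ Finset.range N, V0 (T^[k] ω) ≤ N * B := by
        by_contra h
        exact hnb ⟨N, not_le.1 h⟩
      have h4 : (N : ℝ) ≤ 2 * 2 ^ Nat.log 2 n := by
        have : N ≤ 2 * 2 ^ Nat.log 2 n := by rw [hN, pow_succ]; omega
        exact_mod_cast this
      have h5 : (N : ℝ) * B ≤ 2 * 2 ^ Nat.log 2 n * B := by gcongr
      simp only [hv, ← Finset.mul_sum]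
      linarith
    · have := Nat.lt_pow_succ_log_self one_lt_two n
      omega
    · refine le_trans ?_ hZn
      have := sqrt_le_lilNorm (Nat.pow_log_le_self 2 (by omega : n ≠ 0))
      gcongr
  have hS : Summable fun m : ℕ => Real.exp (7 - κ / 4) * Real.exp (-2 * dyadicLog m) :=
    summable_exp_neg_dyadicLog.mul_left _
  refine hcover.trans ((measure_union_le _ _).trans ?_)
  rw [ENNReal.ofReal_add (by positivity) (mul_nonneg (Real.exp_pos _).le
    (tsum_nonneg fun _ => (Real.exp_pos _).le)), ENNReal.ofReal_add (by positivity) (by positivity)]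
  refine add_le_add ((measure_union_le _ _).trans (add_le_add hbadP hWP)) ?_
  refine (measure_iUnion_le _).trans ?_
  rw [← tsum_mul_left, ENNReal.ofReal_tsum_of_nonneg (fun _ => by positivity) hS]
  exact ENNReal.tsum_le_tsum hFP

end Tail

/-! ### Integrating the tail: moments of the maximal function. -/

section Moment

/-- The tail bound at level `2 ^ j`. -/
noncomputable def tailBound (j : ℕ) : ℝ :=
  (24 + 8 * j) ^ 2 / (2 ^ j) ^ 2 + 56 * (24 + 8 * j) / (2 ^ j) ^ 2
    + Real.exp (7 - (24 + 8 * j) / 4) * ∑' m : ℕ, Real.exp (-2 * dyadicLog m)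

theorem tailBound_nonneg (j : ℕ) : 0 ≤ tailBound j :=
  add_nonneg (by positivity) (mul_nonneg (Real.exp_pos _).le
    (tsum_nonneg fun _ => (Real.exp_pos _).le))

theorem rpow_two_pow_succ (p : ℝ) (j : ℕ) :
    ((2 : ℝ) ^ (j + 1)) ^ p = 2 ^ p * (2 ^ p) ^ j := by
  rw [← pow_succ', ← Real.rpow_natCast, ← Real.rpow_natCast, ← Real.rpow_mul zero_le_two,
    ← Real.rpow_mul zero_le_two, mul_comm]

theorem summable_geometric_mul_sq {a : ℝ} (ha0 : 0 ≤ a) (ha4 : a < 4) (C : ℝ) :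
    Summable fun j : ℕ => a ^ j * (C * ((j : ℝ) + 1) ^ 2 / (2 ^ j) ^ 2) := by
  have h1 : Summable fun j : ℕ => ((j + 2).choose 2 : ℝ) * (a / 4) ^ j :=
    summable_choose_mul_geometric_of_norm_lt_one 2 (by
      rw [Real.norm_of_nonneg (by positivity)]
      linarith)
  have h2 : Summable fun j : ℕ => ((j : ℝ) + 1) ^ 2 * (a / 4) ^ j := by
    refine Summable.of_nonneg_of_le (fun j => by positivity) (fun j => ?_) (h1.mul_left 2)
    rw [Nat.cast_choose_two, ← mul_assoc]
    gcongr
    push_cast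
    nlinarith [show (0 : ℝ) ≤ j by positivity]
  refine (h2.mul_left C).congr fun j => ?_
  have : ((2 : ℝ) ^ j) ^ 2 = 4 ^ j := by rw [← pow_mul, mul_comm, pow_mul]; norm_num
  rw [this, div_pow]
  ring

theorem summable_geometric_mul_exp {a : ℝ} (ha0 : 0 ≤ a) (ha4 : a < 4) :
    Summable fun j : ℕ => a ^ j * Real.exp (7 - (24 + 8 * j) / 4) := by
  have he : a * Real.exp (-2) < 1 := by
    have h2 : 4 ≤ Real.exp 2 := by
      have := Real.add_one_le_exp (1 : ℝ)
      have e : Real.exp 2 = Real.exp 1 ^ 2 := by rw [← Real.exp_nat_mul]; norm_num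
      rw [e]
      nlinarith
    rw [Real.exp_neg, ← div_eq_mul_inv, div_lt_one (Real.exp_pos _)]
    linarith
  refine ((summable_geometric_of_lt_one (by positivity) he).mul_left (Real.exp 1)).congr
    fun j => ?_
  rw [mul_pow, ← Real.exp_nat_mul, mul_left_comm, ← Real.exp_add]
  ring_nf

/-- The choice `κ = 24 + 8 j` at `z = 2 ^ j` makes the polynomial terms `O(j ^ 2 / 4 ^ j)` and the
exponential one `O(e ^ (-2 j))`; both beat `2 ^ (p j)` because `2 ^ p < 4 < e ^ 2`. -/
theorem summable_rpow_mul_tailBound {p : ℝ} (hp : p < 2) :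
    Summable fun j : ℕ => ((2 : ℝ) ^ (j + 1)) ^ p * tailBound j := by
  have ha0 : (0 : ℝ) ≤ 2 ^ p := by positivity
  have ha4 : (2 : ℝ) ^ p < 4 := by
    calc (2 : ℝ) ^ p < 2 ^ (2 : ℝ) := Real.rpow_lt_rpow_of_exponent_lt one_lt_two hp
      _ = 4 := by norm_num
  -- `1920 = 24 ^ 2 + 56 * 24` is the numerator at `j = 0`.
  have h1 := summable_geometric_mul_sq ha0 ha4 1920
  have h2 := (summable_geometric_mul_exp ha0 ha4).mul_right
    (∑' m : ℕ, Real.exp (-2 * dyadicLog m))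
  refine Summable.of_nonneg_of_le (fun j => mul_nonneg (by positivity) (tailBound_nonneg j))
    (fun j => ?_) ((h1.add h2).mul_left (2 ^ p))
  rw [rpow_two_pow_succ, tailBound, mul_assoc, mul_add, ← mul_assoc ((2 ^ p : ℝ) ^ j) (Real.exp _)]
  gcongr
  rw [← add_div]
  gcongr
  have hj : (0 : ℝ) ≤ j := by positivity
  nlinarith

/-- The `p`-th moment bound. -/
noncomputable def momentConst (p : ℝ) : ℝ :=
  1 + ∑' j : ℕ, ((2 : ℝ) ^ (j + 1)) ^ p * tailBound j

theorem one_le_momentConst (p : ℝ) : 1 ≤ momentConst p :=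
  le_add_of_nonneg_right
    (tsum_nonneg fun j => mul_nonneg (by positivity) (tailBound_nonneg j))

variable {Ω : Type*} {m1 m0 : MeasurableSpace Ω} {P : Measure Ω} {T : Ω → Ω}
  {E : Type*} [NormedAddCommGroup E] [NormedSpace ℝ E]

/-- The maximal function of the partial sums of `Y ∘ Tᵏ`. -/
noncomputable def maxIter (T : Ω → Ω) (Y : Ω → E) (ω : Ω) : ℝ≥0∞ :=
  ⨆ (n : ℕ) (_ : 1 ≤ n), ENNReal.ofReal (‖∑ k ∈ Finset.range n, Y (T^[k] ω)‖ / lilNorm n)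

theorem ofReal_lt_maxIter_iff {Y : Ω → E} {z : ℝ} (hz : 0 ≤ z) {ω : Ω} :
    ENNReal.ofReal z < maxIter T Y ω ↔
      ∃ n : ℕ, 1 ≤ n ∧ z * lilNorm n < ‖∑ k ∈ Finset.range n, Y (T^[k] ω)‖ := by
  simp only [maxIter, lt_iSup_iff, exists_prop]
  refine exists_congr fun n => and_congr_right fun hn => ?_
  rw [ENNReal.ofReal_lt_ofReal_iff_of_nonneg hz, lt_div_iff₀ (lilNorm_pos hn)]

theorem measurable_maxIter (hT : Measurable T) {Y : Ω → E} (hY : StronglyMeasurable Y) :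
    Measurable (maxIter T Y) := by
  refine Measurable.iSup fun n => Measurable.iSup fun _ => ?_
  refine ENNReal.measurable_ofReal.comp (Measurable.div_const ?_ _)
  exact (Finset.stronglyMeasurable_fun_sum _ fun k _ =>
    hY.comp_measurable (hT.iterate k)).norm.measurable

theorem maxIter_congr (hT : MeasurePreserving T P P) {Y Y' : Ω → E} (h : Y =ᵐ[P] Y') :
    maxIter T Y =ᵐ[P] maxIter T Y' := by
  have : ∀ᵐ ω ∂P, ∀ k, Y (T^[k] ω) = Y' (T^[k] ω) := ae_all_iff.2 fun k =>
    (hT.iterate k).quasiMeasurePreserving.ae h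
  filter_upwards [this] with ω hω
  simp only [maxIter, hω]

theorem maxIter_smul (t : ℝ) (Y : Ω → E) (ω : Ω) :
    maxIter T (fun ω => t • Y ω) ω = ENNReal.ofReal |t| * maxIter T Y ω := by
  simp only [maxIter, ENNReal.mul_iSup]
  refine iSup_congr fun n => iSup_congr fun _ => ?_
  rw [← ENNReal.ofReal_mul (abs_nonneg t), ← Finset.smul_sum, norm_smul, mul_div_assoc,
    Real.norm_eq_abs]

/-- A dyadic layer-cake bound: if `2 ^ n < x ≤ 2 ^ (n + 1)`, the `n`-th term alone suffices, and at
`x = ∞` the series diverges. -/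
theorem rpow_le_one_add_tsum {p : ℝ} (hp : 0 < p) (x : ℝ≥0∞) :
    x ^ p ≤ 1 + ∑' j : ℕ, (Set.Ioi (ENNReal.ofReal (2 ^ j))).indicator
      (fun _ => ENNReal.ofReal (((2 : ℝ) ^ (j + 1)) ^ p)) x := by
  rcases eq_or_ne x ∞ with rfl | hx
  · have : ∑' j : ℕ, (Set.Ioi (ENNReal.ofReal (2 ^ j))).indicator
      (fun _ => ENNReal.ofReal (((2 : ℝ) ^ (j + 1)) ^ p)) ∞ = ∞ := by
      refine top_le_iff.1 ?_
      calc (∞ : ℝ≥0∞) = ∑' _ : ℕ, 1 := (ENNReal.tsum_const_eq_top_of_ne_zero one_ne_zero).symm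
        _ ≤ _ := by
          refine ENNReal.tsum_le_tsum fun j => ?_
          rw [Set.indicator_of_mem (by simp), ENNReal.one_le_ofReal]
          exact Real.one_le_rpow (one_le_pow₀ one_le_two) hp.le
    rw [this]
    simp
  rcases le_or_gt x 1 with h1 | h1
  · exact (ENNReal.rpow_le_one h1 hp.le).trans le_self_add
  lift x to ℝ≥0 using hx
  have hx1 : (1 : ℝ) < x := by exact_mod_cast h1
  obtain ⟨n, hn1, hn2⟩ := exists_mem_Ioc_zpow (zero_lt_one.trans hx1) (one_lt_two (α := ℝ))
  have hn0 : 0 ≤ n := by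
    by_contra hneg
    have : (2 : ℝ) ^ (n + 1) ≤ 1 := zpow_le_one_of_nonpos₀ one_le_two (by omega)
    linarith
  lift n to ℕ using hn0
  rw [zpow_natCast] at hn1
  have hn2' : (x : ℝ) ≤ 2 ^ (n + 1) := by exact_mod_cast hn2
  refine le_trans ?_ (le_trans (ENNReal.le_tsum n) le_add_self)
  have hx' : (x : ℝ≥0∞) = ENNReal.ofReal (x : ℝ) := (ENNReal.ofReal_coe_nnreal).symm
  rw [Set.indicator_of_mem, hx', ENNReal.ofReal_rpow_of_nonneg (NNReal.coe_nonneg x) hp.le]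
  · refine ENNReal.ofReal_le_ofReal ?_
    gcongr
  · rw [Set.mem_Ioi, hx']
    exact (ENNReal.ofReal_lt_ofReal_iff (zero_lt_one.trans hx1)).2 hn1

variable [CompleteSpace E] [IsProbabilityMeasure P] {f : E → ℝ} {D : ℝ}

theorem SmoothMajorant.lintegral_maxIter_rpow_le_of_le_one
    (hf : SmoothMajorant f D) (hT : MeasurePreserving T P P) (hm1 : m1 ≤ m0)
    (hinv : m1 ≤ m1.comap T) {Y : Ω → E} (hYm : StronglyMeasurable[m1.comap T] Y)
    (hYi : Integrable (fun ω => ‖Y ω‖ ^ 2) P) (hY0 : P[Y | m1] =ᵐ[P] 0)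
    (hnorm : D ^ 2 * ∫ ω, ‖Y ω‖ ^ 2 ∂P ≤ 1) {p : ℝ} (hp0 : 0 < p) (hp : p < 2) :
    ∫⁻ ω, maxIter T Y ω ^ p ∂P ≤ ENNReal.ofReal (momentConst p) := by
  have hmT : m1.comap T ≤ m0 := (MeasurableSpace.comap_mono hm1).trans hT.measurable.comap_le
  have hMm : Measurable (maxIter T Y) := measurable_maxIter hT.measurable (hYm.mono hmT)
  have hms : ∀ j : ℕ, Measurable fun ω => (Set.Ioi (ENNReal.ofReal (2 ^ j))).indicator
      (fun _ => ENNReal.ofReal (((2 : ℝ) ^ (j + 1)) ^ p)) (maxIter T Y ω) := fun j =>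
    (measurable_const.indicator measurableSet_Ioi).comp hMm
  refine (lintegral_mono fun ω => rpow_le_one_add_tsum hp0 _).trans ?_
  rw [lintegral_add_left measurable_const, lintegral_tsum fun j => (hms j).aemeasurable,
    lintegral_const, measure_univ, one_mul, momentConst,
    ENNReal.ofReal_add zero_le_one (tsum_nonneg fun j => mul_nonneg (by positivity)
      (tailBound_nonneg j)), ENNReal.ofReal_one, ENNReal.ofReal_tsum_of_nonneg
      (fun j => mul_nonneg (by positivity) (tailBound_nonneg j)) (summable_rpow_mul_tailBound hp)]
  refine add_le_add le_rfl (ENNReal.tsum_le_tsum fun j => ?_)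
  have e : (fun ω => (Set.Ioi (ENNReal.ofReal (2 ^ j))).indicator
      (fun _ => ENNReal.ofReal (((2 : ℝ) ^ (j + 1)) ^ p)) (maxIter T Y ω))
      = (maxIter T Y ⁻¹' Set.Ioi (ENNReal.ofReal (2 ^ j))).indicator
        fun _ => ENNReal.ofReal (((2 : ℝ) ^ (j + 1)) ^ p) := rfl
  rw [e, lintegral_indicator_const (hMm measurableSet_Ioi), ENNReal.ofReal_mul (by positivity)]
  refine mul_le_mul' le_rfl ?_
  have e2 : maxIter T Y ⁻¹' Set.Ioi (ENNReal.ofReal (2 ^ j)) = {ω | ∃ n : ℕ, 1 ≤ n ∧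
      (2 : ℝ) ^ j * lilNorm n < ‖∑ k ∈ Finset.range n, Y (T^[k] ω)‖} := by
    ext ω
    exact ofReal_lt_maxIter_iff (by positivity)
  rw [e2]
  exact hf.measure_exists_lilNorm_lt_le hT hm1 hinv hYm hYi hY0 hnorm (by positivity)
    (by linarith [show (0 : ℝ) ≤ 8 * j by positivity])

/-- The maximal inequality for stationary martingale differences in `2`-smooth spaces. -/
theorem SmoothMajorant.lintegral_maxIter_rpow_le
    (hf : SmoothMajorant f D) (hT : MeasurePreserving T P P) (hm1 : m1 ≤ m0)
    (hinv : m1 ≤ m1.comap T) {Y : Ω → E} (hYm : AEStronglyMeasurable[m1.comap T] Y P)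
    (hY : MemLp Y 2 P) (hY0 : P[Y | m1] =ᵐ[P] 0) {p : ℝ} (hp0 : 1 ≤ p) (hp : p < 2) :
    (∫⁻ ω, maxIter T Y ω ^ p ∂P) ^ (1 / p)
      ≤ ENNReal.ofReal (momentConst p * D) * eLpNorm Y 2 P := by
  have hp' : 0 < p := zero_lt_one.trans_le hp0
  have hD := hf.one_le
  have hK := one_le_momentConst p
  have hmT : m1.comap T ≤ m0 := (MeasurableSpace.comap_mono hm1).trans hT.measurable.comap_le
  wlog hYs : StronglyMeasurable[m1.comap T] Y generalizing Y
  · have hae := hYm.ae_eq_mk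
    have h1 := this (Y := hYm.mk Y) hYm.stronglyMeasurable_mk.aestronglyMeasurable
      ((memLp_congr_ae hae).1 hY) ((condExp_congr_ae hae.symm).trans hY0)
      hYm.stronglyMeasurable_mk
    rw [eLpNorm_congr_ae hae]
    refine le_trans (le_of_eq ?_) h1
    congr 1
    refine lintegral_congr_ae ?_
    filter_upwards [maxIter_congr hT hae] with ω h
    rw [h]
  have hYi : Integrable (fun ω => ‖Y ω‖ ^ 2) P :=
    (memLp_two_iff_integrable_sq_norm (hYs.mono hmT).aestronglyMeasurable).1 hY
  have hI0 : 0 ≤ ∫ ω, ‖Y ω‖ ^ 2 ∂P := integral_nonneg fun _ => by positivity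
  have he : eLpNorm Y 2 P = ENNReal.ofReal (√(∫ ω, ‖Y ω‖ ^ 2 ∂P)) := by
    rw [hY.eLpNorm_eq_integral_rpow_norm two_ne_zero ENNReal.ofNat_ne_top, Real.sqrt_eq_rpow]
    simp
  -- Divide `Y` by `s`. The scale is any positive `s ≥ D ‖Y‖₂`, as `‖Y‖₂` may vanish; an `ε` removes
  -- the slack at the end.
  have hscale : ∀ s : ℝ, 0 < s → D * √(∫ ω, ‖Y ω‖ ^ 2 ∂P) ≤ s →
      (∫⁻ ω, maxIter T Y ω ^ p ∂P) ^ (1 / p) ≤ ENNReal.ofReal (momentConst p * s) := by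
    intro s hs hle
    have hsq : D ^ 2 * ∫ ω, ‖Y ω‖ ^ 2 ∂P ≤ s ^ 2 := by
      rw [← Real.sq_sqrt hI0, ← mul_pow]
      gcongr
    have key := hf.lintegral_maxIter_rpow_le_of_le_one (P := P) hT hm1 hinv
      (Y := fun ω => s⁻¹ • Y ω) (hYs.const_smul _) (by
        simp only [norm_smul, mul_pow]
        exact hYi.const_mul _) (by
        refine (condExp_smul s⁻¹ Y m1).trans ?_
        filter_upwards [hY0] with ω h
        simp [h]) (by
        simp only [norm_smul, mul_pow, integral_const_mul, norm_inv, Real.norm_of_nonneg hs.le]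
        rw [mul_left_comm, inv_pow, inv_mul_le_iff₀ (by positivity), mul_one]
        exact hsq) hp' hp
    simp only [maxIter_smul] at key
    have hYM : ∀ ω, maxIter T Y ω = ENNReal.ofReal s * (ENNReal.ofReal |s⁻¹| * maxIter T Y ω) := by
      intro ω
      rw [← mul_assoc, ← ENNReal.ofReal_mul hs.le, abs_of_pos (inv_pos.2 hs),
        mul_inv_cancel₀ hs.ne', ENNReal.ofReal_one, one_mul]
    have hcongr : ∫⁻ ω, maxIter T Y ω ^ p ∂P = ∫⁻ ω, ENNReal.ofReal s ^ p *
        (ENNReal.ofReal |s⁻¹| * maxIter T Y ω) ^ p ∂P := lintegral_congr fun ω => by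
      rw [← ENNReal.mul_rpow_of_nonneg _ _ hp'.le, ← hYM]
    rw [hcongr, lintegral_const_mul' _ _ (ENNReal.rpow_ne_top_of_nonneg hp'.le ENNReal.ofReal_ne_top),
      ENNReal.mul_rpow_of_nonneg _ _ (by positivity), ← ENNReal.rpow_mul,
      mul_one_div_cancel hp'.ne', ENNReal.rpow_one, mul_comm (momentConst p),
      ENNReal.ofReal_mul hs.le]
    refine mul_le_mul' le_rfl ?_
    calc _ ≤ ENNReal.ofReal (momentConst p) ^ (1 / p) := ENNReal.rpow_le_rpow key (by positivity)
      _ ≤ ENNReal.ofReal (momentConst p) ^ (1 : ℝ) :=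
        ENNReal.rpow_le_rpow_of_exponent_le (ENNReal.one_le_ofReal.2 hK)
          ((div_le_one hp').2 hp0)
      _ = _ := ENNReal.rpow_one _
  rw [he, ← ENNReal.ofReal_mul (by positivity)]
  refine ENNReal.le_of_forall_pos_le_add fun ε hε _ => ?_
  have hε' : (0 : ℝ) < ε := hε
  refine (hscale (D * √(∫ ω, ‖Y ω‖ ^ 2 ∂P) + ε / momentConst p) (by positivity)
    (le_add_of_nonneg_right (by positivity))).trans ?_
  rw [mul_add, mul_div_cancel₀ _ (by positivity), ← mul_assoc]
  exact ENNReal.ofReal_add_le.trans (by rw [ENNReal.ofReal_coe_nnreal])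

end Moment

/-! ### Series of random variables with summable norms. -/

section Series

variable {Ω : Type*} {m' m0 : MeasurableSpace Ω} {P : Measure Ω}
  {E : Type*} [NormedAddCommGroup E] {ι : Type*} [Countable ι]

/-- Minkowski's inequality for countable sums. -/
theorem eLpNorm_tsum_le_of_ennreal {p : ℝ} (hp : 1 ≤ p) {f : ι → Ω → ℝ≥0∞}
    (hf : ∀ i, AEMeasurable (f i) P) :
    (∫⁻ ω, (∑' i, f i ω) ^ p ∂P) ^ (1 / p) ≤ ∑' i, (∫⁻ ω, f i ω ^ p ∂P) ^ (1 / p) := by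
  have hp0 : 0 < p := zero_lt_one.trans_le hp
  have hfin : ∀ s : Finset ι, (∫⁻ ω, (∑ i ∈ s, f i ω) ^ p ∂P) ^ (1 / p)
      ≤ ∑ i ∈ s, (∫⁻ ω, f i ω ^ p ∂P) ^ (1 / p) := fun s => by
    classical
    induction s using Finset.induction_on with
    | empty => simp [hp0]
    | insert i s hi ih =>
      simp only [Finset.sum_insert hi]
      exact (ENNReal.lintegral_Lp_add_le (hf i) (Finset.aemeasurable_fun_sum s fun j _ => hf j)
        hp).trans (add_le_add le_rfl ih)
  rw [one_div, ENNReal.rpow_inv_le_iff hp0]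
  have e : ∀ ω, (∑' i, f i ω) ^ p = ⨆ s : Finset ι, (∑ i ∈ s, f i ω) ^ p := fun ω => by
    rw [ENNReal.tsum_eq_iSup_sum]
    exact (ENNReal.orderIsoRpow p hp0).map_iSup _
  simp_rw [e]
  rw [lintegral_iSup_directed]
  · refine iSup_le fun s => ?_
    rw [← ENNReal.rpow_inv_le_iff hp0, ← one_div]
    exact (hfin s).trans (ENNReal.sum_le_tsum s)
  · exact fun s => (Finset.aemeasurable_fun_sum s fun i _ => hf i).pow_const p
  · classical
    refine directed_of_isDirected_le fun s t hst ω => ?_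
    exact ENNReal.rpow_le_rpow (Finset.sum_le_sum_of_subset hst) hp0.le

theorem eLpNorm_le_tsum_of_enorm_le {p : ℝ≥0∞} (hp : 1 ≤ p) (hp' : p ≠ ∞) {f : ι → Ω → E}
    (hf : ∀ i, AEStronglyMeasurable (f i) P) {g : Ω → E}
    (hg : ∀ᵐ ω ∂P, ‖g ω‖ₑ ≤ ∑' i, ‖f i ω‖ₑ) :
    eLpNorm g p P ≤ ∑' i, eLpNorm (f i) p P := by
  have hp0 : p ≠ 0 := (zero_lt_one.trans_le hp).ne'
  have hp1 : 1 ≤ p.toReal := by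
    rw [← ENNReal.toReal_one]
    exact ENNReal.toReal_mono hp' hp
  simp_rw [eLpNorm_eq_lintegral_rpow_enorm_toReal hp0 hp']
  refine le_trans ?_ (eLpNorm_tsum_le_of_ennreal hp1 fun i => (hf i).enorm)
  gcongr ?_ ^ _
  refine lintegral_mono_ae ?_
  filter_upwards [hg] with ω h
  gcongr

variable [CompleteSpace E]

theorem ae_summable_of_tsum_eLpNorm {p : ℝ≥0∞} (hp : 1 ≤ p) {f : ι → Ω → E}
    (hf : ∀ i, AEStronglyMeasurable (f i) P) (hs : ∑' i, eLpNorm (f i) p P ≠ ∞) :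
    ∀ᵐ ω ∂P, Summable fun i => f i ω := by
  filter_upwards [summable_norm_of_tsum_eLpNorm_ne_top hp hf hs] with ω h using h.of_norm

theorem tendsto_eLpNorm_sum_sub_tsum {p : ℝ≥0∞} (hp : 1 ≤ p) (hp' : p ≠ ∞) {f : ι → Ω → E}
    (hf : ∀ i, AEStronglyMeasurable (f i) P) (hs : ∑' i, eLpNorm (f i) p P ≠ ∞) :
    Tendsto (fun s : Finset ι => eLpNorm (fun ω => ∑ i ∈ s, f i ω - ∑' i, f i ω) p P) atTop
      (𝓝 0) := by
  refine tendsto_of_tendsto_of_tendsto_of_le_of_le tendsto_const_nhds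
    (ENNReal.tendsto_tsum_compl_atTop_zero hs) (fun _ => zero_le) fun s => ?_
  refine eLpNorm_le_tsum_of_enorm_le hp hp' (fun i : { i // i ∉ s } => hf i) ?_
  filter_upwards [summable_norm_of_tsum_eLpNorm_ne_top hp hf hs] with ω h
  have h1 := h.of_norm
  rw [← h1.sum_add_tsum_subtype_compl s, sub_add_cancel_left, enorm_neg]
  exact enorm_tsum_le_tsum_enorm

theorem memLp_tsum {p : ℝ≥0∞} (hp : 1 ≤ p) (hp' : p ≠ ∞) {f : ι → Ω → E}
    (hf : ∀ i, AEStronglyMeasurable (f i) P) (hs : ∑' i, eLpNorm (f i) p P ≠ ∞) :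
    MemLp (fun ω => ∑' i, f i ω) p P := by
  refine ⟨?_, (eLpNorm_le_tsum_of_enorm_le hp hp' hf
    (ae_of_all _ fun ω => enorm_tsum_le_tsum_enorm)).trans_lt hs.lt_top⟩
  refine aestronglyMeasurable_of_tendsto_ae (atTop : Filter (Finset ι))
    (f := fun s ω => ∑ i ∈ s, f i ω) (fun s => Finset.aestronglyMeasurable_fun_sum s fun i _ => hf i)
    ?_
  filter_upwards [ae_summable_of_tsum_eLpNorm hp hf hs] with ω h using h.hasSum

variable [NormedSpace ℝ E]

/-- Conditional expectation contracts `L¹`, so the difference of the two sides is at most the sum of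
two tails, both tending to zero. -/
theorem condExp_tsum {f : ι → Ω → E} (hf : ∀ i, AEStronglyMeasurable (f i) P)
    (hs : ∑' i, eLpNorm (f i) 1 P ≠ ∞) :
    P[fun ω => ∑' i, f i ω | m'] =ᵐ[P] fun ω => ∑' i, P[f i | m'] ω := by
  have hfi : ∀ i, Integrable (f i) P := fun i => memLp_one_iff_integrable.1
    ⟨hf i, (ENNReal.le_tsum i).trans_lt hs.lt_top⟩
  have hXi : Integrable (fun ω => ∑' i, f i ω) P :=
    memLp_one_iff_integrable.1 (memLp_tsum le_rfl ENNReal.one_ne_top hf hs)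
  have hgm : ∀ i, AEStronglyMeasurable P[f i | m'] P := fun i => integrable_condExp.1
  have hgs : ∑' i, eLpNorm P[f i | m'] 1 P ≠ ∞ :=
    ((ENNReal.tsum_le_tsum fun i => eLpNorm_condExp_le_eLpNorm (f i) le_rfl).trans_lt
      hs.lt_top).ne
  have h1 := tendsto_eLpNorm_sum_sub_tsum le_rfl ENNReal.one_ne_top hf hs
  have h2 := tendsto_eLpNorm_sum_sub_tsum le_rfl ENNReal.one_ne_top hgm hgs
  have hmeas : AEStronglyMeasurable (fun ω => ∑' i, P[f i | m'] ω) P :=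
    (memLp_tsum le_rfl ENNReal.one_ne_top hgm hgs).1
  have h3 : ∀ s : Finset ι, eLpNorm (P[fun ω => ∑' i, f i ω | m'] - fun ω => ∑' i, P[f i | m'] ω)
      1 P ≤ eLpNorm (fun ω => ∑ i ∈ s, f i ω - ∑' i, f i ω) 1 P
        + eLpNorm (fun ω => ∑ i ∈ s, P[f i | m'] ω - ∑' i, P[f i | m'] ω) 1 P := fun s => by
    have hsi : Integrable (∑ i ∈ s, f i) P := integrable_finsetSum' s fun i _ => hfi i
    have hc : (fun ω => ∑ i ∈ s, P[f i | m'] ω - ∑' i, P[f i | m'] ω)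
        - P[∑ i ∈ s, f i - fun ω => ∑' i, f i ω | m']
        =ᵐ[P] (P[fun ω => ∑' i, f i ω | m'] - fun ω => ∑' i, P[f i | m'] ω) := by
      filter_upwards [condExp_sub hsi hXi m', condExp_finsetSum (fun i (_ : i ∈ s) => hfi i) m']
        with ω h4 h5
      simp only [Pi.sub_apply, h4, h5, Finset.sum_apply]
      abel
    rw [← eLpNorm_congr_ae hc, add_comm]
    refine (eLpNorm_sub_le ?_ integrable_condExp.1 le_rfl).trans (add_le_add le_rfl ?_)
    · exact (Finset.aestronglyMeasurable_fun_sum s fun i _ => hgm i).sub hmeas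
    · refine (eLpNorm_condExp_le_eLpNorm _ le_rfl).trans (le_of_eq ?_)
      congr 1
      funext ω
      simp
  have h4 : eLpNorm (P[fun ω => ∑' i, f i ω | m'] - fun ω => ∑' i, P[f i | m'] ω) 1 P = 0 := by
    refine le_antisymm ?_ zero_le
    have := h1.add h2
    rw [add_zero] at this
    exact ge_of_tendsto' this h3
  rw [eLpNorm_eq_zero_iff (integrable_condExp.1.sub hmeas) one_ne_zero] at h4
  filter_upwards [h4] with ω h
  exact sub_eq_zero.1 h

end Series

/-! ### Predictable random operators. -/

section Operators

variable {Ω : Type*} {m' m0 : MeasurableSpace Ω} {P : Measure Ω}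
  {E : Type*} [NormedAddCommGroup E]

/-- The convergence set of `m'`-measurable versions is itself in `m'`, so almost sure convergence
descends to the trimmed measure, where the limit can be taken. -/
theorem aestronglyMeasurable_sub_of_tendsto_ae [CompleteSpace E] (hm : m' ≤ m0) {f : ℕ → Ω → E} {g : Ω → E}
    (hf : ∀ n, AEStronglyMeasurable[m'] (f n) P)
    (hlim : ∀ᵐ ω ∂P, Tendsto (fun n => f n ω) atTop (𝓝 (g ω))) :
    AEStronglyMeasurable[m'] g P := by
  borelize E
  set f' : ℕ → Ω → E := fun n => (hf n).mk (f n) with hf'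
  have hf'm : ∀ n, StronglyMeasurable[m'] (f' n) := fun n => (hf n).stronglyMeasurable_mk
  have hlim' : ∀ᵐ ω ∂P, Tendsto (fun n => f' n ω) atTop (𝓝 (g ω)) := by
    filter_upwards [hlim, ae_all_iff.2 fun n => (hf n).ae_eq_mk] with ω h1 h2
    simp only [hf', ← h2]
    exact h1
  have hC : MeasurableSet[m'] {ω | ∃ l, Tendsto (fun n => f' n ω) atTop (𝓝 l)} :=
    @StronglyMeasurable.measurableSet_exists_tendsto _ _ _ m' _ _ _ _ _ _ hf'm
  have htrim : ∀ᵐ ω ∂P.trim hm, ∃ l, Tendsto (fun n => f' n ω) atTop (𝓝 l) := by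
    rw [ae_iff, ← Set.compl_ofPred, trim_measurableSet_eq hm hC.compl]
    exact ae_iff.1 (hlim'.mono fun ω h => ⟨g ω, h⟩)
  obtain ⟨g', hg'm, hg'⟩ := exists_stronglyMeasurable_limit_of_tendsto_ae
    (fun n => (hf'm n).aestronglyMeasurable) htrim
  refine ⟨g', hg'm, ?_⟩
  filter_upwards [hlim', ae_of_ae_trim hm hg'] with ω h1 h2
  exact tendsto_nhds_unique h1 h2

variable [NormedSpace ℝ E]

theorem aestronglyMeasurable_simpleFunc_clm_apply {m0 m' : MeasurableSpace Ω} {P : Measure[m0] Ω}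
    {B : Ω → E →L[ℝ] E} (hB : ∀ x, AEStronglyMeasurable[m'] (fun ω => B ω x) P)
    (s : SimpleFunc Ω E) : AEStronglyMeasurable[m'] (fun ω => B ω (s ω)) P := by
  classical
  have e : (fun ω => B ω (s ω))
      = fun ω => ∑ x ∈ s.range, (s ⁻¹' {x}).indicator (fun ω => B ω x) ω := by
    funext ω
    rw [Finset.sum_eq_single (s ω)]
    · rw [Set.indicator_of_mem (by simp)]
    · intro x _ hx
      exact Set.indicator_of_notMem (by simpa using hx.symm) _
    · intro h
      exact absurd (s.mem_range_self ω) h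
  rw [e]
  refine ⟨fun ω => ∑ x ∈ s.range, (s ⁻¹' {x}).indicator ((hB x).mk _) ω,
    Finset.stronglyMeasurable_fun_sum _ fun x _ =>
      (hB x).stronglyMeasurable_mk.indicator (s.measurableSet_fiber x), ?_⟩
  filter_upwards [(ae_ball_iff s.range.countable_toSet).2 fun x _ => (hB x).ae_eq_mk] with ω h
  refine Finset.sum_congr rfl fun x hx => ?_
  by_cases hω : ω ∈ s ⁻¹' {x}
  · simp only [Set.indicator_of_mem hω, h x hx]
  · simp only [Set.indicator_of_notMem hω]

variable [CompleteSpace E]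

/-- Only the maps `ω ↦ B ω x` are measurable, so `g` is approximated by simple functions and
continuity of each `B ω` passes to the limit. -/
theorem aestronglyMeasurable_clm_apply (hm : m' ≤ m0) {B : Ω → E →L[ℝ] E}
    (hB : ∀ x, AEStronglyMeasurable[m'] (fun ω => B ω x) P) {g : Ω → E}
    (hg : AEStronglyMeasurable[m'] g P) : AEStronglyMeasurable[m'] (fun ω => B ω (g ω)) P := by
  have hs := hg.stronglyMeasurable_mk
  refine aestronglyMeasurable_sub_of_tendsto_ae hm
    (fun n => aestronglyMeasurable_simpleFunc_clm_apply hB (hs.approx n)) ?_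
  filter_upwards [hg.ae_eq_mk] with ω h
  rw [h]
  exact ((B ω).continuous.tendsto _).comp (hs.tendsto_approx ω)

/-- For a vector times an indicator this is the scalar pull-out rule; additivity and
`L¹`-closedness, the latter from the uniform bound `C`, extend it to integrable `g`. -/
theorem condExp_clm_apply [IsFiniteMeasure P] (hm : m' ≤ m0) {B : Ω → E →L[ℝ] E}
    (hB : ∀ x, AEStronglyMeasurable[m'] (fun ω => B ω x) P) {C : ℝ≥0}
    (hC : ∀ᵐ ω ∂P, ‖B ω‖ₑ ≤ C) {g : Ω → E} (hg : Integrable g P) :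
    P[fun ω => B ω (g ω) | m'] =ᵐ[P] fun ω => B ω (P[g | m'] ω) := by
  have hB0 : ∀ x, AEStronglyMeasurable (fun ω => B ω x) P := fun x => (hB x).mono hm
  have hle : ∀ᵐ ω ∂P, ∀ x, ‖B ω x‖ₑ ≤ C * ‖x‖ₑ := by
    filter_upwards [hC] with ω h x
    exact ((B ω).le_opENorm x).trans (mul_le_mul' h le_rfl)
  have hnorm : ∀ f : Ω → E, eLpNorm (fun ω => B ω (f ω)) 1 P ≤ C * eLpNorm f 1 P := fun f => by
    refine (eLpNorm_le_nnreal_smul_eLpNorm_of_ae_le_mul (f := fun ω => B ω (f ω)) (g := f)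
      (c := C) ?_ 1).trans (le_of_eq ?_)
    · filter_upwards [hle] with ω h
      have := h (f ω)
      simp only [enorm_eq_nnnorm] at this
      exact_mod_cast this
    · rw [ENNReal.smul_def, smul_eq_mul]
  have hint : ∀ f : Ω → E, Integrable f P → Integrable (fun ω => B ω (f ω)) P := fun f hf =>
    memLp_one_iff_integrable.1 ⟨aestronglyMeasurable_clm_apply le_rfl hB0 hf.1,
      (hnorm f).trans_lt (ENNReal.mul_lt_top ENNReal.coe_lt_top (memLp_one_iff_integrable.2 hf).2)⟩
  refine Integrable.induction (fun g : Ω → E =>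
    P[fun ω => B ω (g ω) | m'] =ᵐ[P] fun ω => B ω (P[g | m'] ω)) ?_ ?_ ?_ ?_ hg
  · intro c s hs _
    set χ : Ω → ℝ := s.indicator fun _ => 1 with hχ
    have hχi : Integrable χ P := (integrable_const 1).indicator hs
    have e1 : (fun ω => B ω (s.indicator (fun _ => c) ω)) = χ • fun ω => B ω c := by
      funext ω
      by_cases h : ω ∈ s <;> simp [hχ, h]
    have e2 : (s.indicator fun _ => c) = χ • fun _ : Ω => c := by
      funext ω
      by_cases h : ω ∈ s <;> simp [hχ, h]
    have hci : Integrable (χ • fun _ : Ω => c) P := e2 ▸ (integrable_const c).indicator hs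
    have h1 := condExp_smul_of_aestronglyMeasurable_right hχi
      (e1 ▸ hint _ ((integrable_const c).indicator hs)) (hB c)
    have h2 := condExp_smul_of_aestronglyMeasurable_right (m := m') hχi hci
      aestronglyMeasurable_const
    rw [e1, e2]
    filter_upwards [h1, h2] with ω h3 h4
    rw [h3, h4]
    simp
  · intro f g _ hf hg h1 h2
    have h3 := condExp_add (hint f hf) (hint g hg) m'
    have h4 := condExp_add hf hg m'
    have e : (fun ω => B ω ((f + g) ω)) = (fun ω => B ω (f ω)) + fun ω => B ω (g ω) := by
      funext ω
      simp
    rw [e]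
    filter_upwards [h1, h2, h3, h4] with ω h5 h6 h7 h8
    rw [h7, h8, Pi.add_apply, h5, h6, Pi.add_apply, map_add]
  · refine IsSeqClosed.isClosed fun f g hf hfg => ?_
    have hlim : Tendsto (fun n => 2 * C * eLpNorm (⇑(f n) - ⇑g) 1 P) atTop (𝓝 0) := by
      have := (Lp.tendsto_Lp_iff_tendsto_eLpNorm' f g).1 hfg
      simpa using ENNReal.Tendsto.const_mul this (Or.inr (by finiteness))
    have hfi : ∀ n, Integrable (f n) P := fun n => L1.integrable_coeFn (f n)
    have hgi : Integrable g P := L1.integrable_coeFn g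
    have hmeas : AEStronglyMeasurable (P[fun ω => B ω (g ω) | m'] - fun ω => B ω (P[g | m'] ω))
        P := integrable_condExp.1.sub (hint _ integrable_condExp).1
    have hkey : ∀ n, eLpNorm (P[fun ω => B ω (g ω) | m'] - fun ω => B ω (P[g | m'] ω)) 1 P
        ≤ 2 * C * eLpNorm (⇑(f n) - ⇑g) 1 P := fun n => by
      have hd := (hfi n).sub hgi
      have e : (fun ω => B ω (P[⇑(f n) - ⇑g | m'] ω))
          - P[fun ω => B ω ((⇑(f n) - ⇑g) ω) | m']
          =ᵐ[P] P[fun ω => B ω (g ω) | m'] - fun ω => B ω (P[g | m'] ω) := by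
        have e1 : (fun ω => B ω ((⇑(f n) - ⇑g) ω))
            = (fun ω => B ω (f n ω)) - fun ω => B ω (g ω) := by
          funext ω
          simp
        rw [e1]
        filter_upwards [condExp_sub (hfi n) hgi m', condExp_sub (hint _ (hfi n)) (hint _ hgi) m',
          hf n] with ω h1 h2 h3
        simp only [Pi.sub_apply, h1, h2, map_sub, h3]
        abel
      rw [← eLpNorm_congr_ae e]
      refine (eLpNorm_sub_le (hint _ integrable_condExp).1 integrable_condExp.1 le_rfl).trans ?_
      rw [two_mul, add_mul]
      refine add_le_add ((hnorm _).trans ?_) ((eLpNorm_condExp_le_eLpNorm _ le_rfl).trans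
        (hnorm _))
      gcongr
      exact eLpNorm_condExp_le_eLpNorm _ le_rfl
    have h0 := le_antisymm (ge_of_tendsto' hlim hkey) zero_le
    rw [eLpNorm_eq_zero_iff hmeas one_ne_zero] at h0
    filter_upwards [h0] with ω h
    exact sub_eq_zero.1 h
  · intro f g hfg _ h1
    have h2 : P[fun ω => B ω (f ω) | m'] =ᵐ[P] P[fun ω => B ω (g ω) | m'] :=
      condExp_congr_ae (by filter_upwards [hfg] with ω h; rw [h])
    filter_upwards [h1, h2, condExp_congr_ae (m := m') hfg] with ω h3 h4 h5
    rw [← h4, h3, h5]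

end Operators

/-! ### Growth along orbits. -/

section Iterates

variable {Ω : Type*} {m0 : MeasurableSpace Ω} {P : Measure Ω} [IsProbabilityMeasure P] {T : Ω → Ω}
  {E : Type*} [NormedAddCommGroup E]

/-- A square integrable function is `o(√n)` along almost every orbit. -/
theorem ae_tendsto_iterate_div_sqrt (hT : MeasurePreserving T P P) {V : Ω → E}
    (hV : MemLp V 2 P) : ∀ᵐ ω ∂P, Tendsto (fun n : ℕ => ‖V (T^[n] ω)‖ / √n) atTop (𝓝 0) := by
  have hi : Integrable (fun ω => ‖V ω‖ ^ 2) P := (memLp_two_iff_integrable_sq_norm hV.1).1 hV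
  -- Borel-Cantelli: integrability makes `∑ⱼ P((K + 1) ‖V‖² > j)` finite, and stationarity moves the
  -- `j`-th event to time `j`. An arbitrary `K` turns `O` into `o`.
  have key : ∀ K : ℕ, ∀ᵐ ω ∂P, ∀ᶠ n : ℕ in atTop, (K + 1) * ‖V (T^[n] ω)‖ ^ 2 ≤ n := fun K => by
    have hsum : ∑' j : ℕ, P {ω | (K + 1) * ‖V ω‖ ^ 2 ∈ Set.Ioi (j : ℝ)} < ∞ := by
      let _ : MeasureSpace Ω := ⟨P⟩
      have : IsProbabilityMeasure (volume : Measure Ω) := ‹IsProbabilityMeasure P›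
      exact ProbabilityTheory.tsum_prob_mem_Ioi_lt_top (hi.const_mul ((K : ℝ) + 1))
        fun ω => by positivity
    have heq : ∀ j : ℕ, P {ω | (j : ℝ) < (K + 1) * ‖V (T^[j] ω)‖ ^ 2}
        = P {ω | (K + 1) * ‖V ω‖ ^ 2 ∈ Set.Ioi (j : ℝ)} := fun j =>
      (hT.iterate j).measure_preimage (s := {ω | (K + 1) * ‖V ω‖ ^ 2 ∈ Set.Ioi (j : ℝ)})
        (nullMeasurableSet_lt aemeasurable_const (hi.1.aemeasurable.const_mul _))
    have := ae_eventually_notMem (μ := P) (s := fun j : ℕ =>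
      {ω | (j : ℝ) < (K + 1) * ‖V (T^[j] ω)‖ ^ 2}) (by simp_rw [heq]; exact hsum.ne)
    filter_upwards [this] with ω h
    filter_upwards [h] with n hn
    exact not_lt.1 hn
  filter_upwards [ae_all_iff.2 key] with ω h
  rw [Metric.tendsto_atTop']
  intro ε hε
  obtain ⟨K, hK⟩ := exists_nat_gt (1 / ε ^ 2)
  obtain ⟨N, hN⟩ := eventually_atTop.1 (h K)
  refine ⟨N, fun n hn => ?_⟩
  have h1 := hN n hn.le
  have hn0 : (0 : ℝ) < n := by exact_mod_cast (Nat.zero_le _).trans_lt hn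
  rw [dist_zero_right, Real.norm_of_nonneg (by positivity), div_lt_iff₀ (by positivity)]
  refine lt_of_pow_lt_pow_left₀ 2 (by positivity) ?_
  rw [mul_pow, Real.sq_sqrt hn0.le]
  have h2 : 1 < (K + 1) * ε ^ 2 := by
    rw [div_lt_iff₀ (by positivity)] at hK
    nlinarith [sq_nonneg ε]
  have h3 : (0 : ℝ) < K + 1 := by positivity
  refine lt_of_mul_lt_mul_left (a := (K : ℝ) + 1) ?_ h3.le
  nlinarith

end Iterates

/-! ### Integer iterates, the stationary filtration and the weak norm. -/

section Iter

variable {Ω : Type u} {ℱ₀ : MeasurableSpace Ω} [m : MeasurableSpace Ω] {P : Measure Ω}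
  {θ : Ω ≃ᵐ Ω} {E : Type v} [NormedAddCommGroup E]

theorem iter_zero (θ : Ω ≃ᵐ Ω) : iter θ 0 = id := by
  simp [iter, Equiv.Perm.coe_one]

theorem iter_one (θ : Ω ≃ᵐ Ω) : iter θ 1 = θ := by
  simp [iter]

theorem iter_add (θ : Ω ≃ᵐ Ω) (a b : ℤ) (ω : Ω) : iter θ (a + b) ω = iter θ a (iter θ b ω) := by
  simp [iter, zpow_add]

theorem iter_comp_iter (θ : Ω ≃ᵐ Ω) (a b : ℤ) : iter θ a ∘ iter θ b = iter θ (a + b) :=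
  funext fun ω => (iter_add θ a b ω).symm

theorem iter_natCast (θ : Ω ≃ᵐ Ω) (k : ℕ) : iter θ k = θ^[k] := by
  induction k with
  | zero => exact iter_zero θ
  | succ k ih => rw [Nat.cast_succ, ← iter_comp_iter, ih, iter_one, Function.iterate_succ]

theorem MeasureTheory.MeasurePreserving.iter (hθ : MeasurePreserving θ P P) (n : ℤ) :
    MeasurePreserving (iter θ n) P P := by
  have hs : MeasurePreserving (_root_.iter θ (-1)) P P := by
    have e : _root_.iter θ (-1) = θ.symm := by
      simp only [_root_.iter, zpow_neg, zpow_one]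
      rfl
    exact e ▸ hθ.symm θ
  induction n with
  | zero => exact (iter_zero θ).symm ▸ MeasurePreserving.id P
  | succ n ih => exact iter_comp_iter θ n 1 ▸ ih.comp ((iter_one θ).symm ▸ hθ)
  | pred n ih => exact iter_comp_iter θ (-n) (-1) ▸ ih.comp hs

theorem filt_zero (θ : Ω ≃ᵐ Ω) : filt ℱ₀ θ 0 = ℱ₀ := by
  rw [filt, iter_zero, MeasurableSpace.comap_id]

theorem comap_iter_filt (θ : Ω ≃ᵐ Ω) (n k : ℤ) :
    (filt ℱ₀ θ n).comap (iter θ k) = filt ℱ₀ θ (n + k) := by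
  rw [filt, MeasurableSpace.comap_comp, iter_comp_iter]

theorem filt_le (hθ : MeasurePreserving θ P P) (h : ℱ₀ ≤ m) (n : ℤ) : filt ℱ₀ θ n ≤ m :=
  (MeasurableSpace.comap_mono h).trans (hθ.iter n).measurable.comap_le

theorem filt_mono (h : ℱ₀ ≤ MeasurableSpace.comap θ ℱ₀) : Monotone (filt ℱ₀ θ) := by
  refine monotone_int_of_le_succ fun n => ?_
  rw [add_comm, filt, filt, ← iter_comp_iter, iter_one, ← MeasurableSpace.comap_comp]
  exact MeasurableSpace.comap_mono h

theorem MeasureTheory.AEStronglyMeasurable.comp_iter (hθ : MeasurePreserving θ P P) {g : Ω → E}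
    {n : ℤ} (hg : AEStronglyMeasurable[filt ℱ₀ θ n] g P) (k : ℤ) :
    AEStronglyMeasurable[filt ℱ₀ θ (n + k)] (g ∘ iter θ k) P := by
  refine ⟨hg.mk g ∘ iter θ k, ?_, (hθ.iter k).quasiMeasurePreserving.ae_eq_comp hg.ae_eq_mk⟩
  rw [← comap_iter_filt]
  exact hg.stronglyMeasurable_mk.comp_measurable (comap_measurable _)

theorem partialSum_eq_sum_iterate (θ : Ω ≃ᵐ Ω) (X : Ω → E) (n : ℕ) (ω : Ω) :
    partialSum θ X n ω = ∑ k ∈ Finset.range n, X (θ^[k] ω) := by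
  simp only [partialSum, iter_natCast]

theorem maxFun_eq_maxIter (θ : Ω ≃ᵐ Ω) (X : Ω → E) : maxFun θ X = maxIter θ X := by
  funext ω
  simp only [maxFun, maxIter, partialSum_eq_sum_iterate]

theorem weakNorm_le_of_ae_le {p : ℝ} (hp : 0 < p) {Z W : Ω → ℝ≥0∞} (hW : AEMeasurable W P)
    (h : Z ≤ᵐ[P] W) : weakNorm p P Z ≤ (∫⁻ ω, W ω ^ p ∂P) ^ (1 / p) := by
  refine iSup₂_le fun t ht => ?_
  have h1 : P {ω | (t : ℝ≥0∞) < Z ω} ≤ P {ω | (t : ℝ≥0∞) ^ p ≤ W ω ^ p} := by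
    refine measure_mono_ae ?_
    filter_upwards [h] with ω hω hlt
    exact ENNReal.rpow_le_rpow ((le_of_lt hlt).trans hω) hp.le
  rw [one_div, ENNReal.le_rpow_inv_iff hp, ENNReal.mul_rpow_of_nonneg _ _ hp.le,
    ENNReal.rpow_inv_rpow hp.ne']
  exact (mul_le_mul' le_rfl h1).trans (mul_meas_ge_le_lintegral₀ (hW.pow_const p) _)

theorem norm_sum_div_lilNorm_le_maxIter {T : Ω → Ω} (Y : Ω → E) {n : ℕ} (hn : 1 ≤ n) (ω : Ω) :
    ENNReal.ofReal (‖∑ k ∈ Finset.range n, Y (T^[k] ω)‖ / lilNorm n) ≤ maxIter T Y ω :=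
  le_iSup₂ (f := fun (n : ℕ) (_ : 1 ≤ n) =>
    ENNReal.ofReal (‖∑ k ∈ Finset.range n, Y (T^[k] ω)‖ / lilNorm n)) n hn

theorem maxIter_tsum_le {T : Ω → Ω} {ι : Type*} {Y : ι → Ω → E} {ω : Ω}
    (h : ∀ k : ℕ, Summable fun j => Y j (T^[k] ω)) :
    maxIter T (fun ω => ∑' j, Y j ω) ω ≤ ∑' j, maxIter T (Y j) ω := by
  refine iSup₂_le fun n hn => ?_
  rw [← Summable.tsum_finsetSum fun k _ => h k,
    ENNReal.ofReal_div_of_pos (lilNorm_pos hn), ofReal_norm]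
  refine (ENNReal.div_le_div_right enorm_tsum_le_tsum_enorm _).trans ?_
  rw [div_eq_mul_inv, ← ENNReal.tsum_mul_right]
  refine ENNReal.tsum_le_tsum fun j => ?_
  rw [← div_eq_mul_inv, ← ofReal_norm, ← ENNReal.ofReal_div_of_pos (lilNorm_pos hn)]
  exact norm_sum_div_lilNorm_le_maxIter (Y j) hn ω

variable [NormedSpace ℝ E]

theorem aemeasurable_maxIter {T : Ω → Ω} (hT : MeasurePreserving T P P) {Y : Ω → E}
    (hY : AEStronglyMeasurable Y P) : AEMeasurable (maxIter T Y) P :=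
  (measurable_maxIter hT.measurable hY.stronglyMeasurable_mk).aemeasurable.congr
    (maxIter_congr hT hY.ae_eq_mk).symm

variable [IsProbabilityMeasure P] [CompleteSpace E]

theorem condExp_comp_iter (hθ : MeasurePreserving θ P P) (h : ℱ₀ ≤ m) {g : Ω → E}
    (hg : Integrable g P) (n k : ℤ) :
    P[g ∘ iter θ k | filt ℱ₀ θ (n + k)] =ᵐ[P] P[g | filt ℱ₀ θ n] ∘ iter θ k := by
  rw [← comap_iter_filt]
  exact (hθ.iter k).condExp_comp (filt_le hθ h n) hg

end Iter

/-! ### Coboundaries are negligible. -/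

section Coboundary

variable {Ω : Type u} [m : MeasurableSpace Ω] {P : Measure Ω} [IsProbabilityMeasure P]
  {θ : Ω ≃ᵐ Ω} {E : Type v} [NormedAddCommGroup E]

theorem tendsto_lilNorm_atTop : Tendsto lilNorm atTop atTop :=
  tendsto_atTop_mono sqrt_le_lilNorm_self
    (Real.tendsto_sqrt_atTop.comp tendsto_natCast_atTop_atTop)

theorem ae_isLittleO_sum_sub_comp (hθ : MeasurePreserving θ P P) {U : Ω → E} (hU : MemLp U 2 P) :
    ∀ᵐ ω ∂P, (fun n : ℕ => ∑ k ∈ Finset.range n, (U (θ^[k] ω) - U (θ^[k + 1] ω)))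
      =o[atTop] lilNorm := by
  filter_upwards [ae_tendsto_iterate_div_sqrt hθ hU] with ω h
  simp only [Finset.sum_range_sub' fun k => U (θ^[k] ω)]
  have h1 : (fun n : ℕ => U (θ^[n] ω)) =o[atTop] fun n : ℕ => √(n : ℝ) := by
    refine Asymptotics.isLittleO_norm_left.1 ((Asymptotics.isLittleO_iff_tendsto' ?_).2 h)
    filter_upwards [eventually_ge_atTop 1] with n hn h0
    have : (0 : ℝ) < √(n : ℝ) := Real.sqrt_pos.2 (by exact_mod_cast hn)
    exact absurd h0 this.ne'
  have h2 : (fun n : ℕ => √(n : ℝ)) =O[atTop] lilNorm := by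
    refine Asymptotics.IsBigO.of_norm_le fun n => ?_
    rw [Real.norm_of_nonneg (Real.sqrt_nonneg _)]
    exact sqrt_le_lilNorm_self n
  refine Asymptotics.IsLittleO.sub ?_ (h1.trans_isBigO h2)
  exact Asymptotics.isLittleO_const_left.2 (Or.inr (tendsto_norm_atTop_atTop.comp
    tendsto_lilNorm_atTop))

/-- `V - V ∘ θʳ` is a finite sum, up to sign, of one-step coboundaries, whose partial sums
telescope. -/
theorem ae_isLittleO_sum_sub_comp_iter (hθ : MeasurePreserving θ P P) {V : Ω → E}
    (hV : MemLp V 2 P) (r : ℤ) :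
    ∀ᵐ ω ∂P, (fun n : ℕ => ∑ k ∈ Finset.range n, (V (θ^[k] ω) - V (iter θ r (θ^[k] ω))))
      =o[atTop] lilNorm := by
  have step : ∀ r : ℤ, ∀ᵐ ω ∂P, (fun n : ℕ => ∑ k ∈ Finset.range n,
      (V (iter θ r (θ^[k] ω)) - V (iter θ (r + 1) (θ^[k] ω)))) =o[atTop] lilNorm := fun r => by
    filter_upwards [ae_isLittleO_sum_sub_comp hθ (hV.comp_measurePreserving (hθ.iter r))] with ω h
    simpa only [Function.comp_apply, Function.iterate_succ_apply', iter_add, iter_one] using h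
  induction r with
  | zero => simp [iter_zero]
  | succ r ih =>
    filter_upwards [ih, step r] with ω h1 h2
    refine (h1.add h2).congr_left fun n => ?_
    rw [← Finset.sum_add_distrib]
    exact Finset.sum_congr rfl fun k _ => by abel
  | pred r ih =>
    filter_upwards [ih, step (-r - 1)] with ω h1 h2
    refine (h1.sub h2).congr_left fun n => ?_
    rw [← Finset.sum_sub_distrib]
    refine Finset.sum_congr rfl fun k _ => ?_
    rw [sub_add_cancel]
    abel

end Coboundary

/-! ### Series of martingale differences under the Hannan condition. -/

/-- A family of martingale differences `Y j`, adapted to `ℱ j`, with summable `L²` norms. -/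
structure IsHannanFamily {Ω : Type u} (ℱ₀ : MeasurableSpace Ω) [m : MeasurableSpace Ω]
    (P : Measure Ω) (θ : Ω ≃ᵐ Ω) {E : Type v} [NormedAddCommGroup E] [NormedSpace ℝ E]
    [CompleteSpace E] (Y : ℤ → Ω → E) : Prop where
  measurePreserving : MeasurePreserving θ P P
  le : ℱ₀ ≤ m
  le_comap : ℱ₀ ≤ MeasurableSpace.comap θ ℱ₀
  aestronglyMeasurable_filt : ∀ j, AEStronglyMeasurable[filt ℱ₀ θ j] (Y j) P
  condExp_eq_zero : ∀ j, P[Y j | filt ℱ₀ θ (j - 1)] =ᵐ[P] 0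
  tsum_ne_top : ∑' j, eLpNorm (Y j) 2 P ≠ ∞

namespace IsHannanFamily

variable {Ω : Type u} {ℱ₀ m' : MeasurableSpace Ω} [m : MeasurableSpace Ω] {P : Measure Ω}
  [IsProbabilityMeasure P] {θ : Ω ≃ᵐ Ω} {E : Type v} [NormedAddCommGroup E] [NormedSpace ℝ E]
  [CompleteSpace E] {Y : ℤ → Ω → E} {f : E → ℝ} {D : ℝ}

theorem aestronglyMeasurable (h : IsHannanFamily ℱ₀ P θ Y) (j : ℤ) :
    AEStronglyMeasurable (Y j) P :=
  (h.aestronglyMeasurable_filt j).mono (filt_le h.measurePreserving h.le j)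

theorem memLp (h : IsHannanFamily ℱ₀ P θ Y) (j : ℤ) : MemLp (Y j) 2 P :=
  ⟨h.aestronglyMeasurable j, (ENNReal.le_tsum j).trans_lt h.tsum_ne_top.lt_top⟩

theorem integrable (h : IsHannanFamily ℱ₀ P θ Y) (j : ℤ) : Integrable (Y j) P :=
  (h.memLp j).integrable one_le_two

theorem tsum_eLpNorm_one_ne_top (h : IsHannanFamily ℱ₀ P θ Y) :
    ∑' j, eLpNorm (Y j) 1 P ≠ ∞ :=
  ((ENNReal.tsum_le_tsum fun j => eLpNorm_le_eLpNorm_of_exponent_le one_le_two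
    (h.aestronglyMeasurable j)).trans_lt h.tsum_ne_top.lt_top).ne

theorem ae_summable (h : IsHannanFamily ℱ₀ P θ Y) : ∀ᵐ ω ∂P, Summable fun j => Y j ω :=
  ae_summable_of_tsum_eLpNorm one_le_two h.aestronglyMeasurable h.tsum_ne_top

theorem memLp_tsum (h : IsHannanFamily ℱ₀ P θ Y) : MemLp (fun ω => ∑' j, Y j ω) 2 P :=
  _root_.memLp_tsum one_le_two ENNReal.ofNat_ne_top h.aestronglyMeasurable h.tsum_ne_top

theorem condExp_eq_self (h : IsHannanFamily ℱ₀ P θ Y) {j : ℤ} (hm' : m' ≤ m) (hle : filt ℱ₀ θ j ≤ m') : P[Y j | m'] =ᵐ[P] Y j :=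
  condExp_of_aestronglyMeasurable' hm' ((h.aestronglyMeasurable_filt j).mono hle) (h.integrable j)

theorem condExp_eq_zero_of_le (h : IsHannanFamily ℱ₀ P θ Y) {j : ℤ} (hle : m' ≤ filt ℱ₀ θ (j - 1)) : P[Y j | m'] =ᵐ[P] 0 := by
  have h1 := condExp_condExp_of_le (f := Y j) (μ := P) hle
    (filt_le h.measurePreserving h.le (j - 1))
  refine h1.symm.trans ((condExp_congr_ae (h.condExp_eq_zero j)).trans ?_)
  rw [show (0 : Ω → E) = fun _ => 0 from rfl, ← Pi.zero_def, condExp_zero]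

/-- Differences up to `n` are measurable and later ones are centred, so conditioning cuts the series
at `n`. -/
theorem ae_condExp_filt (h : IsHannanFamily ℱ₀ P θ Y) (n : ℤ) :
    P[fun ω => ∑' j, Y j ω | filt ℱ₀ θ n] =ᵐ[P]
      fun ω => ∑' j, (Set.Iic n).indicator (fun j => Y j ω) j := by
  refine (condExp_tsum h.aestronglyMeasurable h.tsum_eLpNorm_one_ne_top).trans ?_
  have hall : ∀ᵐ ω ∂P, ∀ j, P[Y j | filt ℱ₀ θ n] ω
      = (Set.Iic n).indicator (fun j => Y j ω) j := ae_all_iff.2 fun j => by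
    rcases le_or_gt j n with hj | hj
    · filter_upwards [h.condExp_eq_self (filt_le h.measurePreserving h.le n)
        (filt_mono h.le_comap hj)] with ω hω
      rw [hω, Set.indicator_of_mem (Set.mem_Iic.2 hj)]
    · filter_upwards [h.condExp_eq_zero_of_le
        (filt_mono h.le_comap (show n ≤ j - 1 by omega))] with ω hω
      rw [hω, Set.indicator_of_notMem (by simpa using hj), Pi.zero_apply]
  filter_upwards [hall] with ω hω
  exact tsum_congr hω

theorem proj_tsum (h : IsHannanFamily ℱ₀ P θ Y) (n : ℤ) :
    proj ℱ₀ P θ n (fun ω => ∑' j, Y j ω) =ᵐ[P] Y n := by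
  filter_upwards [h.ae_condExp_filt n, h.ae_condExp_filt (n - 1), h.ae_summable] with ω h1 h2 h3
  rw [proj, Pi.sub_apply, h1, h2, ← (h3.indicator _).tsum_sub (h3.indicator _)]
  refine (tsum_eq_single n fun j hj => ?_).trans ?_
  · rcases lt_or_gt_of_ne hj with hlt | hgt
    · rw [Set.indicator_of_mem (Set.mem_Iic.2 hlt.le),
        Set.indicator_of_mem (Set.mem_Iic.2 (by omega)), sub_self]
    · rw [Set.indicator_of_notMem (by simp [hgt]),
        Set.indicator_of_notMem (by simp only [Set.mem_Iic]; omega), sub_self]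
  · rw [Set.indicator_of_mem (Set.mem_Iic.2 le_rfl), Set.indicator_of_notMem (by simp), sub_zero]

/-- Termwise, `ℱ_{-∞} ⊆ ℱ_{j-1}` annihilates `Yⱼ` and `ℱ_∞ ⊇ ℱⱼ` fixes it. -/
theorem isRegularVar_tsum (h : IsHannanFamily ℱ₀ P θ Y) :
    IsRegularVar ℱ₀ P θ fun ω => ∑' j, Y j ω := by
  refine ⟨?_, Filter.EventuallyEq.symm ?_⟩
  · refine (condExp_tsum h.aestronglyMeasurable h.tsum_eLpNorm_one_ne_top).trans ?_
    filter_upwards [ae_all_iff.2 fun j => h.condExp_eq_zero_of_le (j := j)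
      (iInf_le (fun n => filt ℱ₀ θ n) (j - 1))] with ω hω
    simp [hω]
  · refine (condExp_tsum h.aestronglyMeasurable h.tsum_eLpNorm_one_ne_top).trans ?_
    filter_upwards [ae_all_iff.2 fun j => h.condExp_eq_self (j := j)
      (iSup_le fun n => filt_le h.measurePreserving h.le n)
      (le_iSup (fun n => filt ℱ₀ θ n) j)] with ω hω
    simp [hω]

theorem hannanNorm_tsum (h : IsHannanFamily ℱ₀ P θ Y) :
    hannanNorm ℱ₀ P θ (fun ω => ∑' j, Y j ω) = ∑' j, eLpNorm (Y j) 2 P :=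
  tsum_congr fun n => eLpNorm_congr_ae (h.proj_tsum n)

theorem comap_filt_sub_one (θ : Ω ≃ᵐ Ω) (j : ℤ) :
    (filt ℱ₀ θ (j - 1)).comap θ = filt ℱ₀ θ j := by
  have := comap_iter_filt (ℱ₀ := ℱ₀) θ (j - 1) 1
  rwa [iter_one, sub_add_cancel] at this

/-- The maximal inequality for a single stationary sequence of martingale differences. -/
theorem lintegral_maxIter_rpow_le (hf : SmoothMajorant f D) (hθ : MeasurePreserving θ P P)
    (hle : ℱ₀ ≤ m) (hc : ℱ₀ ≤ MeasurableSpace.comap θ ℱ₀) {V : Ω → E} {j : ℤ}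
    (hVm : AEStronglyMeasurable[filt ℱ₀ θ j] V P) (hV : MemLp V 2 P)
    (hV0 : P[V | filt ℱ₀ θ (j - 1)] =ᵐ[P] 0) {p : ℝ} (hp0 : 1 ≤ p) (hp : p < 2) :
    (∫⁻ ω, maxIter θ V ω ^ p ∂P) ^ (1 / p)
      ≤ ENNReal.ofReal (momentConst p * D) * eLpNorm V 2 P := by
  have e := comap_filt_sub_one (ℱ₀ := ℱ₀) θ j
  refine hf.lintegral_maxIter_rpow_le hθ (filt_le hθ hle (j - 1)) ?_ ?_ hV hV0 hp0 hp
  · rw [e]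
    exact filt_mono hc (by omega)
  · rw [e]
    exact hVm

theorem ae_summable_iterate (h : IsHannanFamily ℱ₀ P θ Y) :
    ∀ᵐ ω ∂P, ∀ k : ℕ, Summable fun j => Y j (θ^[k] ω) :=
  ae_all_iff.2 fun k => (h.measurePreserving.iterate k).quasiMeasurePreserving.ae h.ae_summable

/-- Markov passes to the strong `L^p` norm, where subadditivity of the maximal function and
Minkowski sum the bounds for the single `Yⱼ`. -/
theorem weakNorm_maxFun_tsum_le (h : IsHannanFamily ℱ₀ P θ Y) (hf : SmoothMajorant f D) {p : ℝ}
    (hp0 : 1 ≤ p) (hp : p < 2) :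
    weakNorm p P (maxFun θ fun ω => ∑' j, Y j ω)
      ≤ ENNReal.ofReal (momentConst p * D) * ∑' j, eLpNorm (Y j) 2 P := by
  have hm : ∀ j, AEMeasurable (maxIter θ (Y j)) P := fun j =>
    aemeasurable_maxIter h.measurePreserving (h.aestronglyMeasurable j)
  rw [maxFun_eq_maxIter, ← ENNReal.tsum_mul_left]
  refine (weakNorm_le_of_ae_le (W := fun ω => ∑' j, maxIter θ (Y j) ω) (by linarith)
    (AEMeasurable.tsum hm) ?_).trans ((eLpNorm_tsum_le_of_ennreal hp0 hm).trans
    (ENNReal.tsum_le_tsum fun j => ?_))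
  · filter_upwards [h.ae_summable_iterate] with ω hω using maxIter_tsum_le hω
  · exact lintegral_maxIter_rpow_le hf h.measurePreserving h.le h.le_comap
      (h.aestronglyMeasurable_filt j) (h.memLp j) (h.condExp_eq_zero j) hp0 hp

/-- The `n`-th term of the approximating martingale difference. -/
def shift (θ : Ω ≃ᵐ Ω) (Y : ℤ → Ω → E) (n : ℤ) : Ω → E := Y (1 - n) ∘ iter θ n

theorem aestronglyMeasurable_shift (h : IsHannanFamily ℱ₀ P θ Y) (n : ℤ) :
    AEStronglyMeasurable[filt ℱ₀ θ 1] (shift θ Y n) P := by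
  have := (h.aestronglyMeasurable_filt (1 - n)).comp_iter h.measurePreserving n
  rwa [sub_add_cancel] at this

theorem memLp_shift (h : IsHannanFamily ℱ₀ P θ Y) (n : ℤ) : MemLp (shift θ Y n) 2 P :=
  (h.memLp (1 - n)).comp_measurePreserving (h.measurePreserving.iter n)

theorem eLpNorm_shift (h : IsHannanFamily ℱ₀ P θ Y) (n : ℤ) :
    eLpNorm (shift θ Y n) 2 P = eLpNorm (Y (1 - n)) 2 P :=
  eLpNorm_comp_measurePreserving (h.aestronglyMeasurable (1 - n)) (h.measurePreserving.iter n)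

theorem condExp_shift (h : IsHannanFamily ℱ₀ P θ Y) (n : ℤ) :
    P[shift θ Y n | filt ℱ₀ θ 0] =ᵐ[P] 0 := by
  have h1 := condExp_comp_iter h.measurePreserving h.le (h.integrable (1 - n)) (1 - n - 1) n
  rw [show 1 - n - 1 + n = 0 by ring] at h1
  exact h1.trans ((h.measurePreserving.iter n).quasiMeasurePreserving.ae_eq_comp
    (h.condExp_eq_zero (1 - n)))

theorem tsum_eLpNorm_shift (h : IsHannanFamily ℱ₀ P θ Y) :
    ∑' n, eLpNorm (shift θ Y n) 2 P = ∑' j, eLpNorm (Y j) 2 P := by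
  simp_rw [h.eLpNorm_shift]
  exact (Equiv.subLeft (1 : ℤ)).tsum_eq fun j => eLpNorm (Y j) 2 P

theorem tsum_eLpNorm_shift_ne_top (h : IsHannanFamily ℱ₀ P θ Y) :
    ∑' n, eLpNorm (shift θ Y n) 2 P ≠ ∞ :=
  h.tsum_eLpNorm_shift ▸ h.tsum_ne_top

/-- By stationarity `P₁(X ∘ θⁿ) = (P_{1-n} X) ∘ θⁿ`, which explains the index `1 - n`. -/
theorem proj_one_tsum_comp (h : IsHannanFamily ℱ₀ P θ Y) (n : ℤ) :
    proj ℱ₀ P θ 1 ((fun ω => ∑' j, Y j ω) ∘ iter θ n) =ᵐ[P] shift θ Y n := by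
  have hi : Integrable (fun ω => ∑' j, Y j ω) P := h.memLp_tsum.integrable one_le_two
  have h1 := condExp_comp_iter h.measurePreserving h.le hi (1 - n) n
  have h2 := condExp_comp_iter h.measurePreserving h.le hi (1 - n - 1) n
  have h3 := (h.measurePreserving.iter n).quasiMeasurePreserving.ae_eq_comp (h.proj_tsum (1 - n))
  rw [sub_add_cancel] at h1
  rw [show 1 - n - 1 + n = 1 - 1 by ring] at h2
  filter_upwards [h1, h2, h3] with ω h4 h5 h6
  rw [proj, Pi.sub_apply, h4, h5]
  exact h6

/-- The maximal inequality at `p = 1` makes the expectation of the sum finite. -/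
theorem ae_tsum_maxIter_ne_top (hf : SmoothMajorant f D) (hθ : MeasurePreserving θ P P)
    (hle : ℱ₀ ≤ m) (hc : ℱ₀ ≤ MeasurableSpace.comap θ ℱ₀) {V : ℤ → Ω → E} {j : ℤ → ℤ}
    (hVm : ∀ n, AEStronglyMeasurable[filt ℱ₀ θ (j n)] (V n) P)
    (hV0 : ∀ n, P[V n | filt ℱ₀ θ (j n - 1)] =ᵐ[P] 0) (hV : ∑' n, eLpNorm (V n) 2 P ≠ ∞) :
    ∀ᵐ ω ∂P, ∑' n, maxIter θ (V n) ω ≠ ∞ := by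
  have hVm0 : ∀ n, AEStronglyMeasurable (V n) P := fun n => (hVm n).mono (filt_le hθ hle (j n))
  have hm : ∀ n, AEMeasurable (maxIter θ (V n)) P := fun n => aemeasurable_maxIter hθ (hVm0 n)
  have hlt : ∫⁻ ω, ∑' n, maxIter θ (V n) ω ∂P < ∞ := by
    rw [lintegral_tsum hm]
    refine (ENNReal.tsum_le_tsum fun n => ?_).trans_lt
      ((ENNReal.tsum_mul_left (a := ENNReal.ofReal (momentConst 1 * D))).trans_lt
        (ENNReal.mul_lt_top ENNReal.ofReal_lt_top hV.lt_top))
    have := lintegral_maxIter_rpow_le hf hθ hle hc (hVm n)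
      ⟨hVm0 n, (ENNReal.le_tsum n).trans_lt hV.lt_top⟩ (hV0 n) le_rfl one_lt_two
    simpa using this
  filter_upwards [ae_lt_top' (AEMeasurable.tsum hm) hlt.ne] with ω hω using hω.ne

/-- The martingale approximation of the partial sums, up to `o(√(n L(L(n))))`. -/
theorem ae_isLittleO_sum_sub (h : IsHannanFamily ℱ₀ P θ Y) (hf : SmoothMajorant f D) :
    ∀ᵐ ω ∂P, (fun n : ℕ => ∑ k ∈ Finset.range n, (∑' j, Y j (θ^[k] ω))
      - ∑ k ∈ Finset.range n, ∑' j, shift θ Y j (θ^[k] ω)) =o[atTop] lilNorm := by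
  have hfin1 : ∀ᵐ ω ∂P, ∑' n, maxIter θ (Y (1 - n)) ω ≠ ∞ :=
    ae_tsum_maxIter_ne_top hf h.measurePreserving h.le h.le_comap
      (fun n => h.aestronglyMeasurable_filt (1 - n)) (fun n => h.condExp_eq_zero (1 - n))
      (((Equiv.subLeft (1 : ℤ)).tsum_eq fun j => eLpNorm (Y j) 2 P).trans_ne h.tsum_ne_top)
  have hfin2 : ∀ᵐ ω ∂P, ∑' n, maxIter θ (shift θ Y n) ω ≠ ∞ :=
    ae_tsum_maxIter_ne_top hf h.measurePreserving h.le h.le_comap (j := fun _ => 1)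
      h.aestronglyMeasurable_shift (fun n => by simpa using h.condExp_shift n)
      h.tsum_eLpNorm_shift_ne_top
  have hsum : ∀ᵐ ω ∂P, ∀ k : ℕ, Summable fun j => shift θ Y j (θ^[k] ω) :=
    ae_all_iff.2 fun k => (h.measurePreserving.iterate k).quasiMeasurePreserving.ae
      (ae_summable_of_tsum_eLpNorm one_le_two (fun n => (h.memLp_shift n).1)
        h.tsum_eLpNorm_shift_ne_top)
  have hcob : ∀ᵐ ω ∂P, ∀ j : ℤ, (fun n : ℕ => ∑ k ∈ Finset.range n,
      (Y (1 - j) (θ^[k] ω) - shift θ Y j (θ^[k] ω))) =o[atTop] lilNorm :=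
    ae_all_iff.2 fun j => ae_isLittleO_sum_sub_comp_iter h.measurePreserving (h.memLp (1 - j)) j
  filter_upwards [hfin1, hfin2, h.ae_summable_iterate, hsum, hcob] with ω h1 h2 h3 h4 h5
  set w : ℤ → ℕ → E := fun j n => ∑ k ∈ Finset.range n,
    (Y (1 - j) (θ^[k] ω) - shift θ Y j (θ^[k] ω)) with hw
  have h3' : ∀ k : ℕ, Summable fun j => Y (1 - j) (θ^[k] ω) := fun k =>
    (Equiv.subLeft (1 : ℤ)).summable_iff.2 (h3 k)
  have e : ∀ n : ℕ, ∑ k ∈ Finset.range n, (∑' j, Y j (θ^[k] ω))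
      - ∑ k ∈ Finset.range n, ∑' j, shift θ Y j (θ^[k] ω) = ∑' j, w j n := fun n => by
    rw [hw, Summable.tsum_finsetSum fun k _ => (h3' k).sub (h4 k), ← Finset.sum_sub_distrib]
    refine Finset.sum_congr rfl fun k _ => ?_
    rw [(h3' k).tsum_sub (h4 k)]
    congr 1
    exact ((Equiv.subLeft (1 : ℤ)).tsum_eq fun j => Y j (θ^[k] ω)).symm
  simp_rw [e]
  have hpos : ∀ᶠ n : ℕ in atTop, 0 < lilNorm n := by
    filter_upwards [eventually_ge_atTop 1] with n hn using lilNorm_pos hn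
  -- Dominated convergence over `j`: each normalised coboundary sum tends to zero, and the maximal
  -- functions bound it uniformly in `n` by a summable family.
  have hlim : Tendsto (fun n : ℕ => ∑' j, (lilNorm n)⁻¹ • w j n) atTop (𝓝 (∑' _ : ℤ, (0 : E))) := by
    refine tendsto_tsum_of_dominated_convergence
      (bound := fun j => (maxIter θ (Y (1 - j)) ω).toReal + (maxIter θ (shift θ Y j) ω).toReal)
      ((ENNReal.summable_toReal h1).add (ENNReal.summable_toReal h2)) (fun j => ?_) ?_
    · exact (h5 j).tendsto_inv_smul_nhds_zero
    · filter_upwards [eventually_ge_atTop 1] with n hn j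
      have hb : ∀ V : Ω → E, maxIter θ V ω ≠ ∞ →
          ‖∑ k ∈ Finset.range n, V (θ^[k] ω)‖ / lilNorm n ≤ (maxIter θ V ω).toReal := fun V hV =>
        (ENNReal.ofReal_le_iff_le_toReal hV).1 (norm_sum_div_lilNorm_le_maxIter V hn ω)
      rw [norm_smul, norm_inv, Real.norm_of_nonneg (lilNorm_pos hn).le, inv_mul_eq_div, hw]
      simp only [Finset.sum_sub_distrib]
      refine (div_le_div_of_nonneg_right (norm_sub_le _ _) (lilNorm_pos hn).le).trans ?_
      rw [add_div]
      exact add_le_add (hb _ (ENNReal.ne_top_of_tsum_ne_top h1 j))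
        (hb _ (ENNReal.ne_top_of_tsum_ne_top h2 j))
  simp only [tsum_zero, tsum_const_smul''] at hlim
  refine Asymptotics.isLittleO_norm_left.1 ((Asymptotics.isLittleO_iff_tendsto' ?_).2 ?_)
  · filter_upwards [hpos] with n hn h0
    exact absurd h0 hn.ne'
  · refine (tendsto_zero_iff_norm_tendsto_zero.1 hlim).congr' ?_
    filter_upwards [hpos] with n hn
    rw [norm_smul, norm_inv, Real.norm_of_nonneg hn.le, inv_mul_eq_div]

theorem exists_martingale_approximation (h : IsHannanFamily ℱ₀ P θ Y) (hf : SmoothMajorant f D) :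
    ∃ d : Ω → E, StronglyMeasurable[filt ℱ₀ θ 1] d ∧ MemLp d 2 P ∧
      Tendsto (fun s : Finset ℤ => eLpNorm
        (∑ n ∈ s, proj ℱ₀ P θ 1 ((fun ω => ∑' j, Y j ω) ∘ iter θ n) - d) 2 P) atTop (𝓝 0) ∧
      P[d | ℱ₀] =ᵐ[P] 0 ∧
      ∀ᵐ ω ∂P, (fun n : ℕ => partialSum θ (fun ω => ∑' j, Y j ω) n ω - partialSum θ d n ω)
        =o[atTop] lilNorm := by
  have hm : ∀ n, AEStronglyMeasurable (shift θ Y n) P := fun n => (h.memLp_shift n).1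
  have hs1 : ∑' n, eLpNorm (shift θ Y n) 1 P ≠ ∞ :=
    ((ENNReal.tsum_le_tsum fun n => eLpNorm_le_eLpNorm_of_exponent_le one_le_two
      (hm n)).trans_lt h.tsum_eLpNorm_shift_ne_top.lt_top).ne
  set d' : Ω → E := fun ω => ∑' n, shift θ Y n ω with hd'
  have hle1 := filt_le h.measurePreserving h.le 1
  have hd'2 : MemLp d' 2 P :=
    _root_.memLp_tsum one_le_two ENNReal.ofNat_ne_top hm h.tsum_eLpNorm_shift_ne_top
  have hd : P[d' | filt ℱ₀ θ 1] =ᵐ[P] d' := by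
    refine (condExp_tsum hm hs1).trans ?_
    filter_upwards [ae_all_iff.2 fun n => condExp_of_aestronglyMeasurable' hle1
      (h.aestronglyMeasurable_shift n) ((h.memLp_shift n).integrable one_le_two)] with ω hω
    exact tsum_congr hω
  -- Conditioning selects a version that is `ℱ₁`-measurable everywhere, not merely up to a null set.
  refine ⟨P[d' | filt ℱ₀ θ 1], stronglyMeasurable_condExp, (memLp_congr_ae hd).2 hd'2, ?_, ?_, ?_⟩
  · refine (tendsto_eLpNorm_sum_sub_tsum one_le_two ENNReal.ofNat_ne_top hm
      h.tsum_eLpNorm_shift_ne_top).congr fun s => eLpNorm_congr_ae ?_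
    filter_upwards [hd, ae_all_iff.2 h.proj_one_tsum_comp] with ω h1 h2
    simp only [Pi.sub_apply, Finset.sum_apply, h2]
    rw [h1]
  · have h0 : P[d' | filt ℱ₀ θ 0] =ᵐ[P] 0 := by
      refine (condExp_tsum hm hs1).trans ?_
      filter_upwards [ae_all_iff.2 h.condExp_shift] with ω hω
      simp [hω]
    have := (condExp_condExp_of_le (f := d') (μ := P) (filt_mono h.le_comap zero_le_one) hle1).trans
      h0
    rwa [filt_zero] at this
  · have hdk : ∀ᵐ ω ∂P, ∀ k : ℕ, P[d' | filt ℱ₀ θ 1] (θ^[k] ω) = d' (θ^[k] ω) :=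
      ae_all_iff.2 fun k => (h.measurePreserving.iterate k).quasiMeasurePreserving.ae hd
    filter_upwards [hdk, h.ae_isLittleO_sum_sub hf] with ω h1 h2
    simp only [partialSum_eq_sum_iterate, h1]
    exact h2

end IsHannanFamily

/-! ### The linear process as a Hannan family. -/

section LinearProcess

variable {Ω : Type u} {ℱ₀ : MeasurableSpace Ω} [m : MeasurableSpace Ω] {P : Measure Ω}
  {θ : Ω ≃ᵐ Ω} {E : Type v} [NormedAddCommGroup E] [NormedSpace ℝ E]
  {ξ : Ω → E} {A : ℤ → Ω → E →L[ℝ] E}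

/-- The term of the linear process at time `0` carried by the innovation `ξ_j`. -/
def innovationTerm (θ : Ω ≃ᵐ Ω) (A : ℤ → Ω → E →L[ℝ] E) (ξ : Ω → E) (j : ℤ) (ω : Ω) : E :=
  A (-j) ω (ξ (iter θ j ω))

theorem innovationTerm_neg_iter (θ : Ω ≃ᵐ Ω) (A : ℤ → Ω → E →L[ℝ] E) (ξ : Ω → E) (n i : ℤ)
    (ω : Ω) : innovationTerm θ A ξ (-i) (iter θ n ω) = A i (iter θ n ω) (ξ (iter θ (n - i) ω)) := by
  rw [innovationTerm, neg_neg, ← iter_add, neg_add_eq_sub]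

theorem linearProcess_eq_comp (θ : Ω ≃ᵐ Ω) (A : ℤ → Ω → E →L[ℝ] E) (ξ : Ω → E) (n : ℤ) :
    linearProcess θ A ξ n = (fun ω => ∑' j, innovationTerm θ A ξ j ω) ∘ iter θ n := by
  funext ω
  simp only [linearProcess, ← innovationTerm_neg_iter, Function.comp_apply]
  exact (Equiv.neg ℤ).tsum_eq fun j => innovationTerm θ A ξ j (iter θ n ω)

theorem eLpNorm_innovationTerm_le (hθ : MeasurePreserving θ P P) (hξ : AEStronglyMeasurable ξ P)
    (j : ℤ) :
    eLpNorm (innovationTerm θ A ξ j) 2 P ≤ eLpNorm (A (-j)) ∞ P * eLpNorm ξ 2 P := by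
  rcases eq_or_ne (eLpNorm (A (-j)) ∞ P) ∞ with htop | htop
  -- Since `∞ * 0 = 0`, an infinite operator norm makes the bound trivial only when `ξ` is not
  -- almost surely zero.
  · rcases eq_or_ne (eLpNorm ξ 2 P) 0 with h0 | h0
    · have h1 := (eLpNorm_eq_zero_iff hξ two_ne_zero).1 h0
      have h2 : innovationTerm θ A ξ j =ᵐ[P] 0 := by
        filter_upwards [(hθ.iter j).quasiMeasurePreserving.ae h1] with ω hω
        simp [innovationTerm, hω]
      rw [eLpNorm_congr_ae h2]
      simp
    · simp [htop, ENNReal.top_mul h0]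
  · rw [← eLpNorm_comp_measurePreserving hξ (hθ.iter j), ← ENNReal.coe_toNNReal htop]
    refine (eLpNorm_le_nnreal_smul_eLpNorm_of_ae_le_mul (f := innovationTerm θ A ξ j)
      (g := ξ ∘ iter θ j) (c := (eLpNorm (A (-j)) ∞ P).toNNReal) ?_ 2).trans (le_of_eq ?_)
    · have hA : ∀ᵐ ω ∂P, ‖A (-j) ω‖ₑ ≤ eLpNorm (A (-j)) ∞ P := by
        rw [eLpNorm_exponent_top]
        exact ae_le_eLpNormEssSup
      filter_upwards [hA] with ω hω
      have h1 : ‖innovationTerm θ A ξ j ω‖ₑ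
          ≤ ((eLpNorm (A (-j)) ∞ P).toNNReal : ℝ≥0∞) * ‖ξ (iter θ j ω)‖ₑ := by
        rw [ENNReal.coe_toNNReal htop]
        exact ((A (-j) ω).le_opENorm _).trans (mul_le_mul' hω le_rfl)
      simp only [enorm_eq_nnnorm] at h1
      exact_mod_cast h1
    · rw [ENNReal.smul_def, smul_eq_mul]

variable [IsProbabilityMeasure P] [CompleteSpace E]

/-- `A₋ⱼ` is `ℱ_{j-1}`-measurable, so it leaves the conditional expectation given `ℱ_{j-1}` and
meets the centred `ξⱼ`; summability is that of the operator norms. -/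
theorem isHannanFamily_innovationTerm (hθ : MeasurePreserving θ P P) (hle : ℱ₀ ≤ m)
    (hc : ℱ₀ ≤ MeasurableSpace.comap θ ℱ₀) (hξ : MemLp ξ 2 P) (hξm : AEStronglyMeasurable[ℱ₀] ξ P)
    (hξ0 : P[ξ | filt ℱ₀ θ (-1)] =ᵐ[P] 0)
    (hA : ∀ (i : ℤ) (x : E), AEStronglyMeasurable[filt ℱ₀ θ (-i - 1)] (fun ω => A i ω x) P)
    (hs : ∑' i : ℤ, eLpNorm (A i) ∞ P < ∞) :
    IsHannanFamily ℱ₀ P θ (innovationTerm θ A ξ) := by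
  have hA' : ∀ (j : ℤ) (x : E), AEStronglyMeasurable[filt ℱ₀ θ (j - 1)] (fun ω => A (-j) ω x) P :=
    fun j x => by
      have := hA (-j) x
      rwa [neg_neg] at this
  have hξj : ∀ j, AEStronglyMeasurable[filt ℱ₀ θ j] (ξ ∘ iter θ j) P := fun j => by
    have h0 : AEStronglyMeasurable[filt ℱ₀ θ 0] ξ P := by rwa [filt_zero]
    have := h0.comp_iter hθ j
    rwa [zero_add] at this
  have hfin : ∀ j, eLpNorm (A (-j)) ∞ P ≠ ∞ := fun j =>
    ((ENNReal.le_tsum (-j)).trans_lt hs).ne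
  refine ⟨hθ, hle, hc, fun j => ?_, fun j => ?_, ?_⟩
  · exact aestronglyMeasurable_clm_apply (filt_le hθ hle j)
      (fun x => (hA' j x).mono (filt_mono hc (by omega))) (hξj j)
  · have hξi : Integrable ξ P := hξ.integrable one_le_two
    have h1 := condExp_comp_iter hθ hle hξi (-1) j
    rw [neg_add_eq_sub] at h1
    have hb : ∀ᵐ ω ∂P, ‖A (-j) ω‖ₑ ≤ ((eLpNorm (A (-j)) ∞ P).toNNReal : ℝ≥0∞) := by
      rw [ENNReal.coe_toNNReal (hfin j), eLpNorm_exponent_top]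
      exact ae_le_eLpNormEssSup
    have h2 := condExp_clm_apply (filt_le hθ hle (j - 1)) (hA' j) hb
      ((hθ.iter j).integrable_comp_of_integrable hξi)
    have h3 := (hθ.iter j).quasiMeasurePreserving.ae_eq_comp hξ0
    refine EventuallyEq.trans h2 ?_
    filter_upwards [h1, h3] with ω h4 h5
    rw [h4, h5]
    simp
  · refine ((ENNReal.tsum_le_tsum fun j => eLpNorm_innovationTerm_le hθ hξ.1 j).trans_lt ?_).ne
    rw [ENNReal.tsum_mul_right]
    exact ENNReal.mul_lt_top (((Equiv.neg ℤ).tsum_eq fun i => eLpNorm (A i) ∞ P).trans_lt hs) hξ.2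

end LinearProcess

/-! ### The main theorem. -/

theorem mainTheorem7 :
    ∃ C : ℝ → ℝ, (∀ p : ℝ, 1 ≤ p → p < 2 → 0 < C p) ∧
    ∀ (Ω : Type u) (ℱ₀ : MeasurableSpace Ω) [m : MeasurableSpace Ω] (P : Measure Ω) [IsProbabilityMeasure P]
      (E : Type v) [NormedAddCommGroup E] [NormedSpace ℝ E] [CompleteSpace E]
      [SecondCountableTopology E]
      (θ : Ω ≃ᵐ Ω)
      (ξ : Ω → E) (A : ℤ → Ω → E →L[ℝ] E),
      IsTwoSmooth E →
      MeasurePreserving θ P P →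
      ℱ₀ ≤ m → ℱ₀ ≤ MeasurableSpace.comap θ ℱ₀ →
      -- `ξ ∈ L²(ℱ 0)` with `𝔼(ξ | ℱ (-1)) = 0`
      MemLp ξ 2 P → AEStronglyMeasurable[ℱ₀] ξ P → P[ξ | filt ℱ₀ θ (-1)] =ᵐ[P] 0 →
      -- predictable coefficients
      (∀ (i : ℤ) (x : E), AEStronglyMeasurable[filt ℱ₀ θ (-i - 1)] (fun ω => A i ω x) P) →
      ∑' i : ℤ, eLpNorm (A i) ∞ P < ∞ →
      -- the process is well defined in `L²`
      (∀ n : ℤ,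
        (∀ᵐ ω ∂P, Summable fun i : ℤ => A i (iter θ n ω) (ξ (iter θ (n - i) ω))) ∧
        MemLp (linearProcess θ A ξ n) 2 P ∧
        Tendsto (fun s : Finset ℤ => eLpNorm (fun ω =>
            ∑ i ∈ s, A i (iter θ n ω) (ξ (iter θ (n - i) ω)) - linearProcess θ A ξ n ω) 2 P)
          atTop (𝓝 0) ∧
        linearProcess θ A ξ n = linearProcess θ A ξ 0 ∘ iter θ n) ∧
      -- `X₀` is regular and satisfies the Hannan condition
      IsRegularVar ℱ₀ P θ (linearProcess θ A ξ 0) ∧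
      hannanNorm ℱ₀ P θ (linearProcess θ A ξ 0) < ∞ ∧
      -- the maximal inequality
      (∀ D : ℝ, 1 ≤ D → MartingaleInequality.{u, v} E D → ∀ p : ℝ, 1 ≤ p → p < 2 →
        weakNorm p P (maxFun θ (linearProcess θ A ξ 0))
          ≤ ENNReal.ofReal (C p * D) * hannanNorm ℱ₀ P θ (linearProcess θ A ξ 0)) ∧
      -- the martingale approximation
      ∃ d : Ω → E,
        StronglyMeasurable[filt ℱ₀ θ 1] d ∧ MemLp d 2 P ∧
        Tendsto (fun s : Finset ℤ => eLpNorm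
            (∑ n ∈ s, proj ℱ₀ P θ 1 (linearProcess θ A ξ n) - d) 2 P) atTop (𝓝 0) ∧
        P[d | ℱ₀] =ᵐ[P] 0 ∧
        ∀ᵐ ω ∂P,
          (fun n : ℕ => partialSum θ (linearProcess θ A ξ 0) n ω - partialSum θ d n ω)
            =o[atTop] lilNorm := by
  refine ⟨momentConst, fun p hp _ => zero_lt_one.trans_le (one_le_momentConst p), ?_⟩
  intro Ω ℱ₀ m P _ E _ _ _ _ θ ξ A hE hθ hle hc hξ hξm hξ0 hA hs
  have h := isHannanFamily_innovationTerm hθ hle hc hξ hξm hξ0 hA hs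
  have h0 : linearProcess θ A ξ 0 = fun ω => ∑' j, innovationTerm θ A ξ j ω := by
    rw [linearProcess_eq_comp, iter_zero, Function.comp_id]
  obtain ⟨L, hL, hLE⟩ := hE
  refine ⟨fun n => ⟨?_, ?_, ?_, ?_⟩, ?_, ?_, ?_, ?_⟩
  · filter_upwards [(hθ.iter n).quasiMeasurePreserving.ae h.ae_summable] with ω hω
    simp only [← innovationTerm_neg_iter]
    exact (Equiv.neg ℤ).summable_iff.2 hω
  · rw [linearProcess_eq_comp]
    exact h.memLp_tsum.comp_measurePreserving (hθ.iter n)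
  · have hn : ∑' i, eLpNorm (innovationTerm θ A ξ (-i) ∘ iter θ n) 2 P ≠ ∞ := by
      simp only [fun i => eLpNorm_comp_measurePreserving (p := 2) (h.aestronglyMeasurable (-i))
        (hθ.iter n)]
      exact ((Equiv.neg ℤ).tsum_eq fun i => eLpNorm (innovationTerm θ A ξ i) 2 P).trans_ne
        h.tsum_ne_top
    have := tendsto_eLpNorm_sum_sub_tsum one_le_two ENNReal.ofNat_ne_top
      (fun i => (h.aestronglyMeasurable (-i)).comp_measurePreserving (hθ.iter n)) hn
    simpa only [Function.comp_apply, innovationTerm_neg_iter] using! this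
  · rw [h0, linearProcess_eq_comp]
  · rw [h0]
    exact h.isRegularVar_tsum
  · rw [h0, h.hannanNorm_tsum]
    exact h.tsum_ne_top.lt_top
  · intro D hD hM p hp0 hp
    rw [h0, h.hannanNorm_tsum]
    -- The Burkholder-type majorant has the martingale constant `D` itself, so the bound is linear
    -- in `D` and independent of the smoothness constant `L`.
    exact h.weakNorm_maxFun_tsum_le (hM.smoothMajorant hD) hp0 hp
  -- No martingale constant is given here; only finiteness of the bounds matters, so `‖·‖ ^ 2` with
  -- constant `L` serves as majorant.
  · obtain ⟨d, h1, h2, h3, h4, h5⟩ :=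
      h.exists_martingale_approximation (smoothMajorant_norm_sq hL hLE)
    refine ⟨d, h1, h2, ?_, h4, ?_⟩
    · simpa only [linearProcess_eq_comp] using h3
    · rw [h0]
      exact h5
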